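/- Let $v_1,\dots,v_n$ ($n\ge 3$, indices mod $n$) be the vertices of a simple polygon in the plane: consecutive vertices are distinct, consecutive edges $\overline{v_{i-1}v_i}$, $\overline{v_iv_{i+1}}$ meet only at $v_i$, and non-consecutive edges are disjoint. Let $\partial P$ be the union of the edges, and let $P$ be the closed region consisting of $\partial P$ and the bounded part of the plane that it encloses. A vertex of $P$ is called reflex if its interior angle $\theta\in(0,2\pi)$ satisfies $\theta\ge\pi$. Let $m\ge 4$, and let $\partial P$ be partitioned into polygonal paths $B_1,\dots,B_m$, each consisting of successive edges of $P$ and running from one vertex of $P$ to a different one, where no two of the paths have a common interior point (an interior point of a path is a point of it other than its two endpoints), such that $$\bigcup_{k=1}^m B_k=\partial P,\qquad B_k\cap B_{k+1}=\{w_k\}\ (1\le k\le m-1),\qquad B_m\cap B_1=\{w_m\}$$ for distinct vertices $w_1,\dots,w_m$ of $P$. Suppose that each $B_k$ is outward convex, i.e. every vertex of $P$ that is an interior point of $B_k$ is reflex. Then there is a non-adjacent pair $(B_i,B_j)$, i.e. one with $B_i\cap B_j=\emptyset$, that is strongly mutually visible in $P$: there are interior points $p$ of $B_i$ and $q$ of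 $B_j$ such that the segment $\overline{pq}$ is contained in $P$ and intersects $\partial P$ only at its endpoints $p$ and $q$. -/

import Mathlib

/-- The Euclidean plane. -/
abbrev Plane : Type := EuclideanSpace ℝ (Fin 2)

namespace Polygon

variable {n : ℕ}

/-- A simple polygon with `n` vertices: a closed polygonal path in the plane with at least three
edges, none of them reduced to a point, such that non-consecutive edges are disjoint and
consecutive edges meet only at their common vertex. -/
structure IsSimple (P : Polygon Plane n) : Prop where
  three_le : 3 ≤ n
  nondegenerate : P.HasNondegenerateEdges
  consecutive : ∀ i : Fin n,
    P.edgeSet ℝ i ∩ P.edgeSet ℝ (finRotate n i) = {P (finRotate n i)}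
  nonconsecutive : ∀ i j : Fin n, i ≠ j → j ≠ finRotate n i → i ≠ finRotate n j →
    Disjoint (P.edgeSet ℝ i) (P.edgeSet ℝ j)

/-- The open set enclosed by the polygon: the points off the boundary whose connected component
in the complement of the boundary is bounded. -/
def enclosed (P : Polygon Plane n) : Set Plane :=
  {x | x ∉ P.boundary ℝ ∧ Bornology.IsBounded (connectedComponentIn (P.boundary ℝ)ᶜ x)}

/-- The polygon as a closed region of the plane: its boundary and what the boundary encloses. -/
def region (P : Polygon Plane n) : Set Plane :=
  P.boundary ℝ ∪ P.enclosed

/-- The points close to the vertex `P i` on the ray from `P i` to the midpoint of the two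
neighbouring vertices belong to the polygon. This ray runs inside the smaller of the two angular
sectors spanned at `P i` by the two edges, unless the edges are opposite. -/
def SmallSectorInward (P : Polygon Plane n) (i : Fin n) : Prop :=
  ∀ᶠ t : ℝ in nhdsWithin 0 (Set.Ioi 0),
    AffineMap.lineMap (P i)
      (midpoint ℝ (P ((finRotate n).symm i)) (P (finRotate n i))) t ∈ P.region

open Classical in
/-- The inward-facing angle, between `0` and `2π`, of the two edges at the vertex `P i`: it is the
unoriented angle of the two edges if the smaller sector faces the inside of the polygon, and the
complementary angle to `2π` otherwise (both are `π` at a flat vertex). -/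
noncomputable def interiorAngle (P : Polygon Plane n) (i : Fin n) : ℝ :=
  if P.SmallSectorInward i then
    EuclideanGeometry.angle (P ((finRotate n).symm i)) (P i) (P (finRotate n i))
  else
    2 * Real.pi -
      EuclideanGeometry.angle (P ((finRotate n).symm i)) (P i) (P (finRotate n i))

/-- A vertex is reflex if its interior angle is at least `π`. -/
def IsReflex (P : Polygon Plane n) (i : Fin n) : Prop :=
  Real.pi ≤ P.interiorAngle i

/-- A polygonal path in the boundary of an `n`-gon, which runs from one vertex to another:
it consists of `len` successive edges, the first one starting at the vertex `start`. -/
structure BoundaryPath (n : ℕ) where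
  start : Fin n
  len : ℕ
  one_le_len : 1 ≤ len
  len_lt : len < n

namespace BoundaryPath

/-- The index of the `k`-th vertex of the path, for `k = 0, …, len`. -/
def idx (B : BoundaryPath n) (k : ℕ) : Fin n :=
  (finRotate n)^[k] B.start

/-- The path as a set of points: the union of its edges. -/
def carrier (P : Polygon Plane n) (B : BoundaryPath n) : Set Plane :=
  ⋃ k ∈ Finset.range B.len, P.edgeSet ℝ (B.idx k)

/-- The interior of the path: the path without its two endpoints. -/
def inner (P : Polygon Plane n) (B : BoundaryPath n) : Set Plane :=
  B.carrier P \ {P (B.idx 0), P (B.idx B.len)}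

/-- A path in the boundary is outward convex if all its interior vertices are reflex. -/
def OutwardConvex (P : Polygon Plane n) (B : BoundaryPath n) : Prop :=
  ∀ k : ℕ, 0 < k → k < B.len → P.IsReflex (B.idx k)

end BoundaryPath

/-- Strong mutual visibility of two paths in the boundary: some segment from an interior point of
one to an interior point of the other lies in the polygon and meets the boundary only at the
endpoints of the segment. -/
def StronglyMutuallyVisible (P : Polygon Plane n) (B B' : BoundaryPath n) : Prop :=
  ∃ p ∈ B.inner P, ∃ p' ∈ B'.inner P,
    segment ℝ p p' ⊆ P.region ∧ segment ℝ p p' ∩ P.boundary ℝ = {p, p'}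

/-- The boundary is partitioned into the paths `B 0, …, B (m - 1)`: they cover it, they do not
overlap (no two of them share interior points), and cyclically consecutive ones, `B k` and
`B (k + 1)`, meet exactly in the vertex `P (v k)`, where these vertices are distinct. -/
structure IsPartition (P : Polygon Plane n) {m : ℕ} (B : Fin m → BoundaryPath n)
    (v : Fin m → Fin n) : Prop where
  distinct : Function.Injective (fun k => P (v k))
  cover : ⋃ k, (B k).carrier P = P.boundary ℝ
  nonoverlap : ∀ k l : Fin m, k ≠ l → Disjoint ((B k).inner P) ((B l).inner P)
  meet : ∀ k : Fin m, (B k).carrier P ∩ (B (finRotate m k)).carrier P = {P (v k)}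

end Polygon

/-! Suppose that only paths with a common point see each other. Adjacency of the paths is a cycle of
length `m ≥ 4`, so every path has exactly two neighbours and no three different paths are pairwise
adjacent (`Labelling.no_triangle`). Everything is played off against this missing triangle.

An outward convex path never sees itself (`IsChord.exists_convex`). A chord between two of its edges
would cut off an arc all of whose vertices are reflex. Take a centre from which this arc reaches
farther than the ends of the chord, and let `b` be the farthest vertex of the arc. The polygon
continues just beyond `b`, because `b` is reflex. But the cycle formed by the arc and the chord does
not wind around points there, and the complementary cycle winds around them an even number of times,
so such points cannot be inside.

A vertex where two paths meet is convex (`Counterexample.convex_corner`): otherwise both edges at it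
would see a common point, whose path would complete a triangle. Near a convex corner the two edges
see each other, so the first edge of a path sees the previous path and the last edge sees the next
one. At a reflex vertex within the path both edges see a common point, so neighbouring edges see a
common path. Hence some edge sees both the previous and the next path, and by connectedness so does
a single point `p` of it, which may be chosen generic (`exists_generic`).

Now rotate a ray about `p` from one of these sightings to the other. The edge that it hits first
changes only when the ray passes a vertex (`Oriented.exists_linked`). The two edges involved then
meet at this vertex, or one of them is at a non-convex vertex that sees the other along the ray. In
either case their paths are equal or adjacent. Both are neighbours of the path of `p`, so without
triangles they are equal. The path hit by the ray therefore never changes, although it has to turn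
from the previous path into the next one (`Counterexample.false`).

The topology rests on winding numbers computed as sums of viewing angles. The interior is the set of
points with odd winding number. `SimpleVertices.exists_winding` shows that the number jumps by one
across every edge in the same sense, which describes the interior near all edges and vertices
without the Jordan curve theorem. -/

namespace PolygonVisibility

open Complex Filter Topology

/-! ### Winding numbers of cycles of segments. -/

/-- The cross product of two plane vectors. -/
def cross (a b : ℂ) : ℝ := a.re * b.im - a.im * b.re

lemma cross_add_right (a b c : ℂ) : cross a (b + c) = cross a b + cross a c := by
  simp [cross]; ring

lemma cross_smul_right (a b : ℂ) (t : ℝ) : cross a (t * b) = t * cross a b := by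
  simp [cross]; ring

lemma continuous_cross {X : Type*} [TopologicalSpace X] {f g : X → ℂ} (hf : Continuous f)
    (hg : Continuous g) : Continuous fun x => cross (f x) (g x) := by
  unfold cross
  have h1 := continuous_re.comp hf
  have h2 := continuous_im.comp hf
  have h3 := continuous_re.comp hg
  have h4 := continuous_im.comp hg
  exact (h1.mul h4).sub (h2.mul h3)

lemma continuous_cross_sub (a b : ℂ) : Continuous fun y : ℂ => cross a (y - b) :=
  continuous_cross continuous_const (continuous_id.sub continuous_const)

/-- The signed angle under which a directed segment is seen from a point. -/
noncomputable def viewAngle (x : ℂ) (e : ℂ × ℂ) : ℝ := arg ((e.2 - x) / (e.1 - x))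

/-- The union of a family of segments. -/
def trace (E : Multiset (ℂ × ℂ)) : Set ℂ := {x | ∃ e ∈ E, x ∈ segment ℝ e.1 e.2}

/-- A family of directed segments is a cycle if it has no boundary. -/
def IsCycle (E : Multiset (ℂ × ℂ)) : Prop :=
  ∀ f : ℂ → ℝ, (E.map fun e => f e.2 - f e.1).sum = 0

/-- The total angle under which a family of directed segments is seen from a point. -/
noncomputable def totalAngle (E : Multiset (ℂ × ℂ)) (x : ℂ) : ℝ := (E.map (viewAngle x)).sum

/-- The winding number of a cycle about a point. -/
noncomputable def winding (E : Multiset (ℂ × ℂ)) (x : ℂ) : ℤ :=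
  round (totalAngle E x / (2 * Real.pi))

@[simp] lemma totalAngle_cons (e : ℂ × ℂ) (F : Multiset (ℂ × ℂ)) (x : ℂ) :
    totalAngle (e ::ₘ F) x = viewAngle x e + totalAngle F x := by
  simp [totalAngle]

@[simp] lemma totalAngle_zero (x : ℂ) : totalAngle 0 x = 0 := by simp [totalAngle]

@[simp] lemma mem_trace_cons {e : ℂ × ℂ} {F : Multiset (ℂ × ℂ)} {x : ℂ} :
    x ∈ trace (e ::ₘ F) ↔ x ∈ segment ℝ e.1 e.2 ∨ x ∈ trace F := by
  simp [trace]

lemma isClosed_segment_complex (a b : ℂ) : IsClosed (segment ℝ a b) := by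
  rw [← convexHull_pair]
  exact ((Set.toFinite {a, b}).isCompact_convexHull ℝ).isClosed

lemma isClosed_trace (E : Multiset (ℂ × ℂ)) : IsClosed (trace E) := by
  induction E using Multiset.induction with
  | empty => simp [trace]
  | cons e E ih =>
    have : trace (e ::ₘ E) = segment ℝ e.1 e.2 ∪ trace E := by ext; simp
    rw [this]
    exact (isClosed_segment_complex _ _).union ih

lemma ne_of_notMem_trace {E : Multiset (ℂ × ℂ)} {x : ℂ} (hx : x ∉ trace E) {e : ℂ × ℂ}
    (he : e ∈ E) : e.1 ≠ x ∧ e.2 ≠ x := by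
  constructor
  · rintro rfl; exact hx ⟨e, he, left_mem_segment ..⟩
  · rintro rfl; exact hx ⟨e, he, right_mem_segment ..⟩

/-- Modulo 2π each viewing angle is a difference of arguments at the two ends, and such differences
cancel around a cycle. -/
lemma totalAngle_coe {E : Multiset (ℂ × ℂ)} (hE : IsCycle E) {x : ℂ} (hx : x ∉ trace E) :
    (totalAngle E x : Real.Angle) = 0 := by
  have h1 : ∀ F : Multiset (ℂ × ℂ), F ≤ E → (totalAngle F x : Real.Angle) =
      (((F.map fun e => arg (e.2 - x) - arg (e.1 - x)).sum : ℝ) : Real.Angle) := by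
    intro F
    induction F using Multiset.induction with
    | empty => intro _; simp
    | cons e F ih =>
      intro hF
      have he : e ∈ E := Multiset.mem_of_le hF (Multiset.mem_cons_self _ _)
      have h2 := ne_of_notMem_trace hx he
      rw [totalAngle_cons, Real.Angle.coe_add, ih ((Multiset.le_cons_self _ _).trans hF)]
      simp only [Multiset.map_cons, Multiset.sum_cons, Real.Angle.coe_add, Real.Angle.coe_sub]
      rw [viewAngle, arg_div_coe_angle (sub_ne_zero.2 h2.2) (sub_ne_zero.2 h2.1)]
  rw [h1 E le_rfl, hE fun y => arg (y - x)]
  simp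

lemma totalAngle_eq {E : Multiset (ℂ × ℂ)} (hE : IsCycle E) {x : ℂ} (hx : x ∉ trace E) :
    totalAngle E x = 2 * Real.pi * winding E x := by
  have h := totalAngle_coe hE hx
  rw [← Real.Angle.coe_zero, Real.Angle.angle_eq_iff_two_pi_dvd_sub] at h
  obtain ⟨k, hk⟩ := h
  have h3 : totalAngle E x / (2 * Real.pi) = k := by
    field_simp
    linarith
  rw [winding, h3, round_intCast]
  linarith

lemma winding_eq_of_totalAngle {E : Multiset (ℂ × ℂ)} {x : ℂ} {k : ℤ}
    (h : totalAngle E x = 2 * Real.pi * k) : winding E x = k := by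
  rw [winding, h, mul_div_cancel_left₀ _ Real.two_pi_pos.ne', round_intCast]

/-- A quotient equal to `-r` with `r ≥ 0` would make `x` the convex combination of `a` and `b` with
weights `r / (1 + r)` and `1 / (1 + r)`. So `arg` is only ever evaluated where it is continuous. -/
lemma mem_slitPlane_of_notMem_segment {x a b : ℂ} (h : x ∉ segment ℝ a b) :
    (b - x) / (a - x) ∈ slitPlane := by
  by_contra hn
  rw [mem_slitPlane_iff_not_le_zero, not_not] at hn
  have ha : a - x ≠ 0 := by
    intro h0
    rw [sub_eq_zero] at h0
    exact h (h0 ▸ left_mem_segment ..)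
  obtain ⟨r, hr⟩ : ∃ r : ℝ, (b - x) / (a - x) = -(r : ℂ) ∧ 0 ≤ r := by
    rw [Complex.le_def] at hn
    refine ⟨-((b - x) / (a - x)).re, ?_, by simpa using hn.1⟩
    apply Complex.ext
    · simp
    · simpa using hn.2
  have hb : b - x = -(r : ℂ) * (a - x) := by
    rw [← hr.1, div_mul_cancel₀ _ ha]
  apply h
  have hr1 : (0 : ℝ) < 1 + r := by linarith [hr.2]
  refine ⟨r / (1 + r), 1 / (1 + r), div_nonneg hr.2 hr1.le, by positivity, ?_, ?_⟩
  · field_simp; ring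
  · have hr2 : (1 + r : ℂ) ≠ 0 := by exact_mod_cast hr1.ne'
    simp only [real_smul]
    push_cast
    field_simp
    linear_combination hb

lemma continuousAt_viewAngle {x : ℂ} {e : ℂ × ℂ} (h : x ∉ segment ℝ e.1 e.2) :
    ContinuousAt (fun y => viewAngle y e) x := by
  have ha : e.1 - x ≠ 0 := by
    intro h0
    rw [sub_eq_zero] at h0
    exact h (h0 ▸ left_mem_segment ..)
  unfold viewAngle
  refine (continuousAt_arg (mem_slitPlane_of_notMem_segment h)).comp (f := fun y => (e.2 - y) / (e.1 - y)) ?_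
  exact ContinuousAt.div (by fun_prop) (by fun_prop) ha

lemma continuousAt_totalAngle {E : Multiset (ℂ × ℂ)} {x : ℂ} (h : x ∉ trace E) :
    ContinuousAt (totalAngle E) x := by
  induction E using Multiset.induction with
  | empty => 
    have : totalAngle 0 = fun _ => 0 := by ext; simp
    rw [this]; exact continuousAt_const
  | cons e E ih =>
    have : totalAngle (e ::ₘ E) = fun y => viewAngle y e + totalAngle E y := by ext; simp
    rw [this]
    rw [mem_trace_cons, not_or] at h
    exact (continuousAt_viewAngle h.1).add (ih h.2)

lemma continuousOn_winding {E : Multiset (ℂ × ℂ)} (hE : IsCycle E) :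
    ContinuousOn (winding E) (trace E)ᶜ := by
  intro x hx
  have h1 : ContinuousWithinAt (fun y => (winding E y : ℝ)) (trace E)ᶜ x := by
    have h2 : ContinuousWithinAt (fun y => totalAngle E y / (2 * Real.pi)) (trace E)ᶜ x :=
      ((continuousAt_totalAngle hx).div_const _).continuousWithinAt
    refine h2.congr ?_ ?_
    · intro y hy
      rw [totalAngle_eq hE hy, mul_div_cancel_left₀ _ Real.two_pi_pos.ne']
    · rw [totalAngle_eq hE hx, mul_div_cancel_left₀ _ Real.two_pi_pos.ne']
  exact (Int.isClosedEmbedding_coe_real.isEmbedding.isInducing.continuousWithinAt_iff).2 h1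

lemma winding_eventually_eq {E : Multiset (ℂ × ℂ)} (hE : IsCycle E) {x : ℂ} (hx : x ∉ trace E) :
    ∀ᶠ y in 𝓝 x, y ∉ trace E ∧ winding E y = winding E x := by
  have ho := (isClosed_trace E).isOpen_compl
  have h1 := (continuousOn_winding hE).continuousAt (ho.mem_nhds hx)
  have h2 : ∀ᶠ y in 𝓝 x, winding E y = winding E x :=
    h1.eventually (p := fun k => k = winding E x) (by simp)
  exact (ho.eventually_mem hx).and h2

lemma winding_eq_of_preconnected {E : Multiset (ℂ × ℂ)} (hE : IsCycle E) {s : Set ℂ}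
    (hs : IsPreconnected s) (hd : ∀ x ∈ s, x ∉ trace E) {x y : ℂ} (hx : x ∈ s) (hy : y ∈ s) :
    winding E x = winding E y :=
  hs.constant ((continuousOn_winding hE).mono hd) hx hy

lemma winding_eq_of_segment {E : Multiset (ℂ × ℂ)} (hE : IsCycle E) {x y : ℂ}
    (hd : ∀ w ∈ segment ℝ x y, w ∉ trace E) : winding E x = winding E y :=
  winding_eq_of_preconnected hE (convex_segment x y).isPreconnected hd
    (left_mem_segment ..) (right_mem_segment ..)

/-- Multiplication by `u` moves both ends to the right half-plane, where arguments lie strictly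
between -π/2 and π/2. Their difference is already a principal value, so the congruence modulo 2π is
an equality. -/
lemma viewAngle_eq_of_halfPlane {x u : ℂ} {e : ℂ × ℂ} (h1 : 0 < (u * (e.1 - x)).re)
    (h2 : 0 < (u * (e.2 - x)).re) :
    viewAngle x e = arg (u * (e.2 - x)) - arg (u * (e.1 - x)) := by
  have hu : u ≠ 0 := by rintro rfl; simp at h1
  have n1 : u * (e.1 - x) ≠ 0 := by intro h; rw [h] at h1; simp at h1
  have n2 : u * (e.2 - x) ≠ 0 := by intro h; rw [h] at h2; simp at h2
  have a1 := abs_lt.1 (abs_arg_lt_pi_div_two_iff.2 (Or.inl h1))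
  have a2 := abs_lt.1 (abs_arg_lt_pi_div_two_iff.2 (Or.inl h2))
  have h3 : ((viewAngle x e : ℝ) : Real.Angle) =
      ((arg (u * (e.2 - x)) - arg (u * (e.1 - x)) : ℝ) : Real.Angle) := by
    rw [Real.Angle.coe_sub, ← arg_div_coe_angle n2 n1, mul_div_mul_left _ _ hu, viewAngle]
  have h4 := congrArg Real.Angle.toReal h3
  rwa [viewAngle, arg_coe_angle_toReal_eq_arg, Real.Angle.toReal_coe_eq_self_iff.2] at h4
  constructor <;> linarith

/-- The total angle of a cycle is zero as seen from a point which a line separates from it. -/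
lemma totalAngle_eq_zero {E : Multiset (ℂ × ℂ)} (hE : IsCycle E) {x u : ℂ}
    (h : ∀ e ∈ E, 0 < (u * (e.1 - x)).re ∧ 0 < (u * (e.2 - x)).re) : totalAngle E x = 0 := by
  rw [← hE fun y => arg (u * (y - x)), totalAngle]
  congr 1
  exact Multiset.map_congr rfl fun e he => viewAngle_eq_of_halfPlane (h e he).1 (h e he).2

lemma winding_eq_zero {E : Multiset (ℂ × ℂ)} (hE : IsCycle E) {x u : ℂ}
    (h : ∀ e ∈ E, 0 < (u * (e.1 - x)).re ∧ 0 < (u * (e.2 - x)).re) : winding E x = 0 :=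
  winding_eq_of_totalAngle (by rw [totalAngle_eq_zero hE h]; simp)

/-- The tangent at `x` to the circle about `o` through `x` separates `x` from all other points of
the disc. -/
lemma winding_eq_zero_of_norm_le {E : Multiset (ℂ × ℂ)} (hE : IsCycle E) {x o : ℂ}
    (h : ∀ e ∈ E, (‖e.1 - o‖ ≤ ‖x - o‖ ∧ e.1 ≠ x) ∧ (‖e.2 - o‖ ≤ ‖x - o‖ ∧ e.2 ≠ x)) :
    winding E x = 0 := by
  have key : ∀ c : ℂ, ‖c - o‖ ≤ ‖x - o‖ → c ≠ x →
      0 < (-(starRingEnd ℂ (x - o)) * (c - x)).re := by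
    intro c h1 h2
    have h3 : ‖c - o‖ ^ 2 ≤ ‖x - o‖ ^ 2 := by gcongr
    have h4 : 0 < ‖c - x‖ ^ 2 := by
      have := sub_ne_zero.2 h2
      positivity
    rw [Complex.sq_norm, Complex.normSq_apply] at h4
    rw [Complex.sq_norm, Complex.sq_norm, Complex.normSq_apply, Complex.normSq_apply] at h3
    simp only [sub_re, sub_im, mul_re, neg_re, conj_re, neg_im, conj_im] at *
    nlinarith
  exact winding_eq_zero hE (u := -(starRingEnd ℂ (x - o))) fun e he =>
    ⟨key _ (h e he).1.1 (h e he).1.2, key _ (h e he).2.1 (h e he).2.2⟩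

lemma exists_halfPlane_of_notMem_segment {x a b : ℂ} (h : x ∉ segment ℝ a b) :
    ∃ u : ℂ, 0 < (u * (a - x)).re ∧ 0 < (u * (b - x)).re := by
  obtain ⟨f, c, h1, h2⟩ := geometric_hahn_banach_point_closed (convex_segment (𝕜 := ℝ) a b)
    (isClosed_segment_complex a b) h
  have hf : ∀ w : ℂ, (((f 1 : ℝ) - (f I : ℝ) * I : ℂ) * w).re = f w := by
    intro w
    have hw : w = w.re • (1 : ℂ) + w.im • I := by simp [Complex.re_add_im]
    conv_rhs => rw [hw]
    rw [map_add, map_smul, map_smul]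
    simp
    ring
  refine ⟨(f 1 : ℝ) - (f I : ℝ) * I, ?_, ?_⟩
  · rw [hf, map_sub]; linarith [h2 a (left_mem_segment ..)]
  · rw [hf, map_sub]; linarith [h2 b (right_mem_segment ..)]

/-- Being off the segment matters: at an interior point of it, `arg` gives π in both directions. -/
lemma viewAngle_swap {x a b : ℂ} (h : x ∉ segment ℝ a b) :
    viewAngle x (b, a) = - viewAngle x (a, b) := by
  obtain ⟨u, h1, h2⟩ := exists_halfPlane_of_notMem_segment h
  rw [viewAngle_eq_of_halfPlane (e := (b, a)) h2 h1, viewAngle_eq_of_halfPlane (e := (a, b)) h1 h2]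
  ring

lemma viewAngle_split {x a b p : ℂ} (h : x ∉ segment ℝ a b) (hp : p ∈ segment ℝ a b) :
    viewAngle x (a, p) + viewAngle x (p, b) = viewAngle x (a, b) := by
  obtain ⟨u, h1, h2⟩ := exists_halfPlane_of_notMem_segment h
  have h3 : 0 < (u * (p - x)).re := by
    obtain ⟨s, t, hs, ht, hst, rfl⟩ := hp
    have : (u * (s • a + t • b - x)).re = s * (u * (a - x)).re + t * (u * (b - x)).re := by
      have : u * (s • a + t • b - x) = (s : ℂ) * (u * (a - x)) + t * (u * (b - x)) := by
        have hst' : (s + t : ℂ) = 1 := by exact_mod_cast hst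
        simp only [real_smul]
        linear_combination u * x * hst'
      rw [this]; simp
    rw [this]
    rcases hs.eq_or_lt with rfl | hs
    · have : t = 1 := by linarith
      subst this; simpa using h2
    · have := mul_pos hs h1
      have := mul_nonneg ht h2.le
      linarith
  rw [viewAngle_eq_of_halfPlane (e := (a, p)) h1 h3, viewAngle_eq_of_halfPlane (e := (p, b)) h3 h2,
    viewAngle_eq_of_halfPlane (e := (a, b)) h1 h2]
  ring

/-- The boundary of a triangle. -/
def triangle (a b c : ℂ) : Multiset (ℂ × ℂ) := {(a, b), (b, c), (c, a)}

lemma isCycle_triangle (a b c : ℂ) : IsCycle (triangle a b c) := by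
  intro f; simp [triangle]

lemma totalAngle_triangle (a b c x : ℂ) : totalAngle (triangle a b c) x =
    viewAngle x (a, b) + viewAngle x (b, c) + viewAngle x (c, a) := by
  simp [triangle, totalAngle]; ring

lemma div_im_eq (a b : ℂ) : (b / a).im = cross a b / normSq a := by
  rw [div_im, cross]; ring

lemma viewAngle_pos {x a b : ℂ} (h : 0 < cross (b - a) (x - a)) :
    0 < viewAngle x (a, b) ∧ viewAngle x (a, b) < Real.pi := by
  have h0 : cross (a - x) (b - x) = cross (b - a) (x - a) := by simp [cross]; ring
  have hne : a - x ≠ 0 := by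
    intro h1; rw [h1] at h0; rw [← h0] at h; simp [cross] at h
  have h1 : 0 < ((b - x) / (a - x)).im := by
    rw [div_im_eq, h0]; exact div_pos h (normSq_pos.2 hne)
  refine ⟨lt_of_le_of_ne (arg_nonneg_iff.2 h1.le) fun h2 => ?_, arg_lt_pi_iff.2 (Or.inr h1.ne')⟩
  exact h1.ne' (arg_eq_zero_iff.1 h2.symm).2

lemma viewAngle_neg {x a b : ℂ} (h : cross (b - a) (x - a) < 0) :
    -Real.pi < viewAngle x (a, b) ∧ viewAngle x (a, b) < 0 := by
  have h0 : cross (a - x) (b - x) = cross (b - a) (x - a) := by simp [cross]; ring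
  have hne : a - x ≠ 0 := by
    intro h1; rw [h1] at h0; rw [← h0] at h; simp [cross] at h
  have h1 : ((b - x) / (a - x)).im < 0 := by
    rw [div_im_eq, h0]; exact div_neg_of_neg_of_pos h (normSq_pos.2 hne)
  exact ⟨neg_pi_lt_arg _, arg_neg_iff.2 h1⟩

lemma notMem_segment_of_cross_ne {x a b : ℂ} (h : cross (b - a) (x - a) ≠ 0) :
    x ∉ segment ℝ a b := by
  rintro ⟨s, t, -, -, hst, rfl⟩
  apply h
  have : s = 1 - t := by linarith
  subst this
  simp [cross]; ring

/-- Three angles strictly between 0 and π add up to a multiple of 2π that is positive and below 3π.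
-/
lemma totalAngle_triangle_pos {a b c x : ℂ} (h1 : 0 < cross (b - a) (x - a))
    (h2 : 0 < cross (c - b) (x - b)) (h3 : 0 < cross (a - c) (x - c)) :
    totalAngle (triangle a b c) x = 2 * Real.pi := by
  have hx : x ∉ trace (triangle a b c) := by
    have e1 := notMem_segment_of_cross_ne h1.ne'
    have e2 := notMem_segment_of_cross_ne h2.ne'
    have e3 := notMem_segment_of_cross_ne h3.ne'
    simp [triangle, trace, e1, e2, e3]
  have h := totalAngle_eq (isCycle_triangle a b c) hx
  have hs := totalAngle_triangle a b c x
  obtain ⟨p1, q1⟩ := viewAngle_pos h1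
  obtain ⟨p2, q2⟩ := viewAngle_pos h2
  obtain ⟨p3, q3⟩ := viewAngle_pos h3
  have hpi := Real.pi_pos
  set w := winding (triangle a b c) x
  have g1 : (0 : ℝ) < w := by
    by_contra hn
    push Not at hn
    nlinarith
  have g2 : (w : ℝ) < 2 := by
    by_contra hn
    push Not at hn
    nlinarith
  have g1' : 0 < w := by exact_mod_cast g1
  have g2' : w < 2 := by exact_mod_cast g2
  have : w = 1 := by omega
  rw [h, this]; simp

lemma totalAngle_triangle_neg {a b c x : ℂ} (h1 : cross (b - a) (x - a) < 0)
    (h2 : cross (c - b) (x - b) < 0) (h3 : cross (a - c) (x - c) < 0) :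
    totalAngle (triangle a b c) x = -(2 * Real.pi) := by
  have hx : x ∉ trace (triangle a b c) := by
    have e1 := notMem_segment_of_cross_ne h1.ne
    have e2 := notMem_segment_of_cross_ne h2.ne
    have e3 := notMem_segment_of_cross_ne h3.ne
    simp [triangle, trace, e1, e2, e3]
  have h := totalAngle_eq (isCycle_triangle a b c) hx
  have hs := totalAngle_triangle a b c x
  obtain ⟨p1, q1⟩ := viewAngle_neg h1
  obtain ⟨p2, q2⟩ := viewAngle_neg h2
  obtain ⟨p3, q3⟩ := viewAngle_neg h3
  have hpi := Real.pi_pos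
  set w := winding (triangle a b c) x
  have g1 : (w : ℝ) < 0 := by
    by_contra hn
    push Not at hn
    nlinarith
  have g2 : (-2 : ℝ) < w := by
    by_contra hn
    push Not at hn
    nlinarith
  have g1' : w < 0 := by exact_mod_cast g1
  have g2' : -2 < w := by exact_mod_cast g2
  have : w = -1 := by omega
  rw [h, this]; simp

lemma re_neg_I_mul_conj (d w : ℂ) : ((-I * starRingEnd ℂ d) * w).re = cross d w := by
  simp [cross]

/-- The total angle of a triangle from a point on the other side of a line that supports it. -/
lemma totalAngle_triangle_zero {a b c x d o : ℂ} (ha : 0 ≤ cross d (a - o))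
    (hb : 0 ≤ cross d (b - o)) (hc : 0 ≤ cross d (c - o)) (hx : cross d (x - o) < 0) :
    totalAngle (triangle a b c) x = 0 := by
  have key : ∀ w : ℂ, 0 ≤ cross d (w - o) → 0 < ((-I * starRingEnd ℂ d) * (w - x)).re := by
    intro w hw
    rw [re_neg_I_mul_conj]
    have : cross d (w - x) = cross d (w - o) - cross d (x - o) := by simp [cross]; ring
    linarith
  refine totalAngle_eq_zero (isCycle_triangle a b c) (u := -I * starRingEnd ℂ d) fun e he => ?_
  simp only [triangle, Multiset.insert_eq_cons, Multiset.mem_cons, Multiset.mem_singleton] at he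
  rcases he with rfl | rfl | rfl
  · exact ⟨key _ ha, key _ hb⟩
  · exact ⟨key _ hb, key _ hc⟩
  · exact ⟨key _ hc, key _ ha⟩

end PolygonVisibility

/-! ### Jumps of the winding number at edges and vertices. -/

namespace PolygonVisibility

open Complex Filter Topology

/-- The cycle `E` avoids the point `y` and winds `k` times around it. -/
def WindsAt (E : Multiset (ℂ × ℂ)) (k : ℤ) (y : ℂ) : Prop := y ∉ trace E ∧ winding E y = k

lemma WindsAt.unique {E : Multiset (ℂ × ℂ)} {k l : ℤ} {y : ℂ} (h : WindsAt E k y)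
    (h' : WindsAt E l y) : k = l := h.2.symm.trans h'.2

lemma eventually_cross_pos {d o x : ℂ} (h : 0 < cross d (x - o)) :
    ∀ᶠ y in 𝓝 x, 0 < cross d (y - o) :=
  (continuous_cross_sub d o).continuousAt.eventually (lt_mem_nhds h)

lemma eventually_cross_neg {d o x : ℂ} (h : cross d (x - o) < 0) :
    ∀ᶠ y in 𝓝 x, cross d (y - o) < 0 :=
  (continuous_cross_sub d o).continuousAt.eventually (gt_mem_nhds h)

lemma normSq_pos_of_ne {a b : ℂ} (h : a ≠ b) :
    0 < (b.re - a.re) ^ 2 + (b.im - a.im) ^ 2 := by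
  have := normSq_pos.2 (sub_ne_zero.2 h.symm)
  rw [normSq_apply] at this
  simp only [sub_re, sub_im] at this
  nlinarith

/-- The cycle obtained by replacing the segment from `a` to `b` by a detour on its left. -/
noncomputable def detour (a b : ℂ) (E : Multiset (ℂ × ℂ)) : Multiset (ℂ × ℂ) :=
  (a, a + I * (b - a)) ::ₘ (a + I * (b - a), b) ::ₘ E

lemma isCycle_detour {a b : ℂ} {E : Multiset (ℂ × ℂ)} (hE : IsCycle ((a, b) ::ₘ E)) :
    IsCycle (detour a b E) := by
  intro f
  have := hE f
  simp only [detour, Multiset.map_cons, Multiset.sum_cons] at *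
  linarith

lemma notMem_trace_detour {a b x : ℂ} {E : Multiset (ℂ × ℂ)} (hab : a ≠ b)
    (hx : x ∈ openSegment ℝ a b) (hxE : x ∉ trace E) : x ∉ trace (detour a b E) := by
  obtain ⟨s, t, hs, ht, hst, rfl⟩ := hx
  obtain rfl : s = 1 - t := by linarith
  have hp := normSq_pos_of_ne hab
  simp only [detour, mem_trace_cons, not_or]
  refine ⟨notMem_segment_of_cross_ne ?_, notMem_segment_of_cross_ne ?_, hxE⟩
  · have : cross (a + I * (b - a) - a) ((1 - t) • a + t • b - a) =
        -(t * ((b.re - a.re) ^ 2 + (b.im - a.im) ^ 2)) := by simp [cross]; ring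
    rw [this]
    exact (neg_neg_of_pos (mul_pos ht hp)).ne
  · have : cross (b - (a + I * (b - a))) ((1 - t) • a + t • b - (a + I * (b - a))) =
        -((1 - t) * ((b.re - a.re) ^ 2 + (b.im - a.im) ^ 2)) := by simp [cross]; ring
    rw [this]
    exact (neg_neg_of_pos (mul_pos hs hp)).ne

/-- The cycle is the sum of the detour and the triangle `a b c` on the left of the edge. The detour
keeps away from `x`, so its winding number is constant near `x`, and the triangle contributes 1 on
the left and 0 on the right. -/
lemma edge_local {a b x : ℂ} {E : Multiset (ℂ × ℂ)} (hab : a ≠ b) (hE : IsCycle ((a, b) ::ₘ E))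
    (hx : x ∈ openSegment ℝ a b) (hxE : x ∉ trace E) :
    ∀ᶠ y in 𝓝 x,
      (0 < cross (b - a) (y - a) →
        WindsAt ((a, b) ::ₘ E) (winding (detour a b E) x + 1) y) ∧
      (cross (b - a) (y - a) < 0 → WindsAt ((a, b) ::ₘ E) (winding (detour a b E) x) y) := by
  have hp := normSq_pos_of_ne hab
  have hd := winding_eventually_eq (isCycle_detour hE) (notMem_trace_detour hab hx hxE)
  have hE' := (isClosed_trace E).isOpen_compl.eventually_mem hxE
  obtain ⟨s, t, hs, ht, hst, rfl⟩ := hx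
  obtain rfl : s = 1 - t := by linarith
  set c := a + I * (b - a) with hc
  have h2 : 0 < cross (c - b) ((1 - t) • a + t • b - b) := by
    have : cross (c - b) ((1 - t) • a + t • b - b) =
        (1 - t) * ((b.re - a.re) ^ 2 + (b.im - a.im) ^ 2) := by simp [hc, cross]; ring
    rw [this]; positivity
  have h3 : 0 < cross (a - c) ((1 - t) • a + t • b - c) := by
    have : cross (a - c) ((1 - t) • a + t • b - c) =
        t * ((b.re - a.re) ^ 2 + (b.im - a.im) ^ 2) := by simp [hc, cross]; ring
    rw [this]; positivity
  filter_upwards [hd, hE', eventually_cross_pos h2, eventually_cross_pos h3]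
    with y hy1 hy2 hy3 hy4
  have ht1 : totalAngle ((a, b) ::ₘ E) y =
      totalAngle (triangle a b c) y + totalAngle (detour a b E) y := by
    have e1 : y ∉ segment ℝ b c := notMem_segment_of_cross_ne hy3.ne'
    have e2 : y ∉ segment ℝ c a := notMem_segment_of_cross_ne hy4.ne'
    simp only [detour, totalAngle_triangle, totalAngle_cons]
    rw [← hc, viewAngle_swap e1, viewAngle_swap e2]
    ring
  have ht2 := totalAngle_eq (isCycle_detour hE) hy1.1
  rw [hy1.2] at ht2
  have hmem : cross (b - a) (y - a) ≠ 0 → y ∉ trace ((a, b) ::ₘ E) := by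
    intro h
    rw [mem_trace_cons, not_or]
    exact ⟨notMem_segment_of_cross_ne h, hy2⟩
  refine ⟨fun h => ⟨hmem h.ne', winding_eq_of_totalAngle ?_⟩,
    fun h => ⟨hmem h.ne, winding_eq_of_totalAngle ?_⟩⟩
  · rw [ht1, ht2, totalAngle_triangle_pos h hy3 hy4]
    push_cast; ring
  · rw [ht1, ht2, totalAngle_triangle_zero (d := b - a) (o := a) _ _ _ h, zero_add]
    · simp [cross]
    · simp [cross, mul_comm]
    · have : cross (b - a) (c - a) = (b.re - a.re) ^ 2 + (b.im - a.im) ^ 2 := by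
        simp [hc, cross]; ring
      rw [this]; exact hp.le

/-- The cycle obtained by cutting off the vertex `b`. -/
lemma isCycle_shortcut {u b v : ℂ} {E : Multiset (ℂ × ℂ)}
    (hE : IsCycle ((u, b) ::ₘ (b, v) ::ₘ E)) : IsCycle ((u, v) ::ₘ E) := by
  intro f
  have := hE f
  simp only [Multiset.map_cons, Multiset.sum_cons] at *
  linarith

lemma totalAngle_shortcut {u b v y : ℂ} {E : Multiset (ℂ × ℂ)} (hy : y ∉ segment ℝ u v) :
    totalAngle ((u, b) ::ₘ (b, v) ::ₘ E) y =
      totalAngle (triangle u b v) y + totalAngle ((u, v) ::ₘ E) y := by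
  simp only [totalAngle_triangle, totalAngle_cons]
  rw [viewAngle_swap hy]
  ring

lemma notMem_segment_of_halfPlane {u v y d o : ℂ} (hu : 0 ≤ cross d (u - o))
    (hv : 0 ≤ cross d (v - o)) (hy : cross d (y - o) < 0) : y ∉ segment ℝ u v := by
  rintro ⟨s, t, hs, ht, hst, rfl⟩
  obtain rfl : s = 1 - t := by linarith
  have : cross d ((1 - t) • u + t • v - o) =
      (1 - t) * cross d (u - o) + t * cross d (v - o) := by simp [cross]; ring
  rw [this] at hy
  nlinarith [mul_nonneg hs hu, mul_nonneg ht hv]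

lemma notMem_segment_of_halfPlane' {u v y d o : ℂ} (hu : cross d (u - o) ≤ 0)
    (hv : cross d (v - o) ≤ 0) (hy : 0 < cross d (y - o)) : y ∉ segment ℝ u v := by
  have h : ∀ w, cross (-d) (w - o) = - cross d (w - o) := by intro w; simp [cross]; ring
  exact notMem_segment_of_halfPlane (d := -d) (o := o) (by rw [h]; linarith)
    (by rw [h]; linarith) (by rw [h]; linarith)

/-- Cutting off `b` leaves a cycle that avoids `b` and is harmless nearby. The triangle `u b v` that
is cut off is positively oriented and fills the convex wedge at `b`, where it adds 1. -/
lemma vertex_local_left {u b v : ℂ} {E : Multiset (ℂ × ℂ)}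
    (hE : IsCycle ((u, b) ::ₘ (b, v) ::ₘ E)) (hb : b ∉ trace E)
    (ht : 0 < cross (b - u) (v - b)) :
    ∃ r, ∀ᶠ y in 𝓝 b,
      (0 < cross (b - u) (y - u) → 0 < cross (v - b) (y - b) →
        WindsAt ((u, b) ::ₘ (b, v) ::ₘ E) (r + 1) y) ∧
      (cross (b - u) (y - u) < 0 ∨ cross (v - b) (y - b) < 0 →
        WindsAt ((u, b) ::ₘ (b, v) ::ₘ E) r y) := by
  have h3 : 0 < cross (u - v) (b - v) := by
    have : cross (u - v) (b - v) = cross (b - u) (v - b) := by simp [cross]; ring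
    rwa [this]
  have hvu : cross (b - u) (v - u) = cross (b - u) (v - b) := by simp [cross]; ring
  have huv : cross (v - b) (u - b) = cross (b - u) (v - b) := by simp [cross]; ring
  have hbE : b ∉ trace ((u, v) ::ₘ E) := by
    rw [mem_trace_cons, not_or]
    refine ⟨?_, hb⟩
    rw [segment_symm]
    exact notMem_segment_of_cross_ne h3.ne'
  refine ⟨winding ((u, v) ::ₘ E) b, ?_⟩
  filter_upwards [winding_eventually_eq (isCycle_shortcut hE) hbE, eventually_cross_pos h3]
    with y hy1 hy3
  have hy4 : y ∉ segment ℝ u v := fun h => hy1.1 (by simp [h])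
  have hy5 : y ∉ trace E := fun h => hy1.1 (by simp [h])
  have ht1 := totalAngle_shortcut (b := b) (E := E) hy4
  have ht2 := totalAngle_eq (isCycle_shortcut hE) hy1.1
  rw [hy1.2] at ht2
  refine ⟨fun h1 h2 => ⟨?_, winding_eq_of_totalAngle ?_⟩, fun h => ?_⟩
  · simp only [mem_trace_cons, not_or]
    exact ⟨notMem_segment_of_cross_ne h1.ne', notMem_segment_of_cross_ne h2.ne', hy5⟩
  · rw [ht1, ht2, totalAngle_triangle_pos h1 h2 hy3]
    push_cast; ring
  · rcases h with h | h
    · have gu : 0 ≤ cross (b - u) (u - u) := by simp [cross]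
      have gb : 0 ≤ cross (b - u) (b - u) := by simp [cross, mul_comm]
      have gv : 0 ≤ cross (b - u) (v - u) := by rw [hvu]; exact ht.le
      refine ⟨?_, winding_eq_of_totalAngle ?_⟩
      · simp only [mem_trace_cons, not_or]
        exact ⟨notMem_segment_of_halfPlane gu gb h, notMem_segment_of_halfPlane gb gv h, hy5⟩
      · rw [ht1, ht2, totalAngle_triangle_zero gu gb gv h, zero_add]
    · have gu : 0 ≤ cross (v - b) (u - b) := by rw [huv]; exact ht.le
      have gb : 0 ≤ cross (v - b) (b - b) := by simp [cross]
      have gv : 0 ≤ cross (v - b) (v - b) := by simp [cross, mul_comm]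
      refine ⟨?_, winding_eq_of_totalAngle ?_⟩
      · simp only [mem_trace_cons, not_or]
        exact ⟨notMem_segment_of_halfPlane gu gb h, notMem_segment_of_halfPlane gb gv h, hy5⟩
      · rw [ht1, ht2, totalAngle_triangle_zero gu gb gv h, zero_add]

lemma totalAngle_triangle_zero' {a b c x d o : ℂ} (ha : cross d (a - o) ≤ 0)
    (hb : cross d (b - o) ≤ 0) (hc : cross d (c - o) ≤ 0) (hx : 0 < cross d (x - o)) :
    totalAngle (triangle a b c) x = 0 := by
  have h : ∀ w, cross (-d) (w - o) = - cross d (w - o) := by intro w; simp [cross]; ring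
  exact totalAngle_triangle_zero (d := -d) (o := o) (by rw [h]; linarith)
    (by rw [h]; linarith) (by rw [h]; linarith) (by rw [h]; linarith)

/-- As for a left turn, except that the triangle `u b v` is negatively oriented and subtracts 1
inside the wedge. Outside the wedge the number is that of the shortened cycle, which is therefore
called `r + 1`. -/
lemma vertex_local_right {u b v : ℂ} {E : Multiset (ℂ × ℂ)}
    (hE : IsCycle ((u, b) ::ₘ (b, v) ::ₘ E)) (hb : b ∉ trace E)
    (ht : cross (b - u) (v - b) < 0) :
    ∃ r, ∀ᶠ y in 𝓝 b,
      (0 < cross (b - u) (y - u) ∨ 0 < cross (v - b) (y - b) →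
        WindsAt ((u, b) ::ₘ (b, v) ::ₘ E) (r + 1) y) ∧
      (cross (b - u) (y - u) < 0 → cross (v - b) (y - b) < 0 →
        WindsAt ((u, b) ::ₘ (b, v) ::ₘ E) r y) := by
  have h3 : cross (u - v) (b - v) < 0 := by
    have : cross (u - v) (b - v) = cross (b - u) (v - b) := by simp [cross]; ring
    rwa [this]
  have hvu : cross (b - u) (v - u) = cross (b - u) (v - b) := by simp [cross]; ring
  have huv : cross (v - b) (u - b) = cross (b - u) (v - b) := by simp [cross]; ring
  have hbE : b ∉ trace ((u, v) ::ₘ E) := by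
    rw [mem_trace_cons, not_or]
    refine ⟨?_, hb⟩
    rw [segment_symm]
    exact notMem_segment_of_cross_ne h3.ne
  refine ⟨winding ((u, v) ::ₘ E) b - 1, ?_⟩
  filter_upwards [winding_eventually_eq (isCycle_shortcut hE) hbE, eventually_cross_neg h3]
    with y hy1 hy3
  have hy4 : y ∉ segment ℝ u v := fun h => hy1.1 (by simp [h])
  have hy5 : y ∉ trace E := fun h => hy1.1 (by simp [h])
  have ht1 := totalAngle_shortcut (b := b) (E := E) hy4
  have ht2 := totalAngle_eq (isCycle_shortcut hE) hy1.1
  rw [hy1.2] at ht2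
  refine ⟨fun h => ?_, fun h1 h2 => ⟨?_, winding_eq_of_totalAngle ?_⟩⟩
  · rw [sub_add_cancel]
    rcases h with h | h
    · have gu : cross (b - u) (u - u) ≤ 0 := by simp [cross]
      have gb : cross (b - u) (b - u) ≤ 0 := by simp [cross, mul_comm]
      have gv : cross (b - u) (v - u) ≤ 0 := by rw [hvu]; exact ht.le
      refine ⟨?_, winding_eq_of_totalAngle ?_⟩
      · simp only [mem_trace_cons, not_or]
        exact ⟨notMem_segment_of_halfPlane' gu gb h, notMem_segment_of_halfPlane' gb gv h, hy5⟩
      · rw [ht1, ht2, totalAngle_triangle_zero' gu gb gv h, zero_add]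
    · have gu : cross (v - b) (u - b) ≤ 0 := by rw [huv]; exact ht.le
      have gb : cross (v - b) (b - b) ≤ 0 := by simp [cross]
      have gv : cross (v - b) (v - b) ≤ 0 := by simp [cross, mul_comm]
      refine ⟨?_, winding_eq_of_totalAngle ?_⟩
      · simp only [mem_trace_cons, not_or]
        exact ⟨notMem_segment_of_halfPlane' gu gb h, notMem_segment_of_halfPlane' gb gv h, hy5⟩
      · rw [ht1, ht2, totalAngle_triangle_zero' gu gb gv h, zero_add]
  · simp only [mem_trace_cons, not_or]
    exact ⟨notMem_segment_of_cross_ne h1.ne, notMem_segment_of_cross_ne h2.ne, hy5⟩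
  · rw [ht1, ht2, totalAngle_triangle_neg h1 h2 hy3]
    push_cast; ring

lemma exists_pos_of_mem_openSegment {u b v : ℂ} (hb : b ∈ openSegment ℝ u v) :
    ∃ k : ℝ, 0 < k ∧ v - b = k * (b - u) := by
  obtain ⟨s, t, hs, ht, hst, rfl⟩ := hb
  refine ⟨s / t, by positivity, ?_⟩
  have ht' : (t : ℂ) ≠ 0 := by exact_mod_cast ht.ne'
  have hst' : (s : ℂ) = 1 - t := by
    rw [eq_sub_iff_add_eq]; exact_mod_cast hst
  simp only [real_smul]
  push_cast
  rw [hst']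
  field_simp
  ring

lemma cross_smul_left (a b : ℂ) (t : ℝ) : cross (t * a) b = t * cross a b := by
  simp [cross]; ring

/-- The triangle `u b v` is degenerate and contributes nothing off its line, so `b` counts as an
interior point of the single edge from `u` to `v`. -/
lemma vertex_local_flat {u b v : ℂ} {E : Multiset (ℂ × ℂ)}
    (hE : IsCycle ((u, b) ::ₘ (b, v) ::ₘ E)) (hb : b ∉ trace E) (huv : u ≠ v)
    (hbs : b ∈ openSegment ℝ u v) :
    ∃ r, ∀ᶠ y in 𝓝 b,
      (0 < cross (b - u) (y - u) ∨ 0 < cross (v - b) (y - b) →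
        WindsAt ((u, b) ::ₘ (b, v) ::ₘ E) (r + 1) y) ∧
      (cross (b - u) (y - u) < 0 ∨ cross (v - b) (y - b) < 0 →
        WindsAt ((u, b) ::ₘ (b, v) ::ₘ E) r y) := by
  refine ⟨winding (detour u v E) b, ?_⟩
  obtain ⟨k, hk, hvb⟩ := exists_pos_of_mem_openSegment hbs
  have hsplit : v - u = ((1 + k : ℝ) : ℂ) * (b - u) := by
    push_cast; linear_combination hvb
  filter_upwards [edge_local huv (isCycle_shortcut hE) hbs hb] with y hy
  have c1 : cross (v - b) (y - b) = k * cross (b - u) (y - u) := by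
    rw [hvb, cross_smul_left]; simp [cross]; ring_nf; simp
  have c2 : cross (v - u) (y - u) = (1 + k) * cross (b - u) (y - u) := by
    rw [hsplit, cross_smul_left]
  have trans : ∀ r : ℤ, cross (b - u) (y - u) ≠ 0 → WindsAt ((u, v) ::ₘ E) r y →
      WindsAt ((u, b) ::ₘ (b, v) ::ₘ E) r y := by
    intro r h0 ⟨h1, h2⟩
    have hy4 : y ∉ segment ℝ u v := fun h => h1 (by simp [h])
    have hy5 : y ∉ trace E := fun h => h1 (by simp [h])
    have ht1 := totalAngle_shortcut (b := b) (E := E) hy4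
    have ht2 := totalAngle_eq (isCycle_shortcut hE) h1
    have hz : totalAngle (triangle u b v) y = 0 := by
      have gu : cross (b - u) (u - u) = 0 := by simp [cross]
      have gb : cross (b - u) (b - u) = 0 := by simp [cross, mul_comm]
      have gv : cross (b - u) (v - u) = 0 := by
        rw [hsplit, cross_smul_right, gb, mul_zero]
      rcases lt_or_gt_of_ne h0 with h | h
      · exact totalAngle_triangle_zero gu.ge gb.ge gv.ge h
      · exact totalAngle_triangle_zero' gu.le gb.le gv.le h
    refine ⟨?_, winding_eq_of_totalAngle ?_⟩
    · simp only [mem_trace_cons, not_or]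
      refine ⟨notMem_segment_of_cross_ne h0, notMem_segment_of_cross_ne ?_, hy5⟩
      rw [c1]; exact mul_ne_zero hk.ne' h0
    · rw [ht1, ht2, hz, zero_add, h2]
  have hk1 : 0 < 1 + k := by linarith
  rw [c2] at hy
  rw [c1]
  constructor
  · intro h
    have h' : 0 < cross (b - u) (y - u) := h.elim id fun h => pos_of_mul_pos_right h hk.le
    exact trans _ h'.ne' (hy.1 (mul_pos hk1 h'))
  · intro h
    have h' : cross (b - u) (y - u) < 0 :=
      h.elim id fun h => neg_of_mul_neg_right h hk.le
    exact trans _ h'.ne (hy.2 (mul_neg_of_pos_of_neg hk1 h'))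

/-- Properties that hold on one side of an open edge near each of its points, and on the same side
near an endpoint of the edge, hold together somewhere. -/
lemma exists_common_side {a b p : ℂ} (hab : a ≠ b) (hp : p ∈ segment ℝ a b) {τ : ℝ} (hτ : τ ≠ 0)
    {A B : ℂ → Prop}
    (hA : ∀ᶠ y in 𝓝 p, 0 < τ * cross (b - a) (y - a) → A y)
    (hB : ∀ x ∈ openSegment ℝ a b, ∀ᶠ y in 𝓝 x, 0 < τ * cross (b - a) (y - a) → B y) :
    ∃ y, A y ∧ B y := by
  rw [← closure_openSegment, mem_closure_iff_frequently] at hp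
  obtain ⟨x, hx1, hx2⟩ := (hp.and_eventually (eventually_eventually_nhds.2 hA)).exists
  have h3 := hx2.and (hB x hx1)
  have h4 : Tendsto (fun s : ℝ => x + (s : ℂ) * (τ * (I * (b - a)))) (𝓝[>] 0) (𝓝 x) := by
    have : Continuous fun s : ℝ => x + (s : ℂ) * (τ * (I * (b - a))) := by fun_prop
    have h5 := this.tendsto 0
    simp only [ofReal_zero, zero_mul, add_zero] at h5
    exact h5.mono_left nhdsWithin_le_nhds
  obtain ⟨s, hs, hs0⟩ := ((h4.eventually h3).and self_mem_nhdsWithin).exists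
  have hs0 : 0 < s := hs0
  have hpos : 0 < τ * cross (b - a) (x + (s : ℂ) * (τ * (I * (b - a))) - a) := by
    obtain ⟨α, β, -, -, hst, rfl⟩ := hx1
    obtain rfl : α = 1 - β := by linarith
    have : τ * cross (b - a) ((1 - β) • a + β • b + (s : ℂ) * (τ * (I * (b - a))) - a) =
        s * τ ^ 2 * ((b.re - a.re) ^ 2 + (b.im - a.im) ^ 2) := by
      simp [cross]; ring
    rw [this]
    have := normSq_pos_of_ne hab
    positivity
  exact ⟨_, hs.1 hpos, hs.2 hpos⟩

end PolygonVisibility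

/-! ### Simple polygons and their orientation. -/

namespace PolygonVisibility

open Complex Filter Topology

variable {n : ℕ}

/-- A simple closed polygon in the complex plane, given by its cyclically indexed vertices. -/
structure SimpleVertices (z : Fin n → ℂ) : Prop where
  three_le : 3 ≤ n
  ne : ∀ i, z i ≠ z (finRotate n i)
  consecutive : ∀ i, segment ℝ (z i) (z (finRotate n i)) ∩
    segment ℝ (z (finRotate n i)) (z (finRotate n (finRotate n i))) = {z (finRotate n i)}
  nonconsecutive : ∀ i j, i ≠ j → j ≠ finRotate n i → i ≠ finRotate n j →
    Disjoint (segment ℝ (z i) (z (finRotate n i))) (segment ℝ (z j) (z (finRotate n j)))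

/-- The edges of a closed polygon. -/
def edges (z : Fin n → ℂ) : Multiset (ℂ × ℂ) :=
  Finset.univ.val.map fun i => (z i, z (finRotate n i))

lemma isCycle_edges (z : Fin n → ℂ) : IsCycle (edges z) := by
  intro f
  rw [edges, Multiset.map_map]
  change ∑ i, (f (z (finRotate n i)) - f (z i)) = 0
  rw [Finset.sum_sub_distrib, Equiv.sum_comp (finRotate n) fun i => f (z i), sub_self]

lemma mem_trace_map {s : Finset (Fin n)} {z : Fin n → ℂ} {x : ℂ} :
    x ∈ trace (s.val.map fun i => (z i, z (finRotate n i))) ↔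
      ∃ i ∈ s, x ∈ segment ℝ (z i) (z (finRotate n i)) := by
  simp [trace]

lemma mem_trace_edges {z : Fin n → ℂ} {x : ℂ} :
    x ∈ trace (edges z) ↔ ∃ i, x ∈ segment ℝ (z i) (z (finRotate n i)) := by
  simp [edges, trace]

lemma edges_eq_cons (z : Fin n → ℂ) (i : Fin n) :
    edges z = (z i, z (finRotate n i)) ::ₘ
      ((Finset.univ.erase i).val.map fun j => (z j, z (finRotate n j))) := by
  rw [edges, ← Finset.insert_erase (Finset.mem_univ i), Finset.insert_val_of_notMem (by simp),
    Multiset.map_cons]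
  simp

lemma edges_eq_cons_cons (z : Fin n → ℂ) {i j : Fin n} (hij : i ≠ j) :
    edges z = (z i, z (finRotate n i)) ::ₘ (z j, z (finRotate n j)) ::ₘ
      (((Finset.univ.erase i).erase j).val.map fun k => (z k, z (finRotate n k))) := by
  rw [edges_eq_cons z i]
  congr 1
  conv_lhs => rw [← Finset.insert_erase (s := Finset.univ.erase i) (a := j) (by simp [hij.symm]),
    Finset.insert_val_of_notMem (by simp), Multiset.map_cons]

lemma finRotate_iterate_val {n : ℕ} (k : ℕ) (i : Fin n) :
    ((finRotate n)^[k] i : ℕ) = (i + k) % n := by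
  obtain _ | n := n
  · exact i.elim0
  induction k with
  | zero => simp [Nat.mod_eq_of_lt i.2]
  | succ k ih =>
    rw [Function.iterate_succ_apply', finRotate_apply, Fin.val_add, ih, Fin.val_one', ← add_assoc,
      Nat.mod_add_mod, Nat.add_mod_mod]

lemma exists_iterate_eq (i j : Fin n) : ∃ k < n, (finRotate n)^[k] i = j := by
  have hi := i.2
  have hj := j.2
  rcases le_or_gt (i : ℕ) j with h | h
  · refine ⟨j - i, by omega, ?_⟩
    apply Fin.ext
    rw [finRotate_iterate_val, show (i : ℕ) + (j - i) = j by omega, Nat.mod_eq_of_lt hj]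
  · refine ⟨j + n - i, by omega, ?_⟩
    apply Fin.ext
    rw [finRotate_iterate_val, show (i : ℕ) + (j + n - i) = j + n by omega, Nat.add_mod_right,
      Nat.mod_eq_of_lt hj]

lemma iterate_injOn {i : Fin n} {k l : ℕ} (hk : k < n) (hl : l < n)
    (h : (finRotate n)^[k] i = (finRotate n)^[l] i) : k = l := by
  have h1 := congrArg Fin.val h
  rw [finRotate_iterate_val, finRotate_iterate_val] at h1
  have h2 : k ≡ l [MOD n] := Nat.ModEq.add_left_cancel' (i : ℕ) h1
  rw [Nat.ModEq, Nat.mod_eq_of_lt hk, Nat.mod_eq_of_lt hl] at h2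
  exact h2

lemma iterate_period (i : Fin n) : (finRotate n)^[n] i = i := by
  apply Fin.ext
  rw [finRotate_iterate_val, Nat.add_mod_right, Nat.mod_eq_of_lt i.2]

namespace SimpleVertices

variable {z : Fin n → ℂ}

lemma rotate_ne (hz : SimpleVertices z) (i : Fin n) : finRotate n i ≠ i := by
  intro h
  exact hz.ne i (by rw [h])

lemma rotate_rotate_ne (hz : SimpleVertices z) (i : Fin n) :
    finRotate n (finRotate n i) ≠ i := by
  intro h
  have := iterate_injOn (i := i) (k := 2) (l := 0) (by have := hz.three_le; omega)
    (by have := hz.three_le; omega) h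
  omega

lemma injective (hz : SimpleVertices z) : Function.Injective z := by
  intro i j hij
  by_contra hne
  by_cases h1 : j = finRotate n i
  · exact hz.ne i (by rw [← h1, hij])
  by_cases h2 : i = finRotate n j
  · exact hz.ne j (by rw [← h2, hij])
  exact Set.disjoint_left.1 (hz.nonconsecutive i j hne h1 h2) (left_mem_segment ..)
    (hij ▸ left_mem_segment ..)

/-- A common point of two edges is their common vertex. -/
lemma eq_vertex_of_mem (hz : SimpleVertices z) {i j : Fin n} (hij : i ≠ j) {x : ℂ}
    (hi : x ∈ segment ℝ (z i) (z (finRotate n i)))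
    (hj : x ∈ segment ℝ (z j) (z (finRotate n j))) :
    (j = finRotate n i ∧ x = z j) ∨ (i = finRotate n j ∧ x = z i) := by
  by_cases h1 : j = finRotate n i
  · left
    refine ⟨h1, ?_⟩
    have h := hz.consecutive i
    rw [← h1] at h
    rw [← h1] at hi
    have : x ∈ ({z j} : Set ℂ) := h ▸ ⟨hi, hj⟩
    simpa using this
  by_cases h2 : i = finRotate n j
  · right
    refine ⟨h2, ?_⟩
    have h := hz.consecutive j
    rw [← h2] at h
    rw [← h2] at hj
    have : x ∈ ({z i} : Set ℂ) := h ▸ ⟨hj, hi⟩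
    simpa using this
  exact (Set.disjoint_left.1 (hz.nonconsecutive i j hij h1 h2) hi hj).elim

lemma notMem_openSegment (hz : SimpleVertices z) (i j : Fin n) :
    z j ∉ openSegment ℝ (z i) (z (finRotate n i)) := by
  intro h
  have h' := openSegment_subset_segment _ _ _ h
  have hne := hz.ne i
  have hl : z j ≠ z i := by
    intro h0
    rw [h0, left_mem_openSegment_iff] at h
    exact hne h
  have hr : z j ≠ z (finRotate n i) := by
    intro h0
    rw [h0, right_mem_openSegment_iff] at h
    exact hne h
  have hij : i ≠ j := by rintro rfl; exact hl rfl
  rcases hz.eq_vertex_of_mem hij h' (left_mem_segment ..) with ⟨h1, -⟩ | ⟨-, h1⟩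
  · exact hr (by rw [h1])
  · exact hl h1

lemma eq_of_mem_openSegment (hz : SimpleVertices z) {i j : Fin n} {x : ℂ}
    (hi : x ∈ openSegment ℝ (z i) (z (finRotate n i)))
    (hj : x ∈ segment ℝ (z j) (z (finRotate n j))) : i = j := by
  by_contra hij
  rcases hz.eq_vertex_of_mem hij (openSegment_subset_segment _ _ _ hi) hj with ⟨-, h⟩ | ⟨-, h⟩
  · exact hz.notMem_openSegment i j (h ▸ hi)
  · exact hz.notMem_openSegment i i (h ▸ hi)

lemma eq_or_eq_of_vertex_mem (hz : SimpleVertices z) {i j : Fin n}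
    (hj : z (finRotate n i) ∈ segment ℝ (z j) (z (finRotate n j))) :
    j = i ∨ j = finRotate n i := by
  by_contra! h
  rcases hz.eq_vertex_of_mem h.1 hj (right_mem_segment ..) with ⟨h1, h2⟩ | ⟨h1, h2⟩
  · exact hz.rotate_ne i (hz.injective h2)
  · exact h.2 h1

lemma notMem_trace_erase (hz : SimpleVertices z) {i : Fin n} {x : ℂ}
    (hi : x ∈ openSegment ℝ (z i) (z (finRotate n i))) :
    x ∉ trace ((Finset.univ.erase i).val.map fun j => (z j, z (finRotate n j))) := by
  rw [mem_trace_map]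
  rintro ⟨j, hj, hx⟩
  have := hz.eq_of_mem_openSegment hi hx
  simp [this] at hj

lemma notMem_trace_erase_erase (hz : SimpleVertices z) (i : Fin n) :
    z (finRotate n i) ∉ trace (((Finset.univ.erase i).erase (finRotate n i)).val.map
      fun j => (z j, z (finRotate n j))) := by
  rw [mem_trace_map]
  rintro ⟨j, hj, hx⟩
  have := hz.eq_or_eq_of_vertex_mem hx
  simp only [Finset.mem_erase, Finset.mem_univ, and_true] at hj
  tauto

/-- A flat vertex lies between its neighbours. -/
lemma mem_openSegment_of_cross_eq_zero (hz : SimpleVertices z) (i : Fin n)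
    (h : cross (z (finRotate n i) - z i)
      (z (finRotate n (finRotate n i)) - z (finRotate n i)) = 0) :
    z (finRotate n i) ∈ openSegment ℝ (z i) (z (finRotate n (finRotate n i))) := by
  set a := z i with ha
  set b := z (finRotate n i) with hb
  set c := z (finRotate n (finRotate n i)) with hc
  have hab : a ≠ b := hz.ne i
  have hbc : b ≠ c := hz.ne (finRotate n i)
  have hac : a ≠ c := fun h => hz.rotate_rotate_ne i (hz.injective h.symm)
  have h3 := hz.consecutive i
  rw [← ha, ← hb, ← hc] at h3
  have hba : b - a ≠ 0 := sub_ne_zero.2 hab.symm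
  obtain ⟨k, hk⟩ : ∃ k : ℝ, c - b = k * (b - a) := by
    have h4 : ((c - b) / (b - a)).im = 0 := by rw [div_im_eq, h, zero_div]
    refine ⟨((c - b) / (b - a)).re, ?_⟩
    have h5 : (((c - b) / (b - a)).re : ℂ) = (c - b) / (b - a) := by
      apply Complex.ext <;> simp [h4]
    rw [h5, div_mul_cancel₀ _ hba]
  have hk0 : k ≠ 0 := by
    rintro rfl
    apply hbc
    have : c - b = 0 := by rw [hk]; simp
    exact (sub_eq_zero.1 this).symm
  rcases lt_or_gt_of_ne hk0 with hneg | hpos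
  -- With a negative factor the second edge folds back onto the first. The shorter of the two then
  -- ends on the longer one, away from their common vertex.
  · exfalso
    by_cases h1 : -1 ≤ k
    · have hcm : c ∈ segment ℝ a b := by
        refine ⟨-k, 1 + k, by linarith, by linarith, by ring, ?_⟩
        simp only [real_smul]
        push_cast
        linear_combination -hk
      have : c ∈ ({b} : Set ℂ) := h3 ▸ ⟨hcm, right_mem_segment ..⟩
      exact hbc (by simpa using this.symm)
    · push Not at h1
      have ham : a ∈ segment ℝ b c := by
        have hk1 : (k : ℂ) ≠ 0 := by exact_mod_cast hk0
        refine ⟨1 + 1 / k, -1 / k, ?_, ?_, by ring, ?_⟩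
        · have : -1 < 1 / k := by
            rw [lt_div_iff_of_neg hneg]; linarith
          linarith
        · exact (div_pos_of_neg_of_neg (by norm_num) hneg).le
        · simp only [real_smul]
          push_cast
          field_simp
          linear_combination -hk
      have : a ∈ ({b} : Set ℂ) := h3 ▸ ⟨left_mem_segment .., ham⟩
      exact hab (by simpa using this)
  · have h1k : (1 + k : ℂ) ≠ 0 := by
      have : (1 + k : ℝ) ≠ 0 := by positivity
      exact_mod_cast this
    refine ⟨k / (1 + k), 1 / (1 + k), by positivity, by positivity, by field_simp; ring, ?_⟩
    simp only [real_smul]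
    push_cast
    field_simp
    linear_combination hk

/-- There is an integer `r` such that the polygon winds `r + 1` times around the points on the left
of any of its edges, and `r` times around those on the right. -/
theorem exists_winding (hz : SimpleVertices z) : ∃ r : ℤ,
    (∀ i, ∀ x ∈ openSegment ℝ (z i) (z (finRotate n i)), ∀ᶠ y in 𝓝 x,
      (0 < cross (z (finRotate n i) - z i) (y - z i) → WindsAt (edges z) (r + 1) y) ∧
      (cross (z (finRotate n i) - z i) (y - z i) < 0 → WindsAt (edges z) r y)) ∧
    (∀ i, 0 ≤ cross (z (finRotate n i) - z i)
        (z (finRotate n (finRotate n i)) - z (finRotate n i)) →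
      ∀ᶠ y in 𝓝 (z (finRotate n i)),
        (0 < cross (z (finRotate n i) - z i) (y - z i) →
          0 < cross (z (finRotate n (finRotate n i)) - z (finRotate n i))
            (y - z (finRotate n i)) → WindsAt (edges z) (r + 1) y) ∧
        (cross (z (finRotate n i) - z i) (y - z i) < 0 ∨
          cross (z (finRotate n (finRotate n i)) - z (finRotate n i))
            (y - z (finRotate n i)) < 0 → WindsAt (edges z) r y)) ∧
    (∀ i, cross (z (finRotate n i) - z i)
        (z (finRotate n (finRotate n i)) - z (finRotate n i)) ≤ 0 →
      ∀ᶠ y in 𝓝 (z (finRotate n i)),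
        (0 < cross (z (finRotate n i) - z i) (y - z i) ∨
          0 < cross (z (finRotate n (finRotate n i)) - z (finRotate n i))
            (y - z (finRotate n i)) → WindsAt (edges z) (r + 1) y) ∧
        (cross (z (finRotate n i) - z i) (y - z i) < 0 →
          cross (z (finRotate n (finRotate n i)) - z (finRotate n i))
            (y - z (finRotate n i)) < 0 → WindsAt (edges z) r y)) := by
  have hedge : ∀ i, ∃ r : ℤ, ∀ x ∈ openSegment ℝ (z i) (z (finRotate n i)), ∀ᶠ y in 𝓝 x,
      (0 < cross (z (finRotate n i) - z i) (y - z i) → WindsAt (edges z) (r + 1) y) ∧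
      (cross (z (finRotate n i) - z i) (y - z i) < 0 → WindsAt (edges z) r y) := by
    intro i
    have hcyc := isCycle_edges z
    rw [edges_eq_cons z i] at hcyc ⊢
    obtain ⟨x₀, hx₀⟩ : (openSegment ℝ (z i) (z (finRotate n i))).Nonempty :=
      -- The open edge is connected and avoids its detour, so the winding number of the detour at
      -- one point of it serves for all.
      ⟨_, ⟨1 / 2, 1 / 2, by norm_num, by norm_num, by norm_num, rfl⟩⟩
    refine ⟨winding (detour (z i) (z (finRotate n i)) ((Finset.univ.erase i).val.map
      fun j => (z j, z (finRotate n j)))) x₀, fun x hx => ?_⟩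
    rw [winding_eq_of_preconnected (isCycle_detour hcyc) (convex_openSegment _ _).isPreconnected
      (fun w hw => notMem_trace_detour (hz.ne i) hw (hz.notMem_trace_erase hw)) hx₀ hx]
    exact edge_local (hz.ne i) hcyc hx (hz.notMem_trace_erase hx)
  choose r hr using hedge
  have hleft : ∀ i, 0 ≤ cross (z (finRotate n i) - z i)
        (z (finRotate n (finRotate n i)) - z (finRotate n i)) → ∃ s : ℤ,
      ∀ᶠ y in 𝓝 (z (finRotate n i)),
        (0 < cross (z (finRotate n i) - z i) (y - z i) →
          0 < cross (z (finRotate n (finRotate n i)) - z (finRotate n i))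
            (y - z (finRotate n i)) → WindsAt (edges z) (s + 1) y) ∧
        (cross (z (finRotate n i) - z i) (y - z i) < 0 ∨
          cross (z (finRotate n (finRotate n i)) - z (finRotate n i))
            (y - z (finRotate n i)) < 0 → WindsAt (edges z) s y) := by
    intro i h
    have hcyc := isCycle_edges z
    rw [edges_eq_cons_cons z (hz.rotate_ne i).symm] at hcyc ⊢
    rcases h.eq_or_lt with h | h
    · obtain ⟨s, hs⟩ := vertex_local_flat hcyc (hz.notMem_trace_erase_erase i)
        (fun h => hz.rotate_rotate_ne i (hz.injective h.symm))
        (hz.mem_openSegment_of_cross_eq_zero i h.symm)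
      exact ⟨s, hs.mono fun y hy => ⟨fun h1 _ => hy.1 (Or.inl h1), hy.2⟩⟩
    · exact vertex_local_left hcyc (hz.notMem_trace_erase_erase i) h
  have hright : ∀ i, cross (z (finRotate n i) - z i)
        (z (finRotate n (finRotate n i)) - z (finRotate n i)) ≤ 0 → ∃ s : ℤ,
      ∀ᶠ y in 𝓝 (z (finRotate n i)),
        (0 < cross (z (finRotate n i) - z i) (y - z i) ∨
          0 < cross (z (finRotate n (finRotate n i)) - z (finRotate n i))
            (y - z (finRotate n i)) → WindsAt (edges z) (s + 1) y) ∧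
        (cross (z (finRotate n i) - z i) (y - z i) < 0 →
          cross (z (finRotate n (finRotate n i)) - z (finRotate n i))
            (y - z (finRotate n i)) < 0 → WindsAt (edges z) s y) := by
    intro i h
    have hcyc := isCycle_edges z
    rw [edges_eq_cons_cons z (hz.rotate_ne i).symm] at hcyc ⊢
    rcases h.eq_or_lt with h | h
    · obtain ⟨s, hs⟩ := vertex_local_flat hcyc (hz.notMem_trace_erase_erase i)
        (fun h => hz.rotate_rotate_ne i (hz.injective h.symm))
        (hz.mem_openSegment_of_cross_eq_zero i h)
      exact ⟨s, hs.mono fun y hy => ⟨hy.1, fun h1 _ => hy.2 (Or.inl h1)⟩⟩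
    · exact vertex_local_right hcyc (hz.notMem_trace_erase_erase i) h
  -- At a left turn the points to the right of either edge already carry the value `s`, so the
  -- comparison with each of the two edges is made on its right side. At a right turn it is made on
  -- the left side.
  have hleft' : ∀ i s, (∀ᶠ y in 𝓝 (z (finRotate n i)),
        (cross (z (finRotate n i) - z i) (y - z i) < 0 ∨
          cross (z (finRotate n (finRotate n i)) - z (finRotate n i))
            (y - z (finRotate n i)) < 0 → WindsAt (edges z) s y)) →
      s = r i ∧ s = r (finRotate n i) := by
    intro i s hs
    constructor
    · obtain ⟨y, h1, h2⟩ := exists_common_side (τ := -1) (hz.ne i) (right_mem_segment ..)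
        (by norm_num) (A := WindsAt (edges z) s) (B := WindsAt (edges z) (r i))
        (hs.mono fun y hy h => hy (Or.inl (by linarith)))
        fun x hx => (hr i x hx).mono fun y hy h => hy.2 (by linarith)
      exact h1.unique h2
    · obtain ⟨y, h1, h2⟩ := exists_common_side (τ := -1) (hz.ne (finRotate n i))
        (left_mem_segment ..)
        (by norm_num) (A := WindsAt (edges z) s) (B := WindsAt (edges z) (r (finRotate n i)))
        (hs.mono fun y hy h => hy (Or.inr (by linarith)))
        fun x hx => (hr _ x hx).mono fun y hy h => hy.2 (by linarith)
      exact h1.unique h2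
  have hright' : ∀ i s, (∀ᶠ y in 𝓝 (z (finRotate n i)),
        (0 < cross (z (finRotate n i) - z i) (y - z i) ∨
          0 < cross (z (finRotate n (finRotate n i)) - z (finRotate n i))
            (y - z (finRotate n i)) → WindsAt (edges z) (s + 1) y)) →
      s = r i ∧ s = r (finRotate n i) := by
    intro i s hs
    constructor
    · obtain ⟨y, h1, h2⟩ := exists_common_side (τ := 1) (hz.ne i) (right_mem_segment ..)
        (by norm_num) (A := WindsAt (edges z) (s + 1)) (B := WindsAt (edges z) (r i + 1))
        (hs.mono fun y hy h => hy (Or.inl (by linarith)))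
        fun x hx => (hr i x hx).mono fun y hy h => hy.1 (by linarith)
      exact add_right_cancel (h1.unique h2)
    · obtain ⟨y, h1, h2⟩ := exists_common_side (τ := 1) (hz.ne (finRotate n i))
        (left_mem_segment ..)
        (by norm_num) (A := WindsAt (edges z) (s + 1))
        (B := WindsAt (edges z) (r (finRotate n i) + 1))
        (hs.mono fun y hy h => hy (Or.inr (by linarith)))
        fun x hx => (hr _ x hx).mono fun y hy h => hy.1 (by linarith)
      exact add_right_cancel (h1.unique h2)
  have hstep : ∀ i, r (finRotate n i) = r i := by
    intro i
    rcases le_total 0 (cross (z (finRotate n i) - z i)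
        (z (finRotate n (finRotate n i)) - z (finRotate n i))) with h | h
    · obtain ⟨s, hs⟩ := hleft i h
      obtain ⟨h1, h2⟩ := hleft' i s (hs.mono fun y hy => hy.2)
      rw [← h1, ← h2]
    · obtain ⟨s, hs⟩ := hright i h
      obtain ⟨h1, h2⟩ := hright' i s (hs.mono fun y hy => hy.1)
      rw [← h1, ← h2]
  have hn : 0 < n := by have := hz.three_le; omega
  have hconst : ∀ i, r i = r ⟨0, hn⟩ := by
    intro i
    obtain ⟨k, -, rfl⟩ := exists_iterate_eq ⟨0, hn⟩ i
    induction k with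
    | zero => rfl
    | succ k ih => rw [Function.iterate_succ_apply', hstep, ih]
  refine ⟨r ⟨0, hn⟩, fun i x hx => ?_, fun i h => ?_, fun i h => ?_⟩
  · have := hr i x hx
    rwa [hconst i] at this
  · obtain ⟨s, hs⟩ := hleft i h
    have := (hleft' i s (hs.mono fun y hy => hy.2)).1
    rw [hconst i] at this
    rwa [this] at hs
  · obtain ⟨s, hs⟩ := hright i h
    have := (hright' i s (hs.mono fun y hy => hy.1)).1
    rw [hconst i] at this
    rwa [this] at hs

end SimpleVertices

/-- The points enclosed by a polygon an odd number of times. -/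
def Inside (z : Fin n → ℂ) : Set ℂ := {y | y ∉ trace (edges z) ∧ Odd (winding (edges z) y)}

/-- The points off a polygon which it encloses an even number of times. -/
def Outside (z : Fin n → ℂ) : Set ℂ := {y | y ∉ trace (edges z) ∧ Even (winding (edges z) y)}

/-- The signed height of a point above the line through an edge; `σ` stands for the orientation. -/
def height (σ : ℝ) (z : Fin n → ℂ) (i : Fin n) (y : ℂ) : ℝ :=
  σ * cross (z (finRotate n i) - z i) (y - z i)

/-- The turn of the polygon at the end of an edge; `σ` stands for the orientation. -/
def turn (σ : ℝ) (z : Fin n → ℂ) (i : Fin n) : ℝ :=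
  σ * cross (z (finRotate n i) - z i) (z (finRotate n (finRotate n i)) - z (finRotate n i))

/-- The points of positive height above the edges are inside locally. -/
structure Oriented (σ : ℝ) (z : Fin n → ℂ) : Prop extends SimpleVertices z where
  orientation_ne : σ ≠ 0
  edge : ∀ i, ∀ x ∈ openSegment ℝ (z i) (z (finRotate n i)), ∀ᶠ y in 𝓝 x,
    (0 < height σ z i y → y ∈ Inside z) ∧ (height σ z i y < 0 → y ∈ Outside z)
  convex : ∀ i, 0 < turn σ z i → ∀ᶠ y in 𝓝 (z (finRotate n i)),
    (0 < height σ z i y → 0 < height σ z (finRotate n i) y → y ∈ Inside z) ∧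
    (height σ z i y < 0 ∨ height σ z (finRotate n i) y < 0 → y ∈ Outside z)
  reflex : ∀ i, turn σ z i ≤ 0 → ∀ᶠ y in 𝓝 (z (finRotate n i)),
    (0 < height σ z i y ∨ 0 < height σ z (finRotate n i) y → y ∈ Inside z) ∧
    (height σ z i y < 0 → height σ z (finRotate n i) y < 0 → y ∈ Outside z)

/-- Exactly one of `r` and `r + 1` is odd, and `σ` is chosen so that positive height means the odd
side. For `σ = -1` left and right turns exchange their roles. -/
theorem SimpleVertices.exists_oriented {z : Fin n → ℂ} (hz : SimpleVertices z) :
    ∃ σ : ℝ, Oriented σ z := by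
  obtain ⟨r, h1, h2, h3⟩ := hz.exists_winding
  rcases Int.even_or_odd r with hr | hr
  · have hin : ∀ y, WindsAt (edges z) (r + 1) y → y ∈ Inside z := by
      rintro y ⟨hy1, hy2⟩
      exact ⟨hy1, hy2 ▸ hr.add_one⟩
    have hout : ∀ y, WindsAt (edges z) r y → y ∈ Outside z := by
      rintro y ⟨hy1, hy2⟩
      exact ⟨hy1, hy2 ▸ hr⟩
    refine ⟨1, { hz with orientation_ne := by norm_num, edge := ?_, convex := ?_, reflex := ?_ }⟩
    · intro i x hx
      filter_upwards [h1 i x hx] with y hy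
      simp only [height, one_mul]
      exact ⟨fun h => hin y (hy.1 h), fun h => hout y (hy.2 h)⟩
    · intro i hi
      simp only [turn, one_mul] at hi
      filter_upwards [h2 i hi.le] with y hy
      simp only [height, one_mul]
      exact ⟨fun h h' => hin y (hy.1 h h'), fun h => hout y (hy.2 h)⟩
    · intro i hi
      simp only [turn, one_mul] at hi
      filter_upwards [h3 i hi] with y hy
      simp only [height, one_mul]
      exact ⟨fun h => hin y (hy.1 h), fun h h' => hout y (hy.2 h h')⟩
  · have hin : ∀ y, WindsAt (edges z) r y → y ∈ Inside z := by
      rintro y ⟨hy1, hy2⟩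
      exact ⟨hy1, hy2 ▸ hr⟩
    have hout : ∀ y, WindsAt (edges z) (r + 1) y → y ∈ Outside z := by
      rintro y ⟨hy1, hy2⟩
      exact ⟨hy1, hy2 ▸ hr.add_one⟩
    refine ⟨-1, { hz with orientation_ne := by norm_num, edge := ?_, convex := ?_, reflex := ?_ }⟩
    · intro i x hx
      filter_upwards [h1 i x hx] with y hy
      simp only [height, neg_mul, one_mul, neg_pos, neg_lt_zero]
      exact ⟨fun h => hin y (hy.2 h), fun h => hout y (hy.1 h)⟩
    · intro i hi
      simp only [turn, neg_mul, one_mul, neg_pos] at hi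
      filter_upwards [h3 i hi.le] with y hy
      simp only [height, neg_mul, one_mul, neg_pos, neg_lt_zero]
      exact ⟨fun h h' => hin y (hy.2 h h'), fun h => hout y (hy.1 h)⟩
    · intro i hi
      simp only [turn, neg_mul, one_mul, neg_nonpos] at hi
      filter_upwards [h2 i hi] with y hy
      simp only [height, neg_mul, one_mul, neg_pos, neg_lt_zero]
      exact ⟨fun h => hin y (hy.2 h), fun h h' => hout y (hy.1 h h')⟩

end PolygonVisibility

/-! ### Lines of sight and rays. -/

namespace PolygonVisibility

open Complex Filter Topology

variable {n : ℕ} {z : Fin n → ℂ} {σ : ℝ}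

/-- An edge of a polygon without its endpoints. -/
def openEdge (z : Fin n → ℂ) (i : Fin n) : Set ℂ := openSegment ℝ (z i) (z (finRotate n i))

/-- The open segment between two points lies inside the polygon. -/
def Sees (z : Fin n → ℂ) (x y : ℂ) : Prop :=
  x ≠ y ∧ ∀ s : ℝ, 0 < s → s < 1 → x + s * (y - x) ∈ Inside z

lemma Sees.symm {x y : ℂ} (h : Sees z x y) : Sees z y x := by
  refine ⟨h.1.symm, fun s h0 h1 => ?_⟩
  have := h.2 (1 - s) (by linarith) (by linarith)
  convert this using 1
  push_cast; ring

lemma openEdge_subset_trace {i : Fin n} {x : ℂ} (hx : x ∈ openEdge z i) : x ∈ trace (edges z) :=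
  mem_trace_edges.2 ⟨i, openSegment_subset_segment _ _ _ hx⟩

lemma notMem_inside_of_trace {x : ℂ} (hx : x ∈ trace (edges z)) : x ∉ Inside z := fun h => h.1 hx

lemma disjoint_inside_outside {x : ℂ} (h : x ∈ Inside z) (h' : x ∈ Outside z) : False :=
  Int.not_even_iff_odd.2 h.2 h'.2

lemma mem_trace_or (x : ℂ) : x ∈ trace (edges z) ∨ x ∈ Inside z ∨ x ∈ Outside z := by
  by_cases h : x ∈ trace (edges z)
  · exact Or.inl h
  · rcases Int.even_or_odd (winding (edges z) x) with h' | h'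
    · exact Or.inr (Or.inr ⟨h, h'⟩)
    · exact Or.inr (Or.inl ⟨h, h'⟩)

lemma isOpen_inside (z : Fin n → ℂ) : IsOpen (Inside z) := by
  rw [isOpen_iff_eventually]
  intro x hx
  filter_upwards [winding_eventually_eq (isCycle_edges z) hx.1] with y hy
  exact ⟨hy.1, hy.2 ▸ hx.2⟩

lemma isOpen_outside (z : Fin n → ℂ) : IsOpen (Outside z) := by
  rw [isOpen_iff_eventually]
  intro x hx
  filter_upwards [winding_eventually_eq (isCycle_edges z) hx.1] with y hy
  exact ⟨hy.1, hy.2 ▸ hx.2⟩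

lemma outside_of_norm_lt {x : ℂ} (h : ∀ i, ‖z i‖ < ‖x‖) :
    x ∈ Outside z ∧ winding (edges z) x = 0 := by
  have h1 : x ∉ trace (edges z) := by
    rw [mem_trace_edges]
    rintro ⟨i, hi⟩
    have := (convex_ball (0 : ℂ) ‖x‖).segment_subset (by simpa using h i)
      (by simpa using h (finRotate n i)) hi
    simp at this
  have h2 : winding (edges z) x = 0 := by
    refine winding_eq_zero_of_norm_le (isCycle_edges z) (o := 0) fun e he => ?_
    simp only [edges, Multiset.mem_map] at he
    obtain ⟨i, -, rfl⟩ := he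
    simp only [sub_zero]
    exact ⟨⟨(h _).le, fun h' => (h i).ne (by rw [h'])⟩,
      ⟨(h _).le, fun h' => (h (finRotate n i)).ne (by rw [h'])⟩⟩
  exact ⟨⟨h1, by rw [h2]; exact Even.zero⟩, h2⟩

lemma exists_norm_bound (z : Fin n → ℂ) : ∃ M : ℝ, 0 < M ∧ ∀ i, ‖z i‖ < M := by
  refine ⟨1 + ∑ i, ‖z i‖, by positivity, fun i => ?_⟩
  have := Finset.single_le_sum (f := fun i => ‖z i‖) (fun i _ => norm_nonneg _) (Finset.mem_univ i)
  linarith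

/-- A ray that starts inside a polygon hits the polygon. -/
lemma exists_hit {x θ : ℂ} (hθ : θ ≠ 0) (h : ∀ᶠ t : ℝ in 𝓝[>] 0, x + t * θ ∈ Inside z) :
    ∃ T : ℝ, 0 < T ∧ x + T * θ ∈ trace (edges z) ∧
      ∀ t : ℝ, 0 < t → t < T → x + t * θ ∈ Inside z := by
  obtain ⟨ε, hε, hin⟩ := (mem_nhdsGT_iff_exists_Ioo_subset).1 h
  have hε : 0 < ε := hε
  -- The first time off the interior is the infimum of `S`. Interior and exterior are both open, so
  -- the point reached then lies in neither of them.
  set S : Set ℝ := {t | 0 < t ∧ x + t * θ ∉ Inside z} with hS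
  have hne : S.Nonempty := by
    obtain ⟨M, hM, hb⟩ := exists_norm_bound z
    have hθ' : 0 < ‖θ‖ := norm_pos_iff.2 hθ
    refine ⟨(M + ‖x‖) / ‖θ‖, by positivity, fun h' => ?_⟩
    refine disjoint_inside_outside h' (outside_of_norm_lt fun i => (hb i).trans_le ?_).1
    have h1 : ‖(((M + ‖x‖) / ‖θ‖ : ℝ) : ℂ) * θ‖ = M + ‖x‖ := by
      rw [norm_mul, norm_real, Real.norm_of_nonneg (by positivity), div_mul_cancel₀ _ hθ'.ne']
    have h2 := norm_sub_le (x + (((M + ‖x‖) / ‖θ‖ : ℝ) : ℂ) * θ) x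
    rw [add_sub_cancel_left, h1] at h2
    linarith
  have hbd : BddBelow S := ⟨0, fun t ht => ht.1.le⟩
  have hge : ε ≤ sInf S := by
    refine le_csInf hne fun t ht => ?_
    by_contra hlt
    push Not at hlt
    exact ht.2 (hin ⟨ht.1, hlt⟩)
  have hT : 0 < sInf S := hε.trans_le hge
  have hlt : ∀ t : ℝ, 0 < t → t < sInf S → x + t * θ ∈ Inside z := by
    intro t h0 h1
    by_contra hn
    exact notMem_of_lt_csInf h1 hbd ⟨h0, hn⟩
  have hc : Continuous fun t : ℝ => x + t * θ := by fun_prop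
  refine ⟨sInf S, hT, ?_, hlt⟩
  rcases mem_trace_or (z := z) (x + (sInf S : ℝ) * θ) with h1 | h1 | h1
  · exact h1
  · exfalso
    have h2 := hc.continuousAt.eventually ((isOpen_inside z).mem_nhds h1)
    obtain ⟨δ, hδ, hδ'⟩ := Metric.eventually_nhds_iff.1 h2
    obtain ⟨t, ht, ht'⟩ := exists_lt_of_csInf_lt hne (show sInf S < sInf S + δ by linarith)
    refine ht.2 (hδ' ?_)
    have := csInf_le hbd ht
    rw [Real.dist_eq, abs_lt]
    constructor <;> linarith
  · exfalso
    have h2 := hc.continuousAt.eventually ((isOpen_outside z).mem_nhds h1)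
    obtain ⟨δ, hδ, hδ'⟩ := Metric.eventually_nhds_iff.1 h2
    set t := max (sInf S / 2) (sInf S - δ / 2) with ht
    have ht1 : t < sInf S := max_lt (by linarith) (by linarith)
    have ht2 : sInf S / 2 ≤ t := le_max_left ..
    have ht3 : sInf S - δ / 2 ≤ t := le_max_right ..
    refine disjoint_inside_outside (hlt t (by linarith) ht1) (hδ' ?_)
    rw [Real.dist_eq, abs_lt]
    constructor <;> linarith

lemma sees_of_ray {x θ : ℂ} {T : ℝ} (hT : 0 < T) (hθ : θ ≠ 0)
    (h : ∀ t : ℝ, 0 < t → t < T → x + t * θ ∈ Inside z) : Sees z x (x + T * θ) := by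
  have hT' : (T : ℂ) ≠ 0 := by exact_mod_cast hT.ne'
  refine ⟨fun h0 => ?_, fun s h0 h1 => ?_⟩
  · have : (T : ℂ) * θ = 0 := by linear_combination -h0
    exact mul_ne_zero hT' hθ this
  · have := h (s * T) (by positivity) (by nlinarith)
    convert this using 1
    push_cast; ring

lemma Sees.ray {x θ : ℂ} {T : ℝ} (h : Sees z x (x + T * θ)) {t : ℝ} (h0 : 0 < t)
    (h1 : t < T) : x + t * θ ∈ Inside z := by
  have hT : 0 < T := h0.trans h1
  have := h.2 (t / T) (by positivity) ((div_lt_one hT).2 h1)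
  convert this using 1
  have hT' : (T : ℂ) ≠ 0 := by exact_mod_cast hT.ne'
  push_cast
  field_simp
  ring

lemma height_line (i : Fin n) (x y : ℂ) (s : ℝ) :
    height σ z i (x + s * (y - x)) = (1 - s) * height σ z i x + s * height σ z i y := by
  simp [height, cross]; ring

lemma height_ray (i : Fin n) (x θ : ℂ) (s : ℝ) :
    height σ z i (x + s * θ) = (1 - s) * height σ z i x + s * height σ z i (x + θ) := by
  simp [height, cross]; ring

lemma continuous_height (i : Fin n) : Continuous (height σ z i) :=
  continuous_const.mul (continuous_cross_sub _ _)

lemma height_left (i : Fin n) : height σ z i (z i) = 0 := by simp [height, cross]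

lemma height_right (i : Fin n) : height σ z i (z (finRotate n i)) = 0 := by
  simp [height, cross, mul_comm]

lemma height_of_mem_openEdge {i : Fin n} {x : ℂ} (hx : x ∈ openEdge z i) :
    height σ z i x = 0 := by
  obtain ⟨s, t, -, -, hst, rfl⟩ := hx
  obtain rfl : s = 1 - t := by linarith
  simp [height, cross]; ring_nf; simp

lemma exists_param_of_cross_eq_zero {d w : ℂ} (hd : d ≠ 0) (h : cross d w = 0) :
    w = ((w / d).re : ℂ) * d := by
  have h4 : (w / d).im = 0 := by rw [div_im_eq, h, zero_div]
  have h5 : ((w / d).re : ℂ) = w / d := by apply Complex.ext <;> simp [h4]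
  rw [h5, div_mul_cancel₀ _ hd]

lemma mem_openSegment_iff_param {a b y : ℂ} :
    y ∈ openSegment ℝ a b ↔ ∃ s : ℝ, 0 < s ∧ s < 1 ∧ y = a + s * (b - a) := by
  rw [openSegment_eq_image']
  constructor
  · rintro ⟨s, ⟨h0, h1⟩, rfl⟩
    exact ⟨s, h0, h1, by simp⟩
  · rintro ⟨s, h0, h1, rfl⟩
    exact ⟨s, ⟨h0, h1⟩, by simp⟩

lemma eventually_mem_openSegment {a b x : ℂ} (hab : a ≠ b) (hx : x ∈ openSegment ℝ a b) :
    ∀ᶠ y in 𝓝 x, cross (b - a) (y - a) = 0 → y ∈ openSegment ℝ a b := by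
  have hd : b - a ≠ 0 := sub_ne_zero.2 hab.symm
  obtain ⟨s, h0, h1, rfl⟩ := mem_openSegment_iff_param.1 hx
  have hc : Continuous fun y : ℂ => ((y - a) / (b - a)).re := by fun_prop
  have hs : ((a + s * (b - a) - a) / (b - a)).re = s := by
    rw [add_sub_cancel_left, mul_div_cancel_right₀ _ hd, ofReal_re]
  have e1 := (hc.continuousAt (x := a + s * (b - a))).eventually (lt_mem_nhds (hs.symm ▸ h0))
  have e2 := (hc.continuousAt (x := a + s * (b - a))).eventually (gt_mem_nhds (hs.symm ▸ h1))
  filter_upwards [e1, e2] with y hy1 hy2 hy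
  refine mem_openSegment_iff_param.2 ⟨_, hy1, hy2, ?_⟩
  rw [← exists_param_of_cross_eq_zero hd hy]
  ring

/-- Near its end `b`, the line through `a` and `b` coincides with the segment on one side of `b`.
That side is detected by any transversal through `b`, here the line of direction `d`. The point `o`
only has to lie on this transversal. -/
lemma eventually_mem_openSegment_endpoint {a b d o : ℂ} (hab : a ≠ b)
    (hb : cross d (b - o) = 0) :
    ∀ᶠ y in 𝓝 b, cross (b - a) (y - a) = 0 → 0 < cross d (y - o) * cross d (a - o) →
      y ∈ openSegment ℝ a b := by
  have hd : a - b ≠ 0 := sub_ne_zero.2 hab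
  have hc : Continuous fun y : ℂ => ((y - b) / (a - b)).re := by fun_prop
  have e2 := (hc.continuousAt (x := b)).eventually (gt_mem_nhds (show ((b - b) / (a - b)).re < 1 by simp))
  filter_upwards [e2] with y hy2 hy hpos
  have h1 : cross (a - b) (y - b) = 0 := by
    have : cross (a - b) (y - b) = - cross (b - a) (y - a) := by simp [cross]; ring
    rw [this, hy, neg_zero]
  have h2 := exists_param_of_cross_eq_zero hd h1
  set s := ((y - b) / (a - b)).re with hs
  have h3 : cross d (y - o) = s * cross d (a - o) := by
    have h4 : y - o = (b - o) + s * (a - b) := by rw [← h2]; ring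
    rw [h4, cross_add_right, cross_smul_right, hb]
    have : cross d (a - o) = cross d (a - b) := by
      have : a - o = (b - o) + (a - b) := by ring
      rw [this, cross_add_right, hb, zero_add]
    rw [this, zero_add]
  rw [h3] at hpos
  have h5 : 0 < s := by
    by_contra hn
    push Not at hn
    nlinarith [mul_self_nonneg (cross d (a - o))]
  rw [openSegment_symm]
  refine mem_openSegment_iff_param.2 ⟨s, h5, hy2, ?_⟩
  rw [← h2]; ring

namespace Oriented

lemma height_eq_zero_iff (ho : Oriented σ z) {i : Fin n} {y : ℂ} :
    height σ z i y = 0 ↔ cross (z (finRotate n i) - z i) (y - z i) = 0 := by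
  simp [height, ho.orientation_ne]

lemma eventually_mem_openEdge (ho : Oriented σ z) {i : Fin n} {x : ℂ} (hx : x ∈ openEdge z i) :
    ∀ᶠ y in 𝓝 x, height σ z i y = 0 → y ∈ openEdge z i := by
  filter_upwards [eventually_mem_openSegment (ho.ne i) hx] with y hy h
  exact hy (ho.height_eq_zero_iff.1 h)

/-- The line of sight starts inside. Near `p`, points of negative height are outside and points of
height zero are on the edge. -/
lemma height_pos_of_sees (ho : Oriented σ z) {i : Fin n} {p q : ℂ} (hp : p ∈ openEdge z i)
    (h : Sees z p q) : 0 < height σ z i q := by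
  have hc : Continuous fun s : ℝ => p + s * (q - p) := by fun_prop
  have ht : Tendsto (fun s : ℝ => p + s * (q - p)) (𝓝[>] 0) (𝓝 p) := by
    have := hc.tendsto 0
    simp only [ofReal_zero, zero_mul, add_zero] at this
    exact this.mono_left nhdsWithin_le_nhds
  have e1 := ht.eventually (ho.edge i p hp)
  have e2 := ht.eventually (ho.eventually_mem_openEdge hp)
  obtain ⟨s, ⟨h1, h2⟩, h0, hs1⟩ := ((e1.and e2).and (Ioo_mem_nhdsGT one_pos)).exists
  have hin := h.2 s h0 hs1
  rw [height_line, height_of_mem_openEdge hp, mul_zero, zero_add] at h1 h2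
  rcases lt_trichotomy 0 (height σ z i q) with h3 | h3 | h3
  · exact h3
  · exact (notMem_inside_of_trace (openEdge_subset_trace (h2 (by rw [← h3, mul_zero]))) hin).elim
  · exact (disjoint_inside_outside hin (h1.2 (mul_neg_of_pos_of_neg h0 h3))).elim

end Oriented

/-- A continuous affine function on the plane. -/
def IsAffine (f : ℂ → ℝ) : Prop :=
  Continuous f ∧ ∀ (x y : ℂ) (s : ℝ), f (x + s * (y - x)) = (1 - s) * f x + s * f y

lemma isAffine_height (i : Fin n) : IsAffine (height σ z i) :=
  ⟨continuous_height i, height_line i⟩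

/-- Small perturbations within suitable cones of two points that see each other preserve
visibility. -/
lemma Sees.eventually {p q : ℂ} (h : Sees z p q) {f₁ f₂ g₁ g₂ : ℂ → ℝ} (hf₁ : IsAffine f₁)
    (hf₂ : IsAffine f₂) (hg₁ : IsAffine g₁) (hg₂ : IsAffine g₂)
    (hf : ∀ᶠ y in 𝓝 p, 0 < f₁ y → 0 < f₂ y → y ∈ Inside z)
    (hg : ∀ᶠ y in 𝓝 q, 0 < g₁ y → 0 < g₂ y → y ∈ Inside z)
    (h1 : 0 < f₁ q) (h2 : 0 < f₂ q) (h3 : 0 < g₁ p) (h4 : 0 < g₂ p) :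
    ∀ᶠ w in 𝓝 (p, q), 0 ≤ f₁ w.1 → 0 ≤ f₂ w.1 → 0 ≤ g₁ w.2 → 0 ≤ g₂ w.2 →
      Sees z w.1 w.2 := by
  have hne : ∀ᶠ w : ℂ × ℂ in 𝓝 (p, q), w.1 ≠ w.2 :=
    (isOpen_ne_fun continuous_fst continuous_snd).mem_nhds h.1
  have hpos : ∀ {f : ℂ → ℝ} {a : ℂ}, IsAffine f → 0 < f a → ∀ᶠ y in 𝓝 a, 0 < f y :=
    fun hf ha => hf.1.continuousAt.eventually (lt_mem_nhds ha)
  have hkey : ∀ᶠ w : ℂ × ℂ in 𝓝 (p, q), ∀ s ∈ Set.Icc (0 : ℝ) 1,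
      0 < s → s < 1 → 0 ≤ f₁ w.1 → 0 ≤ f₂ w.1 → 0 ≤ g₁ w.2 → 0 ≤ g₂ w.2 →
        w.1 + s * (w.2 - w.1) ∈ Inside z := by
    -- By compactness it suffices to treat each parameter `s` locally. In between, the interior is
    -- open. At the two ends, affinity makes the functions positive as soon as the point leaves the
    -- endpoint, and the cone conditions apply. Two functions at each end allow for convex corners,
    -- and for a single edge they coincide.
    refine isCompact_Icc.eventually_forall_of_forall_eventually fun s hs => ?_
    have hc : Continuous fun v : (ℂ × ℂ) × ℝ => v.1.1 + v.2 * (v.1.2 - v.1.1) := by fun_prop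
    have hfst : Tendsto (fun v : (ℂ × ℂ) × ℝ => v.1.1) (𝓝 ((p, q), s)) (𝓝 p) :=
      (continuous_fst.comp continuous_fst).tendsto _
    have hsnd : Tendsto (fun v : (ℂ × ℂ) × ℝ => v.1.2) (𝓝 ((p, q), s)) (𝓝 q) :=
      (continuous_snd.comp continuous_fst).tendsto _
    have ht := hc.tendsto ((p, q), s)
    simp only at ht
    rcases hs.1.eq_or_lt with rfl | h0
    · simp only [ofReal_zero, zero_mul, add_zero] at ht
      filter_upwards [ht.eventually hf, hsnd.eventually (hpos hf₁ h1),
        hsnd.eventually (hpos hf₂ h2)] with v hv1 hv2 hv3 k0 k1 m1 m2 m3 m4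
      refine hv1 ?_ ?_
      · rw [hf₁.2]
        have := mul_nonneg (sub_nonneg.2 k1.le) m1
        have := mul_pos k0 hv2
        linarith
      · rw [hf₂.2]
        have := mul_nonneg (sub_nonneg.2 k1.le) m2
        have := mul_pos k0 hv3
        linarith
    rcases hs.2.eq_or_lt with rfl | h1
    · simp only [ofReal_one, one_mul, add_sub_cancel] at ht
      filter_upwards [ht.eventually hg, hfst.eventually (hpos hg₁ h3),
        hfst.eventually (hpos hg₂ h4)] with v hv1 hv2 hv3 k0 k1 m1 m2 m3 m4
      refine hv1 ?_ ?_
      · rw [hg₁.2]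
        have := mul_nonneg k0.le m3
        have := mul_pos (sub_pos.2 k1) hv2
        linarith
      · rw [hg₂.2]
        have := mul_nonneg k0.le m4
        have := mul_pos (sub_pos.2 k1) hv3
        linarith
    · filter_upwards [ht.eventually ((isOpen_inside z).mem_nhds (h.2 s h0 h1))]
        with v hv _ _ _ _ _ _
      exact hv
  filter_upwards [hne, hkey] with w hw1 hw2 m1 m2 m3 m4
  exact ⟨hw1, fun s h0 h1 => hw2 s ⟨h0.le, h1.le⟩ h0 h1 m1 m2 m3 m4⟩

/-- The vectors `θ₁` and `θ₂` are independent, so each vertex is met for at most one `s`, and only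
finitely many values of `s` are excluded. -/
lemma eventually_cross_ne (z : Fin n → ℂ) (x : ℂ) {θ₁ θ₂ : ℂ} (hθ : cross θ₁ θ₂ ≠ 0) :
    ∀ᶠ s : ℝ in 𝓝[>] 0, ∀ i, z i ≠ x → cross (z i - x) (θ₁ + s * θ₂) ≠ 0 := by
  rw [eventually_all]
  intro i
  by_cases hi : z i = x
  · exact Eventually.of_forall fun s h => (h hi).elim
  have hd : z i - x ≠ 0 := sub_ne_zero.2 hi
  have hc : ∀ s : ℝ, cross (z i - x) (θ₁ + s * θ₂) =
      cross (z i - x) θ₁ + s * cross (z i - x) θ₂ := by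
    intro s; rw [cross_add_right, cross_smul_right]
  simp only [hc]
  by_cases h1 : cross (z i - x) θ₁ = 0
  · have h2 : cross (z i - x) θ₂ ≠ 0 := by
      intro h2
      apply hθ
      rw [exists_param_of_cross_eq_zero hd h1, exists_param_of_cross_eq_zero hd h2,
        cross_smul_left, cross_smul_right]
      simp [cross, mul_comm]
    filter_upwards [self_mem_nhdsWithin] with s hs _
    rw [h1, zero_add]
    exact mul_ne_zero (ne_of_gt hs) h2
  · have hcont : Continuous fun s : ℝ => cross (z i - x) θ₁ + s * cross (z i - x) θ₂ := by
      fun_prop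
    have := (hcont.continuousAt (x := (0 : ℝ))).eventually_ne (y := 0) (by simpa using h1)
    filter_upwards [nhdsWithin_le_nhds this] with s hs _
    exact hs

lemma mem_openEdge_of_trace {x : ℂ} (hx : x ∈ trace (edges z)) (hv : ∀ i, z i ≠ x) :
    ∃ j, x ∈ openEdge z j := by
  obtain ⟨j, hj⟩ := mem_trace_edges.1 hx
  exact ⟨j, mem_openSegment_of_ne_left_right (hv j) (hv _) hj⟩

/-- Rays in a generic direction hit a polygon in the interior of an edge. -/
lemma eventually_exists_sees {x θ₁ θ₂ : ℂ} (hθ : cross θ₁ θ₂ ≠ 0)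
    (h : ∀ᶠ s : ℝ in 𝓝[>] 0, ∀ᶠ t : ℝ in 𝓝[>] 0, x + t * (θ₁ + s * θ₂) ∈ Inside z) :
    ∀ᶠ s : ℝ in 𝓝[>] 0, ∃ j, ∃ T : ℝ, 0 < T ∧ x + T * (θ₁ + s * θ₂) ∈ openEdge z j ∧
      Sees z x (x + T * (θ₁ + s * θ₂)) := by
  filter_upwards [h, eventually_cross_ne z x hθ] with s hs1 hs2
  have hne : θ₁ + s * θ₂ ≠ 0 := by
    intro h0
    apply hθ
    have : θ₁ = ((-s : ℝ) : ℂ) * θ₂ := by push_cast; linear_combination h0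
    rw [this, cross_smul_left]
    simp [cross, mul_comm]
  obtain ⟨T, hT, htr, hin⟩ := exists_hit hne hs1
  have hsees := sees_of_ray hT hne hin
  obtain ⟨j, hj⟩ := mem_openEdge_of_trace htr fun i hi => by
    refine hs2 i (by rw [hi]; exact hsees.1.symm) ?_
    rw [hi, add_sub_cancel_left, cross_smul_left]
    simp [cross, mul_comm]
  exact ⟨j, T, hT, hj, hsees⟩

end PolygonVisibility

/-! ### Sightings from edges and from vertices. -/

namespace PolygonVisibility

open Complex Filter Topology

variable {n : ℕ} {z : Fin n → ℂ} {σ : ℝ}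

lemma height_add (i : Fin n) (x w : ℂ) : height σ z i (x + w) =
    height σ z i x + σ * cross (z (finRotate n i) - z i) w := by
  simp [height, cross]; ring

lemma height_next (i : Fin n) :
    height σ z i (z (finRotate n (finRotate n i))) = turn σ z i := by
  simp only [height, turn, cross, sub_re, sub_im]; ring

lemma height_prev (i : Fin n) : height σ z (finRotate n i) (z i) = turn σ z i := by
  simp only [height, turn, cross, sub_re, sub_im]; ring

lemma height_next_left (i : Fin n) :
    height σ z (finRotate n i) (z (finRotate n i)) = 0 := height_left _

lemma tendsto_ray (x θ : ℂ) : Tendsto (fun t : ℝ => x + t * θ) (𝓝[>] 0) (𝓝 x) := by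
  have hc : Continuous fun t : ℝ => x + t * θ := by fun_prop
  have := hc.tendsto 0
  simp only [ofReal_zero, zero_mul, add_zero] at this
  exact this.mono_left nhdsWithin_le_nhds

lemma exists_mem_openEdge_left (i : Fin n) {p : ℂ → Prop}
    (h : ∀ᶠ y in 𝓝 (z i), p y) : ∃ y ∈ openEdge z i, p y := by
  have h1 : z i ∈ closure (openEdge z i) := by
    rw [openEdge, closure_openSegment]; exact left_mem_segment ..
  obtain ⟨y, hy, hp⟩ := ((mem_closure_iff_frequently.1 h1).and_eventually h).exists
  exact ⟨y, hy, hp⟩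

lemma exists_mem_openEdge_right (i : Fin n) {p : ℂ → Prop}
    (h : ∀ᶠ y in 𝓝 (z (finRotate n i)), p y) : ∃ y ∈ openEdge z i, p y := by
  have h1 : z (finRotate n i) ∈ closure (openEdge z i) := by
    rw [openEdge, closure_openSegment]; exact right_mem_segment ..
  obtain ⟨y, hy, hp⟩ := ((mem_closure_iff_frequently.1 h1).and_eventually h).exists
  exact ⟨y, hy, hp⟩

lemma normSq_edge_pos (hz : SimpleVertices z) (i : Fin n) :
    0 < ((z (finRotate n i)).re - (z i).re) ^ 2 + ((z (finRotate n i)).im - (z i).im) ^ 2 :=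
  normSq_pos_of_ne (hz.ne i)

namespace Oriented

/-- Every point in the interior of an edge sees some point in the interior of an edge. -/
lemma exists_sees (ho : Oriented σ z) {i : Fin n} {p : ℂ} (hp : p ∈ openEdge z i) :
    ∃ j, ∃ q ∈ openEdge z j, Sees z p q := by
  have hpos := normSq_edge_pos ho.toSimpleVertices i
  have hσ := ho.orientation_ne
  set e := z (finRotate n i) - z i with he
  -- The inward normal is tilted slightly along the edge to miss all vertices.
  have hcr : cross (σ * (I * e)) e ≠ 0 := by
    have : cross (σ * (I * e)) e = -σ * (((z (finRotate n i)).re - (z i).re) ^ 2 +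
      ((z (finRotate n i)).im - (z i).im) ^ 2) := by simp [he, cross]; ring
    rw [this]
    exact mul_ne_zero (neg_ne_zero.2 hσ) hpos.ne'
  have h := eventually_exists_sees (z := z) (x := p) hcr ?_
  · obtain ⟨s, j, T, -, h1, h2⟩ := h.exists
    exact ⟨j, _, h1, h2⟩
  · refine Eventually.of_forall fun s => ?_
    filter_upwards [(tendsto_ray p _).eventually (ho.edge i p hp), self_mem_nhdsWithin]
      with t ht ht0
    refine ht.1 ?_
    rw [height_add, height_of_mem_openEdge hp, zero_add, cross_smul_right, ← he]
    have : σ * ((t : ℝ) * cross e (σ * (I * e) + s * e)) =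
        t * σ ^ 2 * (((z (finRotate n i)).re - (z i).re) ^ 2 +
          ((z (finRotate n i)).im - (z i).im) ^ 2) := by simp [he, cross]; ring
    rw [this]
    have ht0 : 0 < t := ht0
    positivity

/-- At a vertex which is not convex some point is seen from both edges. -/
lemma exists_sees_of_reflex (ho : Oriented σ z) {i : Fin n} (hi : turn σ z i ≤ 0) :
    ∃ j, ∃ q ∈ openEdge z j, (∃ p ∈ openEdge z i, Sees z p q) ∧
      ∃ p ∈ openEdge z (finRotate n i), Sees z p q := by
  have hpos := normSq_edge_pos ho.toSimpleVertices i
  have hσ := ho.orientation_ne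
  -- The direction has to point to the inner side of both edges. At a strictly reflex vertex the
  -- incoming edge vector minus the outgoing one does so; at a flat vertex the inward normal does.
  obtain ⟨θ, h1, h2⟩ : ∃ θ, 0 < σ * cross (z (finRotate n i) - z i) θ ∧
      0 < σ * cross (z (finRotate n (finRotate n i)) - z (finRotate n i)) θ := by
    rcases hi.lt_or_eq with hlt | heq
    · refine ⟨(z (finRotate n i) - z i) - (z (finRotate n (finRotate n i)) - z (finRotate n i)),
        ?_, ?_⟩
      · rw [sub_eq_add_neg _ (z (finRotate n (finRotate n i)) - z (finRotate n i)),
          cross_add_right]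
        simp only [turn] at hlt
        simp only [cross, sub_re, sub_im, neg_re, neg_im] at *
        nlinarith
      · simp only [turn] at hlt
        simp only [cross, sub_re, sub_im] at *
        nlinarith
    · have hfl := ho.mem_openSegment_of_cross_eq_zero i (by
        rcases mul_eq_zero.1 heq with h | h
        · exact (hσ h).elim
        · exact h)
      obtain ⟨k, hk, hk'⟩ := exists_pos_of_mem_openSegment hfl
      have : σ * cross (z (finRotate n i) - z i) (σ * (I * (z (finRotate n i) - z i))) =
          σ ^ 2 * (((z (finRotate n i)).re - (z i).re) ^ 2 +
          ((z (finRotate n i)).im - (z i).im) ^ 2) := by simp [cross]; ring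
      have h3 : 0 < σ * cross (z (finRotate n i) - z i)
          (σ * (I * (z (finRotate n i) - z i))) := by rw [this]; positivity
      refine ⟨_, h3, ?_⟩
      rw [hk', cross_smul_left]
      have := mul_pos hk h3
      linarith
  have hθ : θ ≠ 0 := by rintro rfl; simp [cross] at h1
  have hcr : cross θ (I * θ) ≠ 0 := by
    have := normSq_pos.2 hθ
    rw [normSq_apply] at this
    have h3 : cross θ (I * θ) = θ.re * θ.re + θ.im * θ.im := by simp [cross]
    rw [h3]; exact this.ne'
  have hev : ∀ e : ℂ, 0 < σ * cross e θ →
      ∀ᶠ s : ℝ in 𝓝[>] 0, 0 < σ * cross e (θ + s * (I * θ)) := by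
    intro e he
    have hc : Continuous fun w : ℂ => σ * cross e w :=
      continuous_const.mul (continuous_cross continuous_const continuous_id)
    exact (tendsto_ray θ (I * θ)).eventually
      ((hc.continuousAt (x := θ)).eventually (lt_mem_nhds he))
  have h := eventually_exists_sees (z := z) (x := z (finRotate n i)) hcr ?_
  · obtain ⟨s, ⟨j, T, hT, hq, hs⟩, k1, k2⟩ := (h.and ((hev _ h1).and (hev _ h2))).exists
    set q := z (finRotate n i) + T * (θ + s * (I * θ)) with hqd
    have hq1 : 0 < height σ z i q := by
      rw [hqd, height_add, height_right, zero_add, cross_smul_right]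
      have := mul_pos hT k1
      linarith
    have hq2 : 0 < height σ z (finRotate n i) q := by
      rw [hqd, height_add, height_left, zero_add, cross_smul_right]
      have := mul_pos hT k2
      linarith
    have hj : 0 < height σ z j (z (finRotate n i)) := ho.height_pos_of_sees hq hs.symm
    have hqj : height σ z j q = 0 := height_of_mem_openEdge hq
    have hqe := (ho.edge j q hq).mono fun y hy (k : 0 < height σ z j y)
      (_ : 0 < height σ z j y) => hy.1 k
    have hc : Tendsto (fun y : ℂ => (y, q)) (𝓝 (z (finRotate n i)))
        (𝓝 (z (finRotate n i), q)) := by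
      have : Continuous fun y : ℂ => (y, q) := by fun_prop
      exact this.tendsto _
    -- The target `q` is kept while the viewpoint moves from the vertex onto either edge. Positive
    -- height above one edge suffices for being inside at a reflex vertex, so each edge is handled
    -- with its own height alone.
    have s1 := hc.eventually (hs.eventually (isAffine_height i) (isAffine_height i)
      (isAffine_height j) (isAffine_height j)
      ((ho.reflex i hi).mono fun y hy k _ => hy.1 (Or.inl k)) hqe hq1 hq1 hj hj)
    have s2 := hc.eventually (hs.eventually (isAffine_height (finRotate n i))
      (isAffine_height (finRotate n i)) (isAffine_height j) (isAffine_height j)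
      ((ho.reflex i hi).mono fun y hy k _ => hy.1 (Or.inr k)) hqe hq2 hq2 hj hj)
    obtain ⟨p, hp, hp'⟩ := exists_mem_openEdge_right i s1
    obtain ⟨p₂, hp₂, hp₂'⟩ := exists_mem_openEdge_left (finRotate n i) s2
    have g1 := (height_of_mem_openEdge (σ := σ) hp).ge
    have g2 := (height_of_mem_openEdge (σ := σ) hp₂).ge
    exact ⟨j, q, hq, ⟨p, hp, hp' g1 g1 hqj.ge hqj.ge⟩, ⟨p₂, hp₂, hp₂' g2 g2 hqj.ge hqj.ge⟩⟩
  · filter_upwards [hev _ h1] with s hs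
    filter_upwards [(tendsto_ray (z (finRotate n i)) _).eventually (ho.reflex i hi),
      self_mem_nhdsWithin] with t ht ht0
    refine ht.1 (Or.inl ?_)
    rw [height_add, height_right, zero_add, cross_smul_right]
    have := mul_pos (show 0 < t from ht0) hs
    linarith

/-- The two edges at a convex vertex see each other. -/
lemma exists_sees_of_convex (ho : Oriented σ z) {i : Fin n} (hi : 0 < turn σ z i) :
    ∃ p ∈ openEdge z i, ∃ q ∈ openEdge z (finRotate n i), Sees z p q := by
  -- Within this ball the wedge above both edges is inside, and it contains the open segment between
  -- points of the two edges.
  obtain ⟨ε, hε, hball⟩ := Metric.eventually_nhds_iff_ball.1 (ho.convex i hi)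
  obtain ⟨p, hp, hpb⟩ := exists_mem_openEdge_right i
    (Metric.ball_mem_nhds (z (finRotate n i)) hε)
  obtain ⟨q, hq, hqb⟩ := exists_mem_openEdge_left (finRotate n i)
    (Metric.ball_mem_nhds (z (finRotate n i)) hε)
  have hp1 := height_of_mem_openEdge (σ := σ) hp
  have hq1 := height_of_mem_openEdge (σ := σ) hq
  have hp2 : 0 < height σ z (finRotate n i) p := by
    obtain ⟨s, h0, h1, rfl⟩ := mem_openSegment_iff_param.1 hp
    rw [height_line, height_prev, height_left, mul_zero, add_zero]
    exact mul_pos (by linarith) hi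
  have hq2 : 0 < height σ z i q := by
    obtain ⟨s, h0, h1, rfl⟩ := mem_openSegment_iff_param.1 hq
    rw [height_line, height_next, height_right, mul_zero, zero_add]
    exact mul_pos h0 hi
  refine ⟨p, hp, q, hq, ?_, fun s h0 h1 => ?_⟩
  · rintro rfl
    exact hp2.ne' hq1
  · have hb : p + s * (q - p) ∈ Metric.ball (z (finRotate n i)) ε := by
      refine (convex_ball _ _).openSegment_subset hpb hqb ?_
      exact mem_openSegment_iff_param.2 ⟨s, h0, h1, rfl⟩
    refine (hball _ hb).1 ?_ ?_
    · rw [height_line, hp1, mul_zero, zero_add]; exact mul_pos h0 hq2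
    · rw [height_line, hq1, mul_zero, add_zero]; exact mul_pos (by linarith) hp2

end Oriented

/-- The ray from `p` in direction `θ` hits the polygon first in the interior of the edge `j`. -/
def RayHits (z : Fin n → ℂ) (p θ : ℂ) (j : Fin n) : Prop :=
  ∃ T : ℝ, 0 < T ∧ p + T * θ ∈ openEdge z j ∧ Sees z p (p + T * θ)

lemma RayHits.unique (hz : SimpleVertices z) {p θ : ℂ} {j k : Fin n} (hj : RayHits z p θ j)
    (hk : RayHits z p θ k) : j = k := by
  obtain ⟨T, hT, hTj, hTs⟩ := hj
  obtain ⟨S, hS, hSk, hSs⟩ := hk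
  rcases lt_trichotomy T S with h | rfl | h
  · exact (notMem_inside_of_trace (openEdge_subset_trace hTj) (hSs.ray hT h)).elim
  · exact hz.eq_of_mem_openSegment hTj (openSegment_subset_segment _ _ _ hSk)
  · exact (notMem_inside_of_trace (openEdge_subset_trace hSk) (hTs.ray hS h)).elim

/-- The time at which the ray from `p` in direction `θ` meets the line through the edge `j`. -/
noncomputable def hitTime (σ : ℝ) (z : Fin n → ℂ) (j : Fin n) (p θ : ℂ) : ℝ :=
  height σ z j p / (height σ z j p - height σ z j (p + θ))

section HitTime

variable {j : Fin n} {p θ₀ : ℂ} {T : ℝ}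

lemma hitTime_denom (h0 : height σ z j (p + T * θ₀) = 0) :
    height σ z j p = T * (height σ z j p - height σ z j (p + θ₀)) := by
  rw [height_ray] at h0
  linarith

lemma tendsto_hitTime (hp : height σ z j p ≠ 0) (h0 : height σ z j (p + T * θ₀) = 0) :
    Tendsto (hitTime σ z j p) (𝓝 θ₀) (𝓝 T) := by
  have h1 := hitTime_denom h0
  have h2 : height σ z j p - height σ z j (p + θ₀) ≠ 0 := by
    intro h; rw [h, mul_zero] at h1; exact hp h1
  have h3 : hitTime σ z j p θ₀ = T := by
    rw [hitTime, div_eq_iff h2]; exact h1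
  have hc : ContinuousAt (hitTime σ z j p) θ₀ := by
    have h4 := continuous_height (σ := σ) (z := z) j
    unfold hitTime
    exact ContinuousAt.div (by fun_prop) (by fun_prop) h2
  rw [← h3]
  exact hc

lemma eventually_hitTime (hp : height σ z j p ≠ 0) (h0 : height σ z j (p + T * θ₀) = 0) :
    ∀ᶠ θ in 𝓝 θ₀, height σ z j (p + hitTime σ z j p θ * θ) = 0 := by
  have h1 := hitTime_denom h0
  have h2 : height σ z j p - height σ z j (p + θ₀) ≠ 0 := by
    intro h; rw [h, mul_zero] at h1; exact hp h1
  have h4 := continuous_height (σ := σ) (z := z) j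
  have hc : ContinuousAt (fun θ => height σ z j p - height σ z j (p + θ)) θ₀ := by fun_prop
  filter_upwards [hc.eventually_ne h2] with θ hθ
  rw [height_ray, hitTime]
  field_simp
  ring

lemma tendsto_hitPoint (hp : height σ z j p ≠ 0) (h0 : height σ z j (p + T * θ₀) = 0) :
    Tendsto (fun θ => p + hitTime σ z j p θ * θ) (𝓝 θ₀) (𝓝 (p + T * θ₀)) := by
  have h1 := (tendsto_hitTime hp h0).ofReal
  exact tendsto_const_nhds.add (h1.mul tendsto_id)

end HitTime

end PolygonVisibility

/-! ### How the edge hit by a ray changes as the ray turns. -/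

namespace PolygonVisibility

open Complex Filter Topology

variable {n : ℕ} {z : Fin n → ℂ} {σ : ℝ}

/-- Two edges coincide, share a vertex, or a vertex of one of them which is not convex sees an
interior point of the other. -/
def Linked (σ : ℝ) (z : Fin n → ℂ) (k l : Fin n) : Prop :=
  k = l ∨ l = finRotate n k ∨ k = finRotate n l ∨
    (∃ a, turn σ z a ≤ 0 ∧ (k = a ∨ k = finRotate n a) ∧
      ∃ q ∈ openEdge z l, Sees z (z (finRotate n a)) q) ∨
    (∃ a, turn σ z a ≤ 0 ∧ (l = a ∨ l = finRotate n a) ∧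
      ∃ q ∈ openEdge z k, Sees z (z (finRotate n a)) q)

lemma Linked.symm {k l : Fin n} (h : Linked σ z k l) : Linked σ z l k := by
  rcases h with h | h | h | h | h
  · exact Or.inl h.symm
  · exact Or.inr (Or.inr (Or.inl h))
  · exact Or.inr (Or.inl h)
  · exact Or.inr (Or.inr (Or.inr (Or.inr h)))
  · exact Or.inr (Or.inr (Or.inr (Or.inl h)))

/-- A point of an edge which is not on a line through two vertices, unless this line contains
the edge. -/
def Generic (σ : ℝ) (z : Fin n → ℂ) (i : Fin n) (p : ℂ) : Prop :=
  ∀ k l, k ≠ l → height σ z i (z k) ≠ 0 → cross (z k - p) (z l - p) ≠ 0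

/-- The intersection with the line of the edge `j` moves continuously with the direction. The
condition `C` selects the directions for which it falls on the edge itself: all of them if `v` is an
interior point, one side if `v` is an endpoint. -/
lemma rayHits_of_edge {j : Fin n} {p v θ₀ : ℂ} {T : ℝ} (hT : 0 < T)
    (hp : height σ z j p ≠ 0) (h0 : height σ z j v = 0) (hv : p + T * θ₀ = v)
    (hgood : ∀ᶠ y in 𝓝 v, y ∈ openEdge z j → Sees z p y) {C : ℂ → Prop}
    (hmem : ∀ᶠ θ in 𝓝 θ₀, height σ z j (p + hitTime σ z j p θ * θ) = 0 →
      0 < hitTime σ z j p θ → C θ → p + hitTime σ z j p θ * θ ∈ openEdge z j) :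
    ∀ᶠ θ in 𝓝 θ₀, C θ → RayHits z p θ j := by
  subst hv
  filter_upwards [hmem, (tendsto_hitPoint hp h0).eventually hgood, eventually_hitTime hp h0,
    (tendsto_hitTime hp h0).eventually (lt_mem_nhds hT)] with θ h1 h2 h3 h4 hC
  exact ⟨_, h4, h1 h3 h4 hC, h2 (h1 h3 h4 hC)⟩

lemma eventually_fst_snd {p v : ℂ} {C : ℂ × ℂ → Prop} (h : ∀ᶠ w in 𝓝 (p, v), C w) :
    ∀ᶠ y in 𝓝 v, C (p, y) := by
  have hc : Continuous fun y : ℂ => (p, y) := by fun_prop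
  exact (hc.tendsto v).eventually h

namespace Oriented

/-- If a ray hits the interior of an edge first, then so do nearby rays. -/
lemma rayHits_eventually (ho : Oriented σ z) {i j : Fin n} {p θ₀ : ℂ} (hp : p ∈ openEdge z i)
    (h : RayHits z p θ₀ j) : ∀ᶠ θ in 𝓝 θ₀, RayHits z p θ j := by
  obtain ⟨T, hT, hq, hs⟩ := h
  have hi := ho.height_pos_of_sees hp hs
  have hj := ho.height_pos_of_sees hq hs.symm
  have h0 := height_of_mem_openEdge (σ := σ) hq
  have hgood := eventually_fst_snd (hs.eventually (isAffine_height i) (isAffine_height i)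
    (isAffine_height j) (isAffine_height j)
    ((ho.edge i p hp).mono fun y hy (k : 0 < height σ z i y) _ => hy.1 k)
    ((ho.edge j _ hq).mono fun y hy (k : 0 < height σ z j y) _ => hy.1 k) hi hi hj hj)
  have hpi := (height_of_mem_openEdge (σ := σ) hp).ge
  have := rayHits_of_edge (C := fun _ => True) hT hj.ne' h0 rfl
    (hgood.mono fun y hy hm => hy hpi hpi (height_of_mem_openEdge hm).ge
      (height_of_mem_openEdge hm).ge) ?_
  · exact this.mono fun θ hθ => hθ trivial
  · filter_upwards [(tendsto_hitPoint hj.ne' h0).eventually (ho.eventually_mem_openEdge hq)]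
      with θ hθ h1 _ _
    exact hθ h1

lemma cross_ray_sub (θ₀ θ p : ℂ) (t : ℝ) : cross θ₀ (p + t * θ - p) = t * cross θ₀ θ := by
  rw [add_sub_cancel_left, cross_smul_right]

/-- Near a reflex vertex with both edges on one side of a line, the points on the other side
are inside. -/
lemma inside_of_other_side (ho : Oriented σ z) {a : Fin n} {θ₀ : ℂ} (ha : turn σ z a ≤ 0)
    (hL : 0 < cross θ₀ (z a - z (finRotate n a)) *
      cross θ₀ (z (finRotate n (finRotate n a)) - z (finRotate n a))) :
    ∀ᶠ y in 𝓝 (z (finRotate n a)),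
      cross θ₀ (y - z (finRotate n a)) * cross θ₀ (z a - z (finRotate n a)) < 0 →
        y ∈ Inside z := by
  filter_upwards [ho.reflex a ha] with y hy hside
  apply hy.1
  by_contra! hn
  obtain ⟨h1, h2⟩ := hn
  rcases ha.lt_or_eq with hlt | heq
  · set b := z (finRotate n a)
    set c := z (finRotate n (finRotate n a))
    have e1 : height σ z a y = -(σ * cross (z a - b) (y - b)) := by
      simp only [height, cross, sub_re, sub_im, b]; ring
    have e2 : height σ z (finRotate n a) y = σ * cross (c - b) (y - b) := rfl
    have e3 : turn σ z a = -(σ * cross (z a - b) (c - b)) := by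
      simp only [turn, cross, sub_re, sub_im, b, c]; ring
    -- This is the linear relation between three plane vectors. If both heights were nonpositive, `y
    -- - b` would be a nonnegative combination of the two edge directions at `b`, hence not on the
    -- other side of the line from them.
    have key : cross θ₀ (y - b) * (σ * cross (z a - b) (c - b)) =
        -(σ * cross (c - b) (y - b)) * cross θ₀ (z a - b) +
          (σ * cross (z a - b) (y - b)) * cross θ₀ (c - b) := by
      simp only [cross, sub_re, sub_im]; ring
    rw [e1] at h1
    rw [e2] at h2
    rw [e3] at hlt
    have k1 := mul_neg_of_neg_of_pos hside (show 0 < σ * cross (z a - b) (c - b) by linarith)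
    have k2 := mul_nonneg (show 0 ≤ -(σ * cross (c - b) (y - b)) by linarith)
      (mul_self_nonneg (cross θ₀ (z a - b)))
    have k3 := mul_nonneg (show 0 ≤ σ * cross (z a - b) (y - b) by linarith) hL.le
    have k4 : cross θ₀ (y - b) * cross θ₀ (z a - b) * (σ * cross (z a - b) (c - b)) =
        -(σ * cross (c - b) (y - b)) * (cross θ₀ (z a - b) * cross θ₀ (z a - b)) +
          σ * cross (z a - b) (y - b) * (cross θ₀ (z a - b) * cross θ₀ (c - b)) := by
      linear_combination cross θ₀ (z a - b) * key
    linarith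
  · have hfl := ho.mem_openSegment_of_cross_eq_zero a (by
      rcases mul_eq_zero.1 heq with h | h
      · exact (ho.orientation_ne h).elim
      · exact h)
    obtain ⟨k, hk, hk'⟩ := exists_pos_of_mem_openSegment hfl
    rw [hk', cross_smul_right] at hL
    have : cross θ₀ (z (finRotate n a) - z a) = -cross θ₀ (z a - z (finRotate n a)) := by
      simp [cross]; ring
    rw [this] at hL
    nlinarith [mul_nonneg hk.le (mul_self_nonneg (cross θ₀ (z a - z (finRotate n a))))]

/-- Rays that pass a reflex vertex closely, on the side off its edges, hit the edge behind it. -/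
lemma rayHits_behind (ho : Oriented σ z) {i j a : Fin n} {p θ₀ : ℂ} {T S : ℝ}
    (hp : p ∈ openEdge z i) (hi : 0 < height σ z i (p + θ₀)) (hT : 0 < T)
    (hv : p + T * θ₀ = z (finRotate n a))
    (hsees : ∀ t : ℝ, 0 < t → t < T → p + t * θ₀ ∈ Inside z) (ha : turn σ z a ≤ 0)
    (hL : 0 < cross θ₀ (z a - z (finRotate n a)) *
      cross θ₀ (z (finRotate n (finRotate n a)) - z (finRotate n a)))
    (hS : 0 < S) (hq : z (finRotate n a) + S * θ₀ ∈ openEdge z j)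
    (hqs : Sees z (z (finRotate n a)) (z (finRotate n a) + S * θ₀)) :
    ∀ᶠ θ in 𝓝 θ₀, cross θ₀ θ * cross θ₀ (z a - z (finRotate n a)) < 0 →
      RayHits z p θ j := by
  have hθ₀ : θ₀ ≠ 0 := by rintro rfl; simp [cross] at hL
  have hq' : p + (T + S : ℝ) * θ₀ = z (finRotate n a) + S * θ₀ := by
    rw [← hv]; push_cast; ring
  have hjv := ho.height_pos_of_sees hq hqs.symm
  have hjq : height σ z j (p + (T + S : ℝ) * θ₀) = 0 := by
    rw [hq']; exact height_of_mem_openEdge hq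
  -- The height above the edge `j` is affine along the ray, zero at the far end and positive at the
  -- vertex, so it is positive at `p`.
  have hjp : 0 < height σ z j p := by
    have h1 := hjq
    have h2 := hjv
    rw [height_ray] at h1
    rw [← hv, height_ray] at h2
    have h3 : (T + S) * ((1 - T) * height σ z j p + T * height σ z j (p + θ₀)) =
        S * height σ z j p := by linear_combination T * h1
    have h4 := mul_pos (add_pos hT hS) h2
    rw [h3] at h4
    exact pos_of_mul_pos_right h4 hS.le
  have hpi := height_of_mem_openEdge (σ := σ) hp
  have hTS : 0 < T + S := by linarith
  set τ := hitTime σ z j p with hτ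
  have htime := tendsto_hitTime hjp.ne' hjq
  have hkey : ∀ᶠ θ in 𝓝 θ₀, ∀ s ∈ Set.Icc (0 : ℝ) 1, 0 < s → s < 1 → 0 < τ θ →
      height σ z j (p + τ θ * θ) = 0 →
      cross θ₀ θ * cross θ₀ (z a - z (finRotate n a)) < 0 →
        p + (s * τ θ : ℝ) * θ ∈ Inside z := by
    refine isCompact_Icc.eventually_forall_of_forall_eventually fun s hs => ?_
    have hfst : Tendsto (fun v : ℂ × ℝ => v.1) (𝓝 (θ₀, s)) (𝓝 θ₀) := continuous_fst.tendsto _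
    have hsnd : Tendsto (fun v : ℂ × ℝ => v.2) (𝓝 (θ₀, s)) (𝓝 s) := continuous_snd.tendsto _
    have ht : Tendsto (fun v : ℂ × ℝ => p + (v.2 * τ v.1 : ℝ) * v.1) (𝓝 (θ₀, s))
        (𝓝 (p + (s * (T + S) : ℝ) * θ₀)) :=
      tendsto_const_nhds.add ((hsnd.mul (htime.comp hfst)).ofReal.mul hfst)
    rcases hs.1.eq_or_lt with rfl | h0
    · simp only [zero_mul, ofReal_zero, add_zero] at ht
      have hc : Continuous fun θ : ℂ => height σ z i (p + θ) :=
        (continuous_height i).comp (continuous_const.add continuous_id)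
      filter_upwards [ht.eventually (ho.edge i p hp),
        hfst.eventually (hc.continuousAt.eventually (lt_mem_nhds hi))] with v h1 h2 k0 k1 k2 k3 k4
      refine h1.1 ?_
      rw [height_ray, hpi, mul_zero, zero_add]
      positivity
    rcases hs.2.eq_or_lt with rfl | h1
    · rw [one_mul, hq'] at ht
      filter_upwards [ht.eventually (ho.edge j _ hq)] with v h1 k0 k1 k2 k3 k4
      refine h1.1 ?_
      have : height σ z j (p + (v.2 * τ v.1 : ℝ) * v.1) =
          (1 - v.2) * height σ z j p + v.2 * height σ z j (p + τ v.1 * v.1) := by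
        rw [← height_line]
        congr 1
        push_cast; ring
      rw [this, k3, mul_zero, add_zero]
      exact mul_pos (by linarith) hjp
    · have h0' : 0 < s * (T + S) := by positivity
      have h1' : s * (T + S) < T + S := by nlinarith
      -- Before and beyond the vertex the limiting point is inside, and openness suffices. Only at
      -- the vertex is it used that the ray passes on the side away from the edges.
      rcases lt_trichotomy (s * (T + S)) T with h2 | h2 | h2
      · filter_upwards [ht.eventually ((isOpen_inside z).mem_nhds (hsees _ h0' h2))]
          with v hv _ _ _ _ _
        exact hv
      · rw [h2, hv] at ht
        filter_upwards [ht.eventually (ho.inside_of_other_side ha hL)] with v h1 k0 k1 k2 k3 k4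
        refine h1 ?_
        have h5 : cross θ₀ (p + (v.2 * τ v.1 : ℝ) * v.1 - z (finRotate n a)) =
            v.2 * τ v.1 * cross θ₀ v.1 := by
          rw [← hv]
          have : p + (v.2 * τ v.1 : ℝ) * v.1 - (p + T * θ₀) =
              (v.2 * τ v.1 : ℝ) * v.1 + ((-T : ℝ) : ℂ) * θ₀ := by push_cast; ring
          rw [this, cross_add_right, cross_smul_right, cross_smul_right]
          simp [cross, mul_comm]
        rw [h5, mul_assoc]
        exact mul_neg_of_pos_of_neg (mul_pos k0 k2) k4
      · have h3 := hqs.ray (t := s * (T + S) - T) (by linarith) (by linarith)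
        rw [← hv] at h3
        have h4 : p + (T : ℂ) * θ₀ + ((s * (T + S) - T : ℝ) : ℂ) * θ₀ =
            p + (s * (T + S) : ℝ) * θ₀ := by push_cast; ring
        rw [h4] at h3
        filter_upwards [ht.eventually ((isOpen_inside z).mem_nhds h3)] with v hv _ _ _ _ _
        exact hv
  have hpt := tendsto_hitPoint hjp.ne' hjq
  rw [hq'] at hpt
  filter_upwards [hkey, eventually_hitTime hjp.ne' hjq,
    hpt.eventually (ho.eventually_mem_openEdge hq),
    htime.eventually (lt_mem_nhds hTS)] with θ h1 h2 h3 h4 hC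
  have hmem := h3 h2
  refine ⟨_, h4, hmem, ?_, fun s s0 s1 => ?_⟩
  · intro h
    rw [← h] at h2
    exact hjp.ne' h2
  · have := h1 s ⟨s0.le, s1.le⟩ s0 s1 h4 h2 hC
    convert this using 1
    push_cast; ring

/-- The sign of `L` tells which of the two sides is which; `Linked` is symmetric, so this sign can
be forgotten. -/
lemma exists_sides {k l : Fin n} {p θ₀ : ℂ} {L : ℝ} (hL : L ≠ 0)
    (hk : ∀ᶠ θ in 𝓝 θ₀, 0 < cross θ₀ θ * L → RayHits z p θ k)
    (hl : ∀ᶠ θ in 𝓝 θ₀, cross θ₀ θ * L < 0 → RayHits z p θ l) (hkl : Linked σ z k l) :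
    ∃ k l, Linked σ z k l ∧ ∀ᶠ θ in 𝓝 θ₀,
      (0 < cross θ₀ θ → RayHits z p θ k) ∧ (cross θ₀ θ < 0 → RayHits z p θ l) := by
  rcases lt_or_gt_of_ne hL with h | h
  · refine ⟨l, k, hkl.symm, ?_⟩
    filter_upwards [hk, hl] with θ h1 h2
    exact ⟨fun h' => h2 (mul_neg_of_pos_of_neg h' h), fun h' => h1 (mul_pos_of_neg_of_neg h' h)⟩
  · refine ⟨k, l, hkl, ?_⟩
    filter_upwards [hk, hl] with θ h1 h2
    exact ⟨fun h' => h1 (mul_pos h' h), fun h' => h2 (mul_neg_of_neg_of_pos h' h)⟩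

/-- The edges hit by the rays on both sides of a given ray are linked. -/
theorem exists_linked (ho : Oriented σ z) {i : Fin n} {p θ₀ : ℂ} (hp : p ∈ openEdge z i)
    (hgen : Generic σ z i p) (hi : 0 < height σ z i (p + θ₀)) :
    ∃ k l, Linked σ z k l ∧ ∀ᶠ θ in 𝓝 θ₀,
      (0 < cross θ₀ θ → RayHits z p θ k) ∧ (cross θ₀ θ < 0 → RayHits z p θ l) := by
  have hpi := height_of_mem_openEdge (σ := σ) hp
  have hθ₀ : θ₀ ≠ 0 := by
    rintro rfl
    rw [add_zero, hpi] at hi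
    exact lt_irrefl _ hi
  have hin : ∀ᶠ t : ℝ in 𝓝[>] 0, p + t * θ₀ ∈ Inside z := by
    filter_upwards [(tendsto_ray p θ₀).eventually (ho.edge i p hp), self_mem_nhdsWithin]
      with t ht ht0
    refine ht.1 ?_
    rw [height_ray, hpi, mul_zero, zero_add]
    exact mul_pos ht0 hi
  obtain ⟨T, hT, htr, hray⟩ := exists_hit hθ₀ hin
  have hsees := sees_of_ray hT hθ₀ hray
  by_cases hvert : ∀ k, z k ≠ p + T * θ₀
  · obtain ⟨j, hj⟩ := mem_openEdge_of_trace htr hvert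
    refine ⟨j, j, Or.inl rfl, ?_⟩
    filter_upwards [ho.rayHits_eventually hp ⟨T, hT, hj, hsees⟩] with θ hθ
    exact ⟨fun _ => hθ, fun _ => hθ⟩
  push Not at hvert
  obtain ⟨k, hk⟩ := hvert
  obtain ⟨a, rfl⟩ := (finRotate n).surjective k
  set b := z (finRotate n a) with hb
  set c := z (finRotate n (finRotate n a)) with hc
  have hib : height σ z i b ≠ 0 := by
    rw [hk, height_ray, hpi, mul_zero, zero_add]
    exact (mul_pos hT hi).ne'
  have hbp : b - p = T * θ₀ := by rw [hk]; ring
  -- The ray already passes through `b`, so by genericity no other vertex lies on its line. This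
  -- makes all later signs strict and prevents a second vertex from being hit behind `b`.
  have hgen' : ∀ l, l ≠ finRotate n a → cross θ₀ (z l - b) ≠ 0 := by
    intro l hl h0
    apply hgen _ l hl.symm hib
    rw [← hb, hbp, cross_smul_left]
    have : z l - p = (z l - b) + T * θ₀ := by rw [← hbp]; ring
    rw [this, cross_add_right, h0, cross_smul_right]
    simp [cross, mul_comm]
  have hLa := hgen' a (ho.rotate_ne a).symm
  have hLc := hgen' _ (ho.rotate_ne (finRotate n a))
  rw [← hc] at hLc
  have hap : height σ z a p = -(T * σ * cross θ₀ (z a - b)) := by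
    have : p = b - T * θ₀ := by rw [← hbp]; ring
    rw [this]
    simp [height, cross, hb]
    ring
  have hcp : height σ z (finRotate n a) p = T * σ * cross θ₀ (c - b) := by
    have : p = b - T * θ₀ := by rw [← hbp]; ring
    rw [this]
    simp only [height, cross, ← hb, ← hc]
    simp
    ring
  have hTσ : T * σ ≠ 0 := mul_ne_zero hT.ne' ho.orientation_ne
  have hap0 : height σ z a p ≠ 0 := by rw [hap]; exact neg_ne_zero.2 (mul_ne_zero hTσ hLa)
  have hcp0 : height σ z (finRotate n a) p ≠ 0 := by rw [hcp]; exact mul_ne_zero hTσ hLc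
  rw [← hk] at hsees
  have hib0 : 0 < height σ z i b := ho.height_pos_of_sees hp hsees
  have hpedge := (ho.edge i p hp).mono fun y hy (k : 0 < height σ z i y)
    (_ : 0 < height σ z i y) => hy.1 k
  -- An edge ending at `b` is hit by nearby rays on the side of its other end `v`, provided that its
  -- points near `b` are visible from `p`.
  have hhit : ∀ (e : Fin n) (v : ℂ), height σ z e p ≠ 0 → height σ z e b = 0 → b ≠ v →
      (openEdge z e = openSegment ℝ v b) →
      (∀ y, height σ z e y = 0 → cross (b - v) (y - v) = 0) →
      (∀ᶠ y in 𝓝 b, y ∈ openEdge z e → Sees z p y) →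
      ∀ᶠ θ in 𝓝 θ₀, 0 < cross θ₀ θ * cross θ₀ (v - b) → RayHits z p θ e := by
    intro e v h1 h2 h3 h4 h5 h6
    refine rayHits_of_edge hT h1 h2 hk.symm h6 ?_
    have h7 : cross θ₀ (b - p) = 0 := by
      rw [hbp, cross_smul_right]; simp [cross, mul_comm]
    have h8 := tendsto_hitPoint (θ₀ := θ₀) (T := T) h1 (by rw [← hk]; exact h2)
    rw [← hk] at h8
    filter_upwards [h8.eventually (eventually_mem_openSegment_endpoint h3.symm h7)]
      with θ hθ k1 k2 k3
    rw [h4]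
    refine hθ (h5 _ k1) ?_
    have h9 : cross θ₀ (v - p) = cross θ₀ (v - b) := by
      have : v - p = (v - b) + (b - p) := by ring
      rw [this, cross_add_right, h7, add_zero]
    rw [cross_ray_sub, h9, mul_assoc]
    exact mul_pos k2 k3
  have hhitA : (∀ᶠ y in 𝓝 b, y ∈ openEdge z a → Sees z p y) →
      ∀ᶠ θ in 𝓝 θ₀, 0 < cross θ₀ θ * cross θ₀ (z a - b) → RayHits z p θ a :=
    hhit a (z a) hap0 (height_right a) (ho.ne a).symm rfl fun y hy => ho.height_eq_zero_iff.1 hy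
  have hhitC : (∀ᶠ y in 𝓝 b, y ∈ openEdge z (finRotate n a) → Sees z p y) →
      ∀ᶠ θ in 𝓝 θ₀, 0 < cross θ₀ θ * cross θ₀ (c - b) → RayHits z p θ (finRotate n a) := by
    refine hhit _ c hcp0 (height_left _) (ho.ne _) (openSegment_symm _ _ _) fun y hy => ?_
    have h1 := ho.height_eq_zero_iff.1 hy
    rw [← hb, ← hc] at h1
    have : cross (b - c) (y - c) = -cross (c - b) (y - b) := by
      simp only [cross, sub_re, sub_im]; ring
    rw [this, h1, neg_zero]
  -- If `p` is above both edges at `b`, they leave `b` on opposite sides of the ray. Each side then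
  -- has its own edge, and the two edges share the vertex `b`.
  have hopp : 0 < height σ z a p → 0 < height σ z (finRotate n a) p →
      cross θ₀ (z a - b) * cross θ₀ (c - b) < 0 := by
    intro h1 h2
    rw [hap] at h1
    rw [hcp] at h2
    have h3 := mul_pos h1 h2
    have h4 : 0 < (T * σ) ^ 2 := by positivity
    by_contra! hn
    nlinarith [mul_nonneg h4.le hn]
  have hcross : 0 < height σ z a p → 0 < height σ z (finRotate n a) p →
      (∀ᶠ y in 𝓝 b, y ∈ openEdge z a → Sees z p y) →
      (∀ᶠ y in 𝓝 b, y ∈ openEdge z (finRotate n a) → Sees z p y) →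
      ∃ k l, Linked σ z k l ∧ ∀ᶠ θ in 𝓝 θ₀,
        (0 < cross θ₀ θ → RayHits z p θ k) ∧ (cross θ₀ θ < 0 → RayHits z p θ l) := by
    intro h1 h2 h3 h4
    refine exists_sides hLa (hhitA h3) ?_ (Or.inr (Or.inl rfl))
    filter_upwards [hhitC h4] with θ hθ h5
    apply hθ
    have h6 := mul_pos_of_neg_of_neg h5 (hopp h1 h2)
    have h7 : 0 < cross θ₀ (z a - b) ^ 2 := by positivity
    by_contra! hn
    nlinarith [mul_nonneg h7.le (neg_nonneg.2 hn)]
  have hcone : ∀ (e : Fin n), (∀ᶠ y in 𝓝 b, 0 < height σ z e y → y ∈ Inside z) →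
      0 < height σ z e p → ∀ᶠ y in 𝓝 b, y ∈ openEdge z e → Sees z p y := by
    intro e h1 h2
    filter_upwards [eventually_fst_snd (hsees.eventually (isAffine_height i) (isAffine_height i)
      (isAffine_height e) (isAffine_height e) hpedge (h1.mono fun y hy k _ => hy k)
      hib0 hib0 h2 h2)] with y hy hm
    exact hy hpi.ge hpi.ge (height_of_mem_openEdge hm).ge (height_of_mem_openEdge hm).ge
  have hback : Tendsto (fun t : ℝ => b + t * (p - b)) (𝓝[>] 0) (𝓝 b) := tendsto_ray _ _
  have hback_in : ∀ᶠ t : ℝ in 𝓝[>] 0, b + t * (p - b) ∈ Inside z := by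
    filter_upwards [Ioo_mem_nhdsGT one_pos] with t ht
    exact hsees.symm.2 t ht.1 ht.2
  have hheight_back : ∀ (e : Fin n) (t : ℝ), height σ z e b = 0 →
      height σ z e (b + t * (p - b)) = t * height σ z e p := by
    intro e t he
    rw [height_line, he, mul_zero, zero_add]
  rcases lt_or_ge 0 (turn σ z a) with hturn | hturn
  · have hconv := ho.convex a hturn
    -- The points of the ray just before a convex vertex are inside, so they cannot lie below either
    -- edge.
    obtain ⟨t, ⟨h1, h2⟩, h3⟩ :=
      ((hback.eventually hconv).and hback_in |>.and self_mem_nhdsWithin).exists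
    have h3 : 0 < t := h3
    rw [hheight_back a t (height_right a), hheight_back _ t (height_left _)] at h1
    have hnn : ¬ (t * height σ z a p < 0 ∨ t * height σ z (finRotate n a) p < 0) := fun h =>
      disjoint_inside_outside h2 (h1.2 h)
    push Not at hnn
    have hap1 : 0 < height σ z a p :=
      lt_of_le_of_ne (nonneg_of_mul_nonneg_right hnn.1 h3) hap0.symm
    have hcp1 : 0 < height σ z (finRotate n a) p :=
      lt_of_le_of_ne (nonneg_of_mul_nonneg_right hnn.2 h3) hcp0.symm
    have hev := eventually_fst_snd (hsees.eventually (isAffine_height i) (isAffine_height i)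
      (isAffine_height a) (isAffine_height (finRotate n a)) hpedge
      (hconv.mono fun y hy => hy.1) hib0 hib0 hap1 hcp1)
    refine hcross hap1 hcp1 ?_ ?_
    · filter_upwards [hev] with y hy hm
      refine hy hpi.ge hpi.ge (height_of_mem_openEdge hm).ge ?_
      obtain ⟨s, s0, s1, rfl⟩ := mem_openSegment_iff_param.1 hm
      rw [height_line, height_prev, height_left, mul_zero, add_zero]
      exact mul_nonneg (by linarith) hturn.le
    · filter_upwards [hev] with y hy hm
      refine hy hpi.ge hpi.ge ?_ (height_of_mem_openEdge hm).ge
      obtain ⟨s, s0, s1, rfl⟩ := mem_openSegment_iff_param.1 hm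
      rw [height_line, height_next, height_right, mul_zero, zero_add]
      exact mul_nonneg s0.le hturn.le
  · have hrefl := ho.reflex a hturn
    have hconeA := hcone a (hrefl.mono fun y hy h => hy.1 (Or.inl h))
    have hconeC := hcone (finRotate n a) (hrefl.mono fun y hy h => hy.1 (Or.inr h))
    by_cases hboth : 0 < height σ z a p ∧ 0 < height σ z (finRotate n a) p
    · exact hcross hboth.1 hboth.2 (hconeA hboth.1) (hconeC hboth.2)
    have hnot : ¬ (height σ z a p < 0 ∧ height σ z (finRotate n a) p < 0) := by
      rintro ⟨g1, g2⟩
      obtain ⟨t, ⟨h1, h2⟩, h3⟩ :=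
        ((hback.eventually hrefl).and hback_in |>.and self_mem_nhdsWithin).exists
      have h3 : 0 < t := h3
      rw [hheight_back a t (height_right a), hheight_back _ t (height_left _)] at h1
      exact disjoint_inside_outside h2
        (h1.2 (mul_neg_of_pos_of_neg h3 g1) (mul_neg_of_pos_of_neg h3 g2))
    -- In the remaining case `p` is above exactly one edge, both edges lie on the same side of the
    -- ray, and the ray touches the polygon at `b` without being stopped.
    have hmixed : height σ z a p * height σ z (finRotate n a) p < 0 := by
      rcases lt_or_gt_of_ne hap0 with g1 | g1 <;> rcases lt_or_gt_of_ne hcp0 with g2 | g2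
      · exact (hnot ⟨g1, g2⟩).elim
      · exact mul_neg_of_neg_of_pos g1 g2
      · exact mul_neg_of_pos_of_neg g1 g2
      · exact (hboth ⟨g1, g2⟩).elim
    have hL : 0 < cross θ₀ (z a - b) * cross θ₀ (c - b) := by
      rw [hap, hcp] at hmixed
      have h4 : 0 < (T * σ) ^ 2 := by positivity
      by_contra! hn
      nlinarith [mul_nonneg h4.le (neg_nonneg.2 hn)]
    -- the ray continues inside the polygon beyond the vertex
    have hcont : ∀ᶠ t : ℝ in 𝓝[>] 0, b + t * θ₀ ∈ Inside z := by
      filter_upwards [(tendsto_ray b θ₀).eventually hrefl, self_mem_nhdsWithin] with t ht ht0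
      have ht0 : 0 < t := ht0
      refine ht.1 ?_
      have hθT : (θ₀ : ℂ) = ((-1 / T : ℝ) : ℂ) * (p - b) := by
        have hT' : (T : ℂ) ≠ 0 := by exact_mod_cast hT.ne'
        push_cast
        field_simp
        linear_combination -hbp
      have hh : ∀ e : Fin n, height σ z e b = 0 →
          height σ z e (b + t * θ₀) = -(t / T) * height σ z e p := by
        intro e he
        have : b + t * θ₀ = b + ((-(t / T) : ℝ) : ℂ) * (p - b) := by
          rw [hθT]; push_cast; ring
        rw [this, hheight_back e _ he]
      rw [hh a (height_right a), hh _ (height_left _)]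
      have htT : 0 < t / T := by positivity
      rcases lt_or_gt_of_ne hap0 with g1 | g1
      · exact Or.inl (mul_pos_of_neg_of_neg (by linarith) g1)
      · right
        have g2 : height σ z (finRotate n a) p < 0 := by
          rcases lt_or_gt_of_ne hcp0 with g2 | g2
          · exact g2
          · exact (hboth ⟨g1, g2⟩).elim
        exact mul_pos_of_neg_of_neg (by linarith) g2
    obtain ⟨S, hS, htr', hray'⟩ := exists_hit hθ₀ hcont
    have hsees' := sees_of_ray hS hθ₀ hray'
    obtain ⟨j, hj⟩ := mem_openEdge_of_trace htr' fun l hl => by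
      have hla : l ≠ finRotate n a := by
        rintro rfl
        exact hsees'.1 hl
      apply hgen' l hla
      rw [hl, add_sub_cancel_left, cross_smul_right]
      simp [cross, mul_comm]
    -- On the free side nearby rays reach the edge `j` behind `b`. On the side of the edges they hit
    -- the one facing `p`, which is linked to `j` through the sight line from `b`.
    have hbeh := ho.rayHits_behind hp hi hT hk.symm hray hturn hL hS hj hsees'
    rcases lt_or_gt_of_ne hap0 with g1 | g1
    · have g2 : 0 < height σ z (finRotate n a) p := by
        rcases lt_or_gt_of_ne hcp0 with g2 | g2
        · exact (hnot ⟨g1, g2⟩).elim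
        · exact g2
      refine exists_sides (k := finRotate n a) (l := j) hLa ?_ hbeh
        (Or.inr (Or.inr (Or.inr (Or.inl ⟨a, hturn, Or.inr rfl, _, hj, hsees'⟩))))
      filter_upwards [hhitC (hconeC g2)] with θ hθ h5
      apply hθ
      have h6 := mul_pos h5 hL
      have h7 : 0 < cross θ₀ (z a - b) ^ 2 := by positivity
      by_contra! hn
      nlinarith [mul_nonneg h7.le (neg_nonneg.2 hn)]
    · exact exists_sides (k := a) (l := j) hLa (hhitA (hconeA g1)) hbeh
        (Or.inr (Or.inr (Or.inr (Or.inl ⟨a, hturn, Or.inl rfl, _, hj, hsees'⟩))))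

end Oriented

end PolygonVisibility

/-! ### Chords and the two cycles they cut off. -/

namespace PolygonVisibility

open Complex Filter Topology

variable {n : ℕ} {z : Fin n → ℂ} {σ : ℝ}

/-- The `k`-th vertex of a polygon, counted from the vertex `i`. -/
def vtx (z : Fin n → ℂ) (i : Fin n) (k : ℕ) : ℂ := z ((finRotate n)^[k] i)

lemma vtx_succ (i : Fin n) (k : ℕ) :
    vtx z i (k + 1) = z (finRotate n ((finRotate n)^[k] i)) := by
  rw [vtx, Function.iterate_succ_apply']

lemma vtx_period (i : Fin n) : vtx z i n = vtx z i 0 := by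
  rw [vtx, iterate_period]; rfl

lemma vtx_iterate (i : Fin n) (j k : ℕ) :
    vtx z ((finRotate n)^[j] i) k = vtx z i (k + j) := by
  rw [vtx, vtx, Function.iterate_add_apply]

lemma sum_iterate {M : Type*} [AddCommMonoid M] (f : Fin n → M) (i : Fin n) :
    ∑ j, f j = ∑ k ∈ Finset.range n, f ((finRotate n)^[k] i) := by
  symm
  refine Finset.sum_bij (fun k _ => (finRotate n)^[k] i) (fun _ _ => Finset.mem_univ _) ?_ ?_
    (fun _ _ => rfl)
  · intro a ha b hb h
    exact iterate_injOn (Finset.mem_range.1 ha) (Finset.mem_range.1 hb) h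
  · intro b _
    obtain ⟨k, hk, h⟩ := exists_iterate_eq i b
    exact ⟨k, Finset.mem_range.2 hk, h⟩

/-- Two edges, counted from the vertex `i`, that have a common point are neighbours. -/
lemma SimpleVertices.common_point (hz : SimpleVertices z) (i : Fin n) {k l : ℕ} (hk : k < n)
    (hl : l < n) (hkl : k ≠ l) {x : ℂ} (hx : x ∈ segment ℝ (vtx z i k) (vtx z i (k + 1)))
    (hx' : x ∈ segment ℝ (vtx z i l) (vtx z i (l + 1))) :
    (l = k + 1 ∧ x = vtx z i l) ∨ (k = l + 1 ∧ x = vtx z i k) ∨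
      (k = 0 ∧ l + 1 = n ∧ x = vtx z i 0) ∨ (l = 0 ∧ k + 1 = n ∧ x = vtx z i 0) := by
  rw [vtx_succ] at hx hx'
  have hne : (finRotate n)^[k] i ≠ (finRotate n)^[l] i := fun h => hkl (iterate_injOn hk hl h)
  rcases hz.eq_vertex_of_mem hne hx hx' with ⟨h1, h2⟩ | ⟨h1, h2⟩
  · rw [← Function.iterate_succ_apply' (finRotate n)] at h1
    rcases Nat.lt_or_ge (k + 1) n with h3 | h3
    · exact Or.inl ⟨iterate_injOn hl h3 h1, h2⟩
    · have h4 : k + 1 = n := by omega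
      rw [Nat.succ_eq_add_one, h4, iterate_period] at h1
      have h5 : l = 0 := iterate_injOn hl (by omega) h1
      subst h5
      exact Or.inr (Or.inr (Or.inr ⟨rfl, h4, h2⟩))
  · rw [← Function.iterate_succ_apply' (finRotate n)] at h1
    rcases Nat.lt_or_ge (l + 1) n with h3 | h3
    · exact Or.inr (Or.inl ⟨iterate_injOn hk h3 h1, h2⟩)
    · have h4 : l + 1 = n := by omega
      rw [Nat.succ_eq_add_one, h4, iterate_period] at h1
      have h5 : k = 0 := iterate_injOn hk (by omega) h1
      subst h5
      exact Or.inr (Or.inr (Or.inl ⟨rfl, h4, h2⟩))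

/-- A chord of a polygon, from an interior point of the edge `i` to an interior point of the
`j`-th edge after it. -/
structure IsChord (σ : ℝ) (z : Fin n → ℂ) (i : Fin n) (j : ℕ) (p q : ℂ) : Prop where
  oriented : Oriented σ z
  pos : 0 < j
  lt : j < n
  left : p ∈ openEdge z i
  right : q ∈ openEdge z ((finRotate n)^[j] i)
  sees : Sees z p q

/-- The part of the polygon from `p` to `q`. -/
def arc (z : Fin n → ℂ) (i : Fin n) (j : ℕ) (p q : ℂ) : Set ℂ :=
  {x | ∃ k ≤ j, x ∈ segment ℝ (vtx z i k) (vtx z i (k + 1)) ∧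
    (k = 0 → x ∈ segment ℝ p (vtx z i 1)) ∧ (k = j → x ∈ segment ℝ (vtx z i j) q)}

/-- The cycle formed by a chord and the part of the polygon from `p` to `q`. -/
def half (z : Fin n → ℂ) (i : Fin n) (j : ℕ) (p q : ℂ) : Multiset (ℂ × ℂ) :=
  (p, vtx z i 1) ::ₘ (vtx z i j, q) ::ₘ (q, p) ::ₘ
    ((Finset.Ico 1 j).val.map fun k => (vtx z i k, vtx z i (k + 1)))

namespace IsChord

variable {i : Fin n} {j : ℕ} {p q : ℂ}

lemma iterate_back (h : IsChord σ z i j p q) :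
    (finRotate n)^[n - j] ((finRotate n)^[j] i) = i := by
  rw [← Function.iterate_add_apply, Nat.sub_add_cancel h.lt.le, iterate_period]

lemma reverse (h : IsChord σ z i j p q) :
    IsChord σ z ((finRotate n)^[j] i) (n - j) q p where
  oriented := h.oriented
  pos := by have := h.lt; omega
  lt := by have := h.pos; have := h.lt; omega
  left := h.right
  right := by rw [h.iterate_back]; exact h.left
  sees := h.sees.symm

lemma left' (h : IsChord σ z i j p q) : p ∈ openSegment ℝ (vtx z i 0) (vtx z i 1) := h.left

lemma right' (h : IsChord σ z i j p q) : q ∈ openSegment ℝ (vtx z i j) (vtx z i (j + 1)) := by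
  rw [vtx_succ]; exact h.right

lemma isCycle_half (h : IsChord σ z i j p q) : IsCycle (half z i j p q) := by
  intro f
  have h1 := Finset.sum_Ico_sub (fun k => f (vtx z i k)) (show 1 ≤ j from h.pos)
  simp only [half, Multiset.map_cons, Multiset.sum_cons, Multiset.map_map]
  change f (vtx z i 1) - f p + (f q - f (vtx z i j) + (f p - f q +
    ∑ k ∈ Finset.Ico 1 j, (f (vtx z i (k + 1)) - f (vtx z i k)))) = 0
  rw [h1]
  ring

lemma segment_subset_left {a b p x : ℂ} (hab : a ≠ b) (hp : p ∈ openSegment ℝ a b)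
    (hx : x ∈ segment ℝ a p) : x ∈ segment ℝ a b ∧ x ≠ b := by
  have hs := (convex_segment a b).segment_subset (left_mem_segment ..)
    (openSegment_subset_segment _ _ _ hp) hx
  refine ⟨hs, ?_⟩
  rintro rfl
  obtain ⟨s, h0, h1, rfl⟩ := mem_openSegment_iff_param.1 hp
  rw [segment_eq_image'] at hx
  obtain ⟨t, ⟨t0, t1⟩, ht⟩ := hx
  simp only [add_sub_cancel_left, real_smul] at ht
  have h2 : (1 - t * s : ℂ) * (x - a) = 0 := by linear_combination -ht
  rcases mul_eq_zero.1 h2 with h3 | h3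
  · have h4 : (1 - t * s : ℝ) = 0 := by exact_mod_cast h3
    nlinarith
  · exact hab (sub_eq_zero.1 h3).symm

lemma segment_subset_right {a b p x : ℂ} (hab : a ≠ b) (hp : p ∈ openSegment ℝ a b)
    (hx : x ∈ segment ℝ p b) : x ∈ segment ℝ a b ∧ x ≠ a := by
  rw [segment_symm] at hx ⊢
  rw [openSegment_symm] at hp
  exact segment_subset_left hab.symm hp hx

lemma mem_both {a b p x : ℂ} (hab : a ≠ b) (hp : p ∈ openSegment ℝ a b)
    (hx : x ∈ segment ℝ a p) (hx' : x ∈ segment ℝ p b) : x = p := by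
  obtain ⟨s, h0, h1, rfl⟩ := mem_openSegment_iff_param.1 hp
  rw [segment_eq_image'] at hx hx'
  obtain ⟨t, ⟨t0, t1⟩, rfl⟩ := hx
  obtain ⟨u, ⟨u0, u1⟩, hu⟩ := hx'
  simp only [add_sub_cancel_left, real_smul] at hu ⊢
  have h2 : (s + u * (1 - s) - t * s : ℂ) * (b - a) = 0 := by linear_combination hu
  rcases mul_eq_zero.1 h2 with h3 | h3
  · have h4 : (s + u * (1 - s) - t * s : ℝ) = 0 := by exact_mod_cast h3
    have h5 : t = 1 := by nlinarith [mul_nonneg u0 (sub_nonneg.2 h1.le)]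
    subst h5
    simp
  · exact (hab (sub_eq_zero.1 h3).symm).elim

lemma vtx_ne (hz : SimpleVertices z) (i : Fin n) (k : ℕ) : vtx z i k ≠ vtx z i (k + 1) := by
  rw [vtx_succ]; exact hz.ne _

lemma vtx_add_period (i : Fin n) (k : ℕ) : vtx z i (k + n) = vtx z i k := by
  rw [vtx, Function.iterate_add_apply, iterate_period]; rfl

/-- The complementary arc is reindexed from `i`: it runs from the edge `j` to the last edge and ends
on the edge `n`, that is, on the edge 0 again, where only the part before `p` belongs to it. -/
lemma mem_arc_reverse (h : IsChord σ z i j p q) {x : ℂ}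
    (hx : x ∈ arc z ((finRotate n)^[j] i) (n - j) q p) :
    ∃ l < n, (l = 0 ∨ j ≤ l) ∧ x ∈ segment ℝ (vtx z i l) (vtx z i (l + 1)) ∧
      (l = 0 → x ∈ segment ℝ (vtx z i 0) p) ∧ (l = j → x ∈ segment ℝ q (vtx z i (j + 1))) := by
  obtain ⟨l, hl, h1, h2, h3⟩ := hx
  simp only [vtx_iterate] at h1 h2 h3
  have hj := h.lt
  have hj0 := h.pos
  rcases hl.lt_or_eq with hlt | rfl
  · refine ⟨l + j, by omega, Or.inr (by omega), ?_, by omega, ?_⟩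
    · rwa [add_right_comm] at h1
    · intro h4
      have h5 : l = 0 := by omega
      rw [add_comm j]
      exact h2 h5
  · refine ⟨0, by omega, Or.inl rfl, ?_, fun _ => ?_, by omega⟩
    · rw [show n - j + j = 0 + n by omega, show n - j + 1 + j = 0 + 1 + n by omega,
        vtx_add_period, vtx_add_period] at h1
      exact h1
    · have := h3 rfl
      rwa [show n - j + j = 0 + n by omega, vtx_add_period] at this

lemma arc_inter (h : IsChord σ z i j p q) {x : ℂ} (hx : x ∈ arc z i j p q)
    (hx' : x ∈ arc z ((finRotate n)^[j] i) (n - j) q p) : x = p ∨ x = q := by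
  have hz := h.oriented.toSimpleVertices
  obtain ⟨k, hk, hk1, hk2, hk3⟩ := hx
  obtain ⟨l, hl, hl0, hl1, hl2, hl3⟩ := h.mem_arc_reverse hx'
  have hj := h.lt
  have hj0 := h.pos
  have hk2' : k = 0 → x ≠ vtx z i 0 := fun h0 =>
    (segment_subset_right (vtx_ne hz i 0) h.left' (hk2 h0)).2
  have hk3' : k = j → x ≠ vtx z i (j + 1) := fun h0 =>
    (segment_subset_left (vtx_ne hz i j) h.right' (hk3 h0)).2
  have hl2' : l = 0 → x ≠ vtx z i 1 := fun h0 =>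
    (segment_subset_left (vtx_ne hz i 0) h.left' (hl2 h0)).2
  have hl3' : l = j → x ≠ vtx z i j := fun h0 =>
    (segment_subset_right (vtx_ne hz i j) h.right' (hl3 h0)).2
  by_cases hkl : k = l
  · subst hkl
    rcases Nat.eq_zero_or_pos k with rfl | hpos
    · exact Or.inl (mem_both (vtx_ne hz i 0) h.left' (hl2 rfl) (hk2 rfl))
    · have : k = j := by omega
      subst this
      exact Or.inr (mem_both (vtx_ne hz i k) h.right' (hk3 rfl) (hl3 rfl))
  · exfalso
    rcases hz.common_point i (by omega) hl hkl hk1 hl1 with ⟨e1, e2⟩ | ⟨e1, e2⟩ | ⟨e1, e2, e3⟩ |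
      ⟨e1, e2, e3⟩
    · rcases hl0 with rfl | hl0
      · omega
      · by_cases h1 : l = j
        · exact hl3' h1 (h1 ▸ e2)
        · have : k = j := by omega
          subst this e1
          exact hk3' rfl e2
    · have : l = 0 := by omega
      subst this e1
      exact hl2' rfl e2
    · exact hk2' e1 e3
    · have : k = j := by omega
      subst this
      apply hk3' rfl
      rw [e3, e2, vtx_period]

lemma mem_trace_half {x : ℂ} : x ∈ trace (half z i j p q) ↔
    x ∈ segment ℝ p (vtx z i 1) ∨ x ∈ segment ℝ (vtx z i j) q ∨ x ∈ segment ℝ q p ∨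
      ∃ k, 1 ≤ k ∧ k < j ∧ x ∈ segment ℝ (vtx z i k) (vtx z i (k + 1)) := by
  simp only [half, mem_trace_cons]
  simp only [trace, Multiset.mem_map, Finset.mem_val, Finset.mem_Ico]
  constructor
  · rintro (h | h | h | ⟨e, ⟨k, ⟨h1, h2⟩, rfl⟩, h⟩)
    · exact Or.inl h
    · exact Or.inr (Or.inl h)
    · exact Or.inr (Or.inr (Or.inl h))
    · exact Or.inr (Or.inr (Or.inr ⟨k, h1, h2, h⟩))
  · rintro (h | h | h | ⟨k, h1, h2, h⟩)
    · exact Or.inl h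
    · exact Or.inr (Or.inl h)
    · exact Or.inr (Or.inr (Or.inl h))
    · exact Or.inr (Or.inr (Or.inr ⟨_, ⟨k, ⟨h1, h2⟩, rfl⟩, h⟩))

lemma mem_arc_left (h : IsChord σ z i j p q) {x : ℂ} (hx : x ∈ segment ℝ p (vtx z i 1)) :
    x ∈ arc z i j p q :=
  ⟨0, by omega, (segment_subset_right (vtx_ne h.oriented.toSimpleVertices i 0) h.left' hx).1,
    fun _ => hx, fun h0 => by have := h.pos; omega⟩

lemma mem_arc_right (h : IsChord σ z i j p q) {x : ℂ} (hx : x ∈ segment ℝ (vtx z i j) q) :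
    x ∈ arc z i j p q :=
  ⟨j, le_rfl, (segment_subset_left (vtx_ne h.oriented.toSimpleVertices i j) h.right' hx).1,
    fun h0 => by have := h.pos; omega, fun _ => hx⟩

lemma mem_arc_middle {x : ℂ} {k : ℕ} (h1 : 1 ≤ k) (h2 : k < j)
    (hx : x ∈ segment ℝ (vtx z i k) (vtx z i (k + 1))) : x ∈ arc z i j p q :=
  ⟨k, h2.le, hx, by omega, by omega⟩

lemma trace_half_subset (h : IsChord σ z i j p q) {x : ℂ} (hx : x ∈ trace (half z i j p q)) :
    x ∈ arc z i j p q ∨ x ∈ segment ℝ q p := by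
  rcases mem_trace_half.1 hx with h1 | h1 | h1 | ⟨k, h1, h2, h3⟩
  · exact Or.inl (h.mem_arc_left h1)
  · exact Or.inl (h.mem_arc_right h1)
  · exact Or.inr h1
  · exact Or.inl (mem_arc_middle h1 h2 h3)

lemma arc_subset_trace {x : ℂ} (hx : x ∈ arc z i j p q) : x ∈ trace (edges z) := by
  obtain ⟨k, -, hk, -⟩ := hx
  rw [vtx_succ] at hk
  exact mem_trace_edges.2 ⟨_, hk⟩

lemma mem_chord (h : IsChord σ z i j p q) {x : ℂ} (hx : x ∈ segment ℝ q p) :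
    x = p ∨ x = q ∨ x ∈ Inside z := by
  by_cases h1 : q = x
  · exact Or.inr (Or.inl h1.symm)
  by_cases h2 : p = x
  · exact Or.inl h2.symm
  obtain ⟨s, h3, h4, rfl⟩ := mem_openSegment_iff_param.1
    (mem_openSegment_of_ne_left_right h1 h2 hx)
  exact Or.inr (Or.inr (h.sees.symm.2 s h3 h4))

lemma left_mem_trace (h : IsChord σ z i j p q) : p ∈ trace (edges z) :=
  openEdge_subset_trace h.left

lemma right_mem_trace (h : IsChord σ z i j p q) : q ∈ trace (edges z) :=
  openEdge_subset_trace h.right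

lemma notMem_trace_half_of_outside (h : IsChord σ z i j p q) {x : ℂ} (hx : x ∈ Outside z) :
    x ∉ trace (half z i j p q) := by
  intro h1
  rcases h.trace_half_subset h1 with h2 | h2
  · exact hx.1 (arc_subset_trace h2)
  · rcases h.mem_chord h2 with rfl | rfl | h3
    · exact hx.1 h.left_mem_trace
    · exact hx.1 h.right_mem_trace
    · exact disjoint_inside_outside h3 hx

/-- The points of one arc are off the cycle formed with the other. -/
lemma notMem_trace_half (h : IsChord σ z i j p q) {x : ℂ} (hx : x ∈ arc z i j p q)
    (hp : x ≠ p) (hq : x ≠ q) :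
    x ∉ trace (half z ((finRotate n)^[j] i) (n - j) q p) := by
  intro h1
  rcases h.reverse.trace_half_subset h1 with h2 | h2
  · rcases h.arc_inter hx h2 with h3 | h3
    · exact hp h3
    · exact hq h3
  · rcases h.reverse.mem_chord h2 with h3 | h3 | h3
    · exact hq h3
    · exact hp h3
    · exact h3.1 (arc_subset_trace hx)

lemma totalAngle_half (x : ℂ) : totalAngle (half z i j p q) x =
    viewAngle x (p, vtx z i 1) + viewAngle x (vtx z i j, q) + viewAngle x (q, p) +
      ∑ k ∈ Finset.Ico 1 j, viewAngle x (vtx z i k, vtx z i (k + 1)) := by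
  simp only [half, totalAngle_cons]
  rw [totalAngle, Multiset.map_map]
  change _ + (_ + (_ + ∑ k ∈ Finset.Ico 1 j, viewAngle x (vtx z i k, vtx z i (k + 1)))) = _
  ring

lemma totalAngle_edges (i : Fin n) (x : ℂ) : totalAngle (edges z) x =
    ∑ k ∈ Finset.range n, viewAngle x (vtx z i k, vtx z i (k + 1)) := by
  rw [totalAngle, edges, Multiset.map_map]
  change ∑ l, viewAngle x (z l, z (finRotate n l)) = _
  rw [sum_iterate _ i]
  refine Finset.sum_congr rfl fun k _ => ?_
  rw [vtx_succ, vtx]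

/-- The winding number of a polygon is the sum of those of the two parts cut by a chord. -/
lemma winding_add (h : IsChord σ z i j p q) {x : ℂ} (hx : x ∉ trace (edges z))
    (hx' : x ∉ segment ℝ p q) : winding (edges z) x = winding (half z i j p q) x +
      winding (half z ((finRotate n)^[j] i) (n - j) q p) x := by
  have hj := h.lt
  have hj0 := h.pos
  have hedge : ∀ k, x ∉ segment ℝ (vtx z i k) (vtx z i (k + 1)) := by
    intro k hk
    rw [vtx_succ] at hk
    exact hx (mem_trace_edges.2 ⟨_, hk⟩)
  have t1 : x ∉ trace (half z i j p q) := fun h1 => by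
    rcases h.trace_half_subset h1 with h2 | h2
    · exact hx (arc_subset_trace h2)
    · exact hx' (segment_symm ℝ p q ▸ h2)
  have t2 : x ∉ trace (half z ((finRotate n)^[j] i) (n - j) q p) := fun h1 => by
    rcases h.reverse.trace_half_subset h1 with h2 | h2
    · exact hx (arc_subset_trace h2)
    · exact hx' h2
  have s1 := viewAngle_split (hedge 0) (openSegment_subset_segment _ _ _ h.left')
  have s2 := viewAngle_split (hedge j) (openSegment_subset_segment _ _ _ h.right')
  have s3 := viewAngle_swap hx'
  -- The two edges carrying the chord are split at `p` and `q`, and the chord is traversed once in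
  -- each direction.
  have key : totalAngle (edges z) x = totalAngle (half z i j p q) x +
      totalAngle (half z ((finRotate n)^[j] i) (n - j) q p) x := by
    rw [totalAngle_edges i, totalAngle_half, totalAngle_half]
    simp only [vtx_iterate]
    rw [show n - j + j = 0 + n by omega, vtx_add_period, add_comm 1 j]
    have e1 : ∑ k ∈ Finset.Ico 1 (n - j), viewAngle x (vtx z i (k + j), vtx z i (k + 1 + j)) =
        ∑ k ∈ Finset.Ico (j + 1) n, viewAngle x (vtx z i k, vtx z i (k + 1)) := by
      have := Finset.sum_Ico_add' (fun k => viewAngle x (vtx z i k, vtx z i (k + 1))) 1 (n - j) j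
      rw [show 1 + j = j + 1 by omega, show n - j + j = n by omega] at this
      rw [← this]
      refine Finset.sum_congr rfl fun k _ => ?_
      rw [add_right_comm]
    rw [e1, Finset.range_eq_Ico, ← Finset.sum_Ico_consecutive _ (Nat.zero_le j) hj.le,
      Finset.sum_eq_sum_Ico_succ_bot hj0, Finset.sum_eq_sum_Ico_succ_bot hj, s3, ← s1, ← s2]
    simp only [zero_add]
    ring
  rw [totalAngle_eq (isCycle_edges z) hx, totalAngle_eq h.isCycle_half t1,
    totalAngle_eq h.reverse.isCycle_half t2, ← mul_add] at key
  have := mul_left_cancel₀ Real.two_pi_pos.ne' key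
  exact_mod_cast this

end IsChord

end PolygonVisibility

/-! ### Arcs with only reflex vertices carry no chord. -/

namespace PolygonVisibility

open Complex Filter Topology

variable {n : ℕ} {z : Fin n → ℂ} {σ : ℝ}

/-- A point just below the edge is joined to a nearby point of `D` by a segment that runs outside
the polygon except for its end in `D`. So the segment avoids `F`, and the winding number is
transported along it. -/
lemma Oriented.winding_eq_below (ho : Oriented σ z) {e : Fin n} {p : ℂ} (hp : p ∈ openEdge z e)
    {F : Multiset (ℂ × ℂ)} (hF : IsCycle F) (hout : ∀ x ∈ Outside z, x ∉ trace F) {D : Set ℂ}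
    (hpD : p ∈ closure D) (hDe : ∀ x ∈ D, height σ z e x = 0) (hDF : ∀ x ∈ D, x ∉ trace F) {w : ℤ}
    (hw : ∀ x ∈ D, winding F x = w) :
    ∀ᶠ y in 𝓝 p, height σ z e y < 0 → winding F y = w := by
  obtain ⟨ε, hε, hball⟩ := Metric.eventually_nhds_iff_ball.1 (ho.edge e p hp)
  filter_upwards [Metric.ball_mem_nhds p hε] with y hy hneg
  obtain ⟨x, hx, hxb⟩ := ((mem_closure_iff_frequently.1 hpD).and_eventually
    (Metric.ball_mem_nhds p hε)).exists
  rw [← hw x hx]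
  refine winding_eq_of_segment hF fun v hv => ?_
  have hvb := (convex_ball p ε).segment_subset hy hxb hv
  rw [segment_eq_image'] at hv
  obtain ⟨s, ⟨s0, s1⟩, rfl⟩ := hv
  rcases s1.lt_or_eq with s1 | rfl
  · refine hout _ ((hball _ hvb).2 ?_)
    simp only [real_smul]
    rw [height_line, hDe x hx, mul_zero, add_zero]
    exact mul_neg_of_pos_of_neg (by linarith) hneg
  · simpa using hDF x hx

/-- From a point on the boundary of a disc, every other point of the disc is seen at an obtuse angle
to the outward radius. -/
lemma inner_lt_zero {o b v : ℂ} (h : ‖v - o‖ ≤ ‖b - o‖) (hne : v ≠ b) :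
    (b - o).re * (v - b).re + (b - o).im * (v - b).im < 0 := by
  have h3 : ‖v - o‖ ^ 2 ≤ ‖b - o‖ ^ 2 := by gcongr
  have h4 : 0 < ‖v - b‖ ^ 2 := by
    have := sub_ne_zero.2 hne
    positivity
  rw [Complex.sq_norm, Complex.normSq_apply] at h4
  rw [Complex.sq_norm, Complex.sq_norm, Complex.normSq_apply, Complex.normSq_apply] at h3
  simp only [sub_re, sub_im] at *
  nlinarith

namespace IsChord

variable {i : Fin n} {j : ℕ} {p q : ℂ}

lemma vtx_ne_left (h : IsChord σ z i j p q) (k : ℕ) : vtx z i k ≠ p := fun h0 =>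
  h.oriented.notMem_openSegment i ((finRotate n)^[k] i) (by
    have := h.left
    rw [← h0] at this
    exact this)

lemma vtx_ne_right (h : IsChord σ z i j p q) (k : ℕ) : vtx z i k ≠ q := fun h0 =>
  h.oriented.notMem_openSegment ((finRotate n)^[j] i) ((finRotate n)^[k] i) (by
    have := h.right
    rw [← h0] at this
    exact this)

lemma ne_left_of_edge (h : IsChord σ z i j p q) {k : ℕ} (hk : 0 < k) (hkn : k < n) {x : ℂ}
    (hx : x ∈ segment ℝ (vtx z i k) (vtx z i (k + 1))) : x ≠ p := by
  rintro rfl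
  rw [vtx_succ] at hx
  have h1 := h.oriented.eq_of_mem_openSegment h.left hx
  have := iterate_injOn (k := 0) (by omega) hkn h1
  omega

lemma ne_right_of_edge (h : IsChord σ z i j p q) {k : ℕ} (hk : k < n) (hkj : k ≠ j) {x : ℂ}
    (hx : x ∈ segment ℝ (vtx z i k) (vtx z i (k + 1))) : x ≠ q := by
  rintro rfl
  rw [vtx_succ] at hx
  have h1 := h.oriented.eq_of_mem_openSegment h.right hx
  exact hkj (iterate_injOn hk h.lt h1.symm)

/-- The part of the boundary on the other side of a chord. -/
abbrev opp (z : Fin n → ℂ) (i : Fin n) (j : ℕ) (p q : ℂ) : Multiset (ℂ × ℂ) :=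
  half z ((finRotate n)^[j] i) (n - j) q p

lemma vtx_notMem (h : IsChord σ z i j p q) {k : ℕ} (h1 : 1 ≤ k) (hk : k ≤ j) :
    vtx z i k ∉ trace (opp z i j p q) := by
  refine h.notMem_trace_half ?_ (h.vtx_ne_left k) (h.vtx_ne_right k)
  rcases hk.lt_or_eq with hlt | rfl
  · exact mem_arc_middle h1 hlt (left_mem_segment ..)
  · exact h.mem_arc_right (left_mem_segment ..)

/-- The edges of the arc avoid the opposite cycle, so its winding number is constant along them. -/
lemma winding_opp_vtx (h : IsChord σ z i j p q) {k : ℕ} (h1 : 1 ≤ k) (hk : k ≤ j) :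
    winding (opp z i j p q) (vtx z i k) = winding (opp z i j p q) (vtx z i 1) := by
  induction k, h1 using Nat.le_induction with
  | base => rfl
  | succ k h1 ih =>
    rw [← ih (by omega)]
    symm
    have := h.lt
    refine winding_eq_of_segment h.reverse.isCycle_half fun x hx => ?_
    exact h.notMem_trace_half (mem_arc_middle h1 hk hx)
      (h.ne_left_of_edge h1 (by omega) hx) (h.ne_right_of_edge (by omega) (by omega) hx)

lemma winding_opp_near_left (h : IsChord σ z i j p q) : ∀ᶠ y in 𝓝 p, height σ z i y < 0 →
    winding (opp z i j p q) y = winding (opp z i j p q) (vtx z i 1) := by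
  have hn := h.lt
  have hj := h.pos
  have hz := h.oriented.toSimpleVertices
  have hmem : ∀ x ∈ segment ℝ p (vtx z i 1), x ≠ p → x ∉ trace (opp z i j p q) := by
    intro x hx hxp
    refine h.notMem_trace_half (h.mem_arc_left hx) hxp ?_
    exact h.ne_right_of_edge (k := 0) (by omega) (by omega)
      (segment_subset_right (vtx_ne hz i 0) h.left' hx).1
  have hp1 : p ≠ vtx z i 1 := (h.vtx_ne_left 1).symm
  refine h.oriented.winding_eq_below h.left h.reverse.isCycle_half
    (fun x hx => h.reverse.notMem_trace_half_of_outside hx)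
    (D := openSegment ℝ p (vtx z i 1)) ?_ ?_ ?_ ?_
  · rw [closure_openSegment]; exact left_mem_segment ..
  · intro x hx
    apply height_of_mem_openEdge
    obtain ⟨s, s0, s1, hs⟩ := mem_openSegment_iff_param.1 h.left'
    obtain ⟨t, t0, t1, rfl⟩ := mem_openSegment_iff_param.1 hx
    refine mem_openSegment_iff_param.2 ⟨s + t * (1 - s), ?_, ?_, ?_⟩
    · nlinarith [mul_pos t0 (sub_pos.2 s1)]
    · nlinarith [mul_pos (sub_pos.2 t1) (sub_pos.2 s1)]
    · rw [hs]
      simp only [vtx, Function.iterate_zero, id, Function.iterate_one]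
      push_cast; ring
  · intro x hx
    refine hmem x (openSegment_subset_segment _ _ _ hx) ?_
    rintro rfl
    exact hp1 (left_mem_openSegment_iff.1 hx)
  · intro x hx
    refine winding_eq_of_segment h.reverse.isCycle_half fun v hv => ?_
    have := segment_subset_right hp1 hx hv
    exact hmem v this.1 this.2

lemma winding_opp_near_right (h : IsChord σ z i j p q) : ∀ᶠ y in 𝓝 q,
    height σ z ((finRotate n)^[j] i) y < 0 →
      winding (opp z i j p q) y = winding (opp z i j p q) (vtx z i 1) := by
  have hn := h.lt
  have hj := h.pos
  have hz := h.oriented.toSimpleVertices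
  have hmem : ∀ x ∈ segment ℝ (vtx z i j) q, x ≠ q → x ∉ trace (opp z i j p q) := by
    intro x hx hxp
    refine h.notMem_trace_half (h.mem_arc_right hx) ?_ hxp
    exact h.ne_left_of_edge (k := j) (by omega) (by omega)
      (segment_subset_left (vtx_ne hz i j) h.right' hx).1
  have hp1 : vtx z i j ≠ q := h.vtx_ne_right j
  rw [← h.winding_opp_vtx hj le_rfl]
  refine h.oriented.winding_eq_below h.right h.reverse.isCycle_half
    (fun x hx => h.reverse.notMem_trace_half_of_outside hx)
    (D := openSegment ℝ (vtx z i j) q) ?_ ?_ ?_ ?_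
  · rw [closure_openSegment]; exact right_mem_segment ..
  · intro x hx
    apply height_of_mem_openEdge
    obtain ⟨s, s0, s1, hs⟩ := mem_openSegment_iff_param.1 h.right'
    obtain ⟨t, t0, t1, rfl⟩ := mem_openSegment_iff_param.1 hx
    refine mem_openSegment_iff_param.2 ⟨t * s, by positivity, by nlinarith, ?_⟩
    rw [hs, vtx_succ]
    simp only [vtx]
    push_cast; ring
  · intro x hx
    refine hmem x (openSegment_subset_segment _ _ _ hx) ?_
    rintro rfl
    exact hp1 (right_mem_openSegment_iff.1 hx)
  · intro x hx
    symm
    refine winding_eq_of_segment h.reverse.isCycle_half fun v hv => ?_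
    have := segment_subset_left hp1 hx hv
    exact hmem v this.1 this.2

lemma opp_reverse (h : IsChord σ z i j p q) :
    opp z ((finRotate n)^[j] i) (n - j) q p = half z i j p q := by
  have := h.lt
  rw [opp, h.iterate_back, show n - (n - j) = j by omega]

/-- At a point just outside the edge `i` near `p`, each cycle has the winding number that it has
along the arc opposite to it. The two add up to the winding number of the polygon, which is even
outside. -/
lemma even_sum (h : IsChord σ z i j p q) : Even (winding (half z i j p q)
    (vtx z ((finRotate n)^[j] i) 1) + winding (opp z i j p q) (vtx z i 1)) := by
  have h1 := h.winding_opp_near_left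
  have h2 := h.reverse.winding_opp_near_right
  rw [h.iterate_back, h.opp_reverse] at h2
  have hσ := h.oriented.orientation_ne
  set e := z (finRotate n i) - z i with he
  have hpos := normSq_edge_pos h.oriented.toSimpleVertices i
  obtain ⟨t, ⟨⟨k1, k2⟩, k3⟩, t0⟩ := (((tendsto_ray p (-(σ * (I * e)))).eventually
    ((h1.and h2).and (h.oriented.edge i p h.left))).and self_mem_nhdsWithin).exists
  have t0 : 0 < t := t0
  set y := p + t * (-(σ * (I * e))) with hy
  have hneg : height σ z i y < 0 := by
    rw [hy, height_add, height_of_mem_openEdge h.left, zero_add, cross_smul_right, ← he]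
    have : σ * ((t : ℝ) * cross e (-(σ * (I * e)))) =
        -(t * σ ^ 2 * (((z (finRotate n i)).re - (z i).re) ^ 2 +
          ((z (finRotate n i)).im - (z i).im) ^ 2)) := by simp [he, cross]; ring
    rw [this, neg_lt_zero]
    positivity
  have hout := k3.2 hneg
  rw [← k1 hneg, ← k2 hneg, ← h.winding_add hout.1 fun hc => ?_]
  · exact hout.2
  · rcases h.reverse.mem_chord hc with h3 | h3 | h3
    · exact hout.1 (h3 ▸ h.right_mem_trace)
    · exact hout.1 (h3 ▸ h.left_mem_trace)
    · exact disjoint_inside_outside h3 hout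

lemma mem_half (hj : 0 < j) {e : ℂ × ℂ} (he : e ∈ half z i j p q) :
    (e.1 = p ∨ e.1 = q ∨ ∃ k, 1 ≤ k ∧ k ≤ j ∧ e.1 = vtx z i k) ∧
    (e.2 = p ∨ e.2 = q ∨ ∃ k, 1 ≤ k ∧ k ≤ j ∧ e.2 = vtx z i k) := by
  simp only [half, Multiset.mem_cons, Multiset.mem_map, Finset.mem_val, Finset.mem_Ico] at he
  rcases he with rfl | rfl | rfl | ⟨k, ⟨h1, h2⟩, rfl⟩
  · exact ⟨Or.inl rfl, Or.inr (Or.inr ⟨1, le_rfl, hj, rfl⟩)⟩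
  · exact ⟨Or.inr (Or.inr ⟨j, hj, le_rfl, rfl⟩), Or.inr (Or.inl rfl)⟩
  · exact ⟨Or.inr (Or.inl rfl), Or.inl rfl⟩
  · exact ⟨Or.inr (Or.inr ⟨k, h1, h2.le, rfl⟩), Or.inr (Or.inr ⟨k + 1, by omega, h2, rfl⟩)⟩

/-- A cycle formed with a chord does not wind around points farther away than its vertices. -/
lemma winding_half_eq_zero (h : IsChord σ z i j p q) {x o : ℂ}
    (hp : ‖p - o‖ ≤ ‖x - o‖ ∧ p ≠ x) (hq : ‖q - o‖ ≤ ‖x - o‖ ∧ q ≠ x)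
    (hv : ∀ k, 1 ≤ k → k ≤ j → ‖vtx z i k - o‖ ≤ ‖x - o‖ ∧ vtx z i k ≠ x) :
    winding (half z i j p q) x = 0 := by
  refine winding_eq_zero_of_norm_le h.isCycle_half (o := o) fun e he => ?_
  obtain ⟨h1, h2⟩ := mem_half h.pos he
  constructor
  · rcases h1 with h1 | h1 | ⟨k, k1, k2, h1⟩ <;> rw [h1]
    · exact hp
    · exact hq
    · exact hv k k1 k2
  · rcases h2 with h1 | h1 | ⟨k, k1, k2, h1⟩ <;> rw [h1]
    · exact hp
    · exact hq
    · exact hv k k1 k2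

lemma norm_le_of_openSegment {a b x : ℂ} {M : ℝ} (ha : ‖a‖ ≤ M) (hb : ‖b‖ ≤ M)
    (hx : x ∈ openSegment ℝ a b) : ‖x‖ ≤ M := by
  have := (convex_closedBall (0 : ℂ) M).openSegment_subset (by simpa using ha)
    (by simpa using hb) hx
  simpa using this

/-- If a vertex of largest norm is on the arc, the disc through it contains the opposite cycle, and
its tangent there separates the two. -/
lemma winding_opp_eq_zero (h : IsChord σ z i j p q) {k : ℕ} (h1 : 1 ≤ k) (hk : k ≤ j)
    (hmax : ∀ l, ‖z l‖ ≤ ‖vtx z i k‖) : winding (opp z i j p q) (vtx z i 1) = 0 := by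
  rw [← h.winding_opp_vtx h1 hk]
  refine h.reverse.winding_half_eq_zero (o := 0) ?_ ?_ fun l l1 l2 => ?_
  · simp only [sub_zero]
    exact ⟨norm_le_of_openSegment (hmax _) (hmax _) h.right, (h.vtx_ne_right k).symm⟩
  · simp only [sub_zero]
    exact ⟨norm_le_of_openSegment (hmax _) (hmax _) h.left, (h.vtx_ne_left k).symm⟩
  · simp only [sub_zero]
    refine ⟨hmax _, fun h0 => ?_⟩
    rw [vtx_iterate] at h0
    have h2 := h.oriented.injective h0
    have hn := h.lt
    rcases Nat.lt_or_ge (l + j) n with h3 | h3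
    · have := iterate_injOn h3 (by omega) h2
      omega
    · rw [show l + j = n by omega, iterate_period] at h2
      have := iterate_injOn (k := 0) (l := k) (by omega) (by omega) h2
      omega

/-- A vertex of largest norm lies on one of the two arcs, so one summand in `even_sum` vanishes and
the other is even. -/
lemma even_winding_opp (h : IsChord σ z i j p q) :
    Even (winding (opp z i j p q) (vtx z i 1)) := by
  have hn := h.lt
  have hj := h.pos
  have : NeZero n := ⟨by omega⟩
  obtain ⟨m, -, hm⟩ := Finset.exists_max_image Finset.univ (fun l => ‖z l‖)
    Finset.univ_nonempty
  obtain ⟨k, hk, rfl⟩ := exists_iterate_eq i m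
  have hmax : ∀ l, ‖z l‖ ≤ ‖vtx z i k‖ := fun l => hm l (Finset.mem_univ l)
  by_cases hkj : 1 ≤ k ∧ k ≤ j
  · rw [h.winding_opp_eq_zero hkj.1 hkj.2 hmax]
    exact Even.zero
  · have h0 : winding (half z i j p q) (vtx z ((finRotate n)^[j] i) 1) = 0 := by
      rw [← h.opp_reverse]
      rcases Nat.eq_zero_or_pos k with rfl | hpos
      · refine h.reverse.winding_opp_eq_zero (k := n - j) (by omega) le_rfl ?_
        rw [vtx_iterate, show n - j + j = n by omega, vtx_period]
        exact hmax
      · refine h.reverse.winding_opp_eq_zero (k := k - j) (by omega) (by omega) ?_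
        rw [vtx_iterate, show k - j + j = k by omega]
        exact hmax
    have := h.even_sum
    rwa [h0, zero_add] at this

/-- There is no chord between interior points of a part of the boundary without convex
vertices. -/
theorem exists_convex (h : IsChord σ z i j p q)
    (hturn : ∀ k < j, turn σ z ((finRotate n)^[k] i) ≤ 0) : False := by
  have hn := h.lt
  have hj := h.pos
  have ho := h.oriented
  have hi := ho.height_pos_of_sees h.left h.sees
  have hpq : q - p ≠ 0 := sub_ne_zero.2 h.sees.1.symm
  have hf : cross (q - p) (vtx z i 1 - p) ≠ 0 := by
    intro h0
    have h1 := exists_param_of_cross_eq_zero hpq h0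
    set t := ((vtx z i 1 - p) / (q - p)).re
    have h2 : vtx z i 1 = p + t * (q - p) := by rw [← h1]; ring
    have h3 : height σ z i (vtx z i 1) = 0 := height_right i
    rw [h2, height_line, height_of_mem_openEdge h.left, mul_zero, zero_add] at h3
    have h4 : t = 0 := by
      rcases mul_eq_zero.1 h3 with h4 | h4
      · exact h4
      · exact (hi.ne' h4).elim
    rw [h4] at h2
    exact h.vtx_ne_left 1 (by rw [h2]; simp)
  -- a centre for which the vertices of the arc reach farther than the chord
  obtain ⟨o, ho1, ho2⟩ : ∃ o : ℂ, ‖p - o‖ < ‖vtx z i 1 - o‖ ∧ ‖q - o‖ < ‖vtx z i 1 - o‖ := by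
    set f := cross (q - p) (vtx z i 1 - p) with hfd
    set D := normSq (q - p) with hD
    have hDpos : 0 < D := normSq_pos.2 hpq
    have hex : ∀ x : ℂ, ‖x - (p - ((D / f : ℝ) : ℂ) * (I * (q - p)))‖ ^ 2 =
        normSq (x - p) + 2 * (D / f) * cross (q - p) (x - p) + (D / f) ^ 2 * D := by
      intro x
      rw [Complex.sq_norm]
      set τ := D / f
      simp only [hD, normSq_apply, cross, sub_re, sub_im, mul_re, mul_im, ofReal_re, ofReal_im,
        I_re, I_im]
      ring
    -- The centre is on the normal of the chord at `p`, on the side away from the first vertex of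
    -- the arc. Up to a common constant, the squared distances from it are 0 for `p`, `D` for `q`
    -- and at least `2 * D` for this vertex.
    refine ⟨p - ((D / f : ℝ) : ℂ) * (I * (q - p)), ?_, ?_⟩
    all_goals
      refine lt_of_pow_lt_pow_left₀ 2 (norm_nonneg _) ?_
      rw [hex, hex, ← hfd]
      have e1 : 2 * (D / f) * f = 2 * D := by field_simp
      have e2 := normSq_nonneg (vtx z i 1 - p)
      rw [e1]
    · simp [cross]
      linarith
    · have : cross (q - p) (q - p) = 0 := by simp [cross, mul_comm]
      rw [this, ← hD]
      linarith
  obtain ⟨k, hk, hmax⟩ := Finset.exists_max_image (Finset.Icc 1 j) (fun l => ‖vtx z i l - o‖)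
    ⟨1, by simp; omega⟩
  rw [Finset.mem_Icc] at hk
  set b := vtx z i k with hb
  have hb1 : ‖vtx z i 1 - o‖ ≤ ‖b - o‖ := hmax 1 (by simp; omega)
  have hpb := ho1.trans_le hb1
  have hqb := ho2.trans_le hb1
  obtain ⟨k', rfl⟩ : ∃ k', k = k' + 1 := ⟨k - 1, by omega⟩
  set a := (finRotate n)^[k'] i with ha
  have hba : b = z (finRotate n a) := vtx_succ i k'
  have hca : vtx z i (k' + 1 + 1) = z (finRotate n (finRotate n a)) := by
    rw [vtx_succ, Function.iterate_succ_apply']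
  -- Both neighbours of the farthest vertex `b` are seen from it at an obtuse angle to the radius. A
  -- neighbour beyond the end of the arc is replaced by `p` or `q`, which lies in the same direction
  -- from `b`.
  have hu : (b - o).re * (z a - b).re + (b - o).im * (z a - b).im < 0 := by
    rcases Nat.eq_zero_or_pos k' with h0 | h0
    · have h1 := inner_lt_zero hpb.le (h.vtx_ne_left _).symm
      obtain ⟨s, s0, s1, hs⟩ := mem_openSegment_iff_param.1 h.left'
      have e0 : vtx z i 0 = z a := by rw [ha, h0]; rfl
      have e1 : vtx z i 1 = b := by rw [hb, h0]
      rw [e0, e1] at hs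
      have e2 : p - b = ((1 - s : ℝ) : ℂ) * (z a - b) := by rw [hs]; push_cast; ring
      rw [e2, re_ofReal_mul, im_ofReal_mul] at h1
      have e3 : 0 < 1 - s := by linarith
      by_contra! hn
      nlinarith [mul_nonneg e3.le hn]
    · refine inner_lt_zero (hmax k' (by simp; omega)) ?_
      have := vtx_ne ho.toSimpleVertices i k'
      exact this
  have hv : (b - o).re * (z (finRotate n (finRotate n a)) - b).re +
      (b - o).im * (z (finRotate n (finRotate n a)) - b).im < 0 := by
    rw [← hca]
    rcases hk.2.lt_or_eq with h0 | h0
    · exact inner_lt_zero (hmax (k' + 1 + 1) (by simp; omega))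
        (vtx_ne ho.toSimpleVertices i (k' + 1)).symm
    · have h1 := inner_lt_zero hqb.le (h.vtx_ne_right _).symm
      obtain ⟨s, s0, s1, hs⟩ := mem_openSegment_iff_param.1 h.right'
      rw [← h0, ← hb] at hs
      have e2 : q - b = (s : ℂ) * (vtx z i (k' + 1 + 1) - b) := by rw [hs]; ring
      rw [e2, re_ofReal_mul, im_ofReal_mul] at h1
      by_contra! hn
      nlinarith [mul_nonneg s0.le hn]
  have ha0 := hturn k' (by omega)
  rw [← ha] at ha0
  set c := z (finRotate n (finRotate n a)) with hc
  set N := b - o with hN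
  -- The identity `key` expands the turn at `b` along the radius. Without positive height above
  -- either edge it would force the turn to be zero, but at a flat vertex the neighbours lie in
  -- opposite directions and cannot both be at an obtuse angle.
  have hside : 0 < σ * cross (b - z a) N ∨ 0 < σ * cross (c - b) N := by
    by_contra! hn
    obtain ⟨n1, n2⟩ := hn
    have e1 : σ * cross (b - z a) (c - b) ≤ 0 := by rw [hba]; exact ha0
    have key : (N.re ^ 2 + N.im ^ 2) * (σ * cross (b - z a) (c - b)) =
        (N.re * (z a - b).re + N.im * (z a - b).im) * (σ * cross (c - b) N) +
        (N.re * (c - b).re + N.im * (c - b).im) * (σ * cross (b - z a) N) := by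
      simp only [cross, sub_re, sub_im]; ring
    have e2 : 0 ≤ (N.re * (z a - b).re + N.im * (z a - b).im) * (σ * cross (c - b) N) :=
      mul_nonneg_of_nonpos_of_nonpos hu.le n2
    have e3 : 0 ≤ (N.re * (c - b).re + N.im * (c - b).im) * (σ * cross (b - z a) N) :=
      mul_nonneg_of_nonpos_of_nonpos hv.le n1
    have e4 : (N.re ^ 2 + N.im ^ 2) * (σ * cross (b - z a) (c - b)) ≤ 0 :=
      mul_nonpos_of_nonneg_of_nonpos (by positivity) e1
    have e5 : 0 < N.re ^ 2 + N.im ^ 2 := by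
      by_contra! h0
      have z1 : N.re = 0 := by nlinarith [sq_nonneg N.re, sq_nonneg N.im]
      have z2 : N.im = 0 := by nlinarith [sq_nonneg N.re, sq_nonneg N.im]
      rw [z1, z2] at hu
      simp at hu
    have e6 : (N.re ^ 2 + N.im ^ 2) * (σ * cross (b - z a) (c - b)) = 0 := by linarith
    have e7 : cross (b - z a) (c - b) = 0 := by
      rcases mul_eq_zero.1 e6 with h0 | h0
      · exact (e5.ne' h0).elim
      · rcases mul_eq_zero.1 h0 with h0 | h0
        · exact (ho.orientation_ne h0).elim
        · exact h0
    rw [hba] at e7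
    obtain ⟨t, t0, ht⟩ := exists_pos_of_mem_openSegment
      (ho.mem_openSegment_of_cross_eq_zero a e7)
    rw [← hba, ← hc] at ht
    rw [ht, re_ofReal_mul, im_ofReal_mul] at hv
    have e8 : b - z a = -(z a - b) := by ring
    rw [e8, neg_re, neg_im] at hv
    nlinarith [mul_pos t0 (neg_pos.2 hu)]
  have hW := h.even_winding_opp
  rw [← h.winding_opp_vtx hk.1 hk.2, ← hb] at hW
  have hbopp : b ∉ trace (opp z i j p q) := h.vtx_notMem hk.1 hk.2
  have hrefl := ho.reflex a ha0
  rw [← hba] at hrefl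
  obtain ⟨s, ⟨k1, k2⟩, s0⟩ := ((tendsto_ray b N).eventually
    (hrefl.and (winding_eventually_eq h.reverse.isCycle_half hbopp)) |>.and
      self_mem_nhdsWithin).exists
  have s0 : 0 < s := s0
  -- This point just beyond `b` is inside because `b` is not convex, and it is farther from `o` than
  -- the whole cycle of arc and chord.
  set y := b + s * N with hy
  have hyin : y ∈ Inside z := by
    refine k1.1 ?_
    rcases hside with h0 | h0
    · left
      have : height σ z a b = 0 := by rw [hba]; exact height_right a
      rw [hy, height_add, this, zero_add, cross_smul_right, ← hba]
      have := mul_pos s0 h0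
      linarith
    · right
      have : height σ z (finRotate n a) b = 0 := by rw [hba]; exact height_left _
      rw [hy, height_add, this, zero_add, cross_smul_right, ← hba, ← hc]
      have := mul_pos s0 h0
      linarith
  have hyo : ‖b - o‖ < ‖y - o‖ := by
    have : y - o = ((1 + s : ℝ) : ℂ) * (b - o) := by rw [hy, hN]; push_cast; ring
    rw [this, norm_mul, norm_real, Real.norm_of_nonneg (by linarith)]
    have := (norm_nonneg (p - o)).trans_lt hpb
    nlinarith
  have far : ∀ x : ℂ, ‖x - o‖ ≤ ‖b - o‖ → ‖x - o‖ ≤ ‖y - o‖ ∧ x ≠ y := fun x hx =>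
    ⟨(hx.trans_lt hyo).le, fun h0 => (hx.trans_lt hyo).ne (by rw [h0])⟩
  have hw0 : winding (half z i j p q) y = 0 :=
    h.winding_half_eq_zero (far p hpb.le) (far q hqb.le) fun l l1 l2 =>
      far _ (hmax l (by simp; omega))
  have hyc : y ∉ segment ℝ p q := fun h0 => by
    have := (convex_closedBall o ‖b - o‖).segment_subset
      (by simpa [dist_eq_norm] using hpb.le) (by simpa [dist_eq_norm] using hqb.le) h0
    rw [mem_closedBall_iff_norm] at this
    linarith
  have hsum := h.winding_add hyin.1 hyc
  rw [hw0, zero_add] at hsum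
  apply Int.not_even_iff_odd.2 hyin.2
  rw [hsum, k2.2]
  exact hW

end IsChord

end PolygonVisibility

/-! ### The cyclic order of the paths and a hypothetical counterexample. -/

namespace PolygonVisibility

open Complex Filter Topology Polygon

variable {n m : ℕ} {z : Fin n → ℂ} {σ : ℝ}

/-- Some end of a path labelled `j` is the start of a path labelled `k`, or vice versa. -/
def AdjLabel (lab : Fin n → Fin m) (j k : Fin m) : Prop :=
  ∃ i, (lab i = j ∧ lab (finRotate n i) = k) ∨ (lab i = k ∧ lab (finRotate n i) = j)

lemma AdjLabel.symm {lab : Fin n → Fin m} {j k : Fin m} (h : AdjLabel lab j k) :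
    AdjLabel lab k j := by
  obtain ⟨i, h⟩ := h
  exact ⟨i, h.symm⟩

/-- The edges of a polygon are labelled by the paths that they belong to. -/
structure Labelling (B : Fin m → BoundaryPath n) (lab : Fin n → Fin m) : Prop where
  lab_idx : ∀ j, ∀ k < (B j).len, lab ((B j).idx k) = j
  exists_idx : ∀ i, ∃ k < (B (lab i)).len, (B (lab i)).idx k = i
  four_le : 4 ≤ m
  adj : ∀ j, AdjLabel lab j (finRotate m j)

lemma idx_succ (B : BoundaryPath n) (k : ℕ) : B.idx (k + 1) = finRotate n (B.idx k) := by
  rw [BoundaryPath.idx, Function.iterate_succ_apply', BoundaryPath.idx]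

lemma idx_injOn (B : BoundaryPath n) {k l : ℕ} (hk : k < n) (hl : l < n)
    (h : B.idx k = B.idx l) : k = l := iterate_injOn hk hl h

lemma iterate_idx (B : BoundaryPath n) (k l : ℕ) : (finRotate n)^[k] (B.idx l) = B.idx (k + l) := by
  rw [BoundaryPath.idx, BoundaryPath.idx, Function.iterate_add_apply]

namespace Labelling

variable {B : Fin m → BoundaryPath n} {lab : Fin n → Fin m}

/-- The path that follows a given one. -/
def next (B : Fin m → BoundaryPath n) (lab : Fin n → Fin m) (j : Fin m) : Fin m :=
  lab ((B j).idx (B j).len)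

/-- The path that precedes a given one. -/
def prev (B : Fin m → BoundaryPath n) (lab : Fin n → Fin m) (j : Fin m) : Fin m :=
  lab ((finRotate n).symm (B j).start)

lemma idx_of_lab (h : Labelling B lab) {i : Fin n} {j : Fin m} (hi : lab i = j) :
    ∃ k < (B j).len, (B j).idx k = i := by
  subst hi; exact h.exists_idx i

lemma next_ne (h : Labelling B lab) (j : Fin m) : next B lab j ≠ j := by
  intro h0
  obtain ⟨k, hk, hk'⟩ := h.idx_of_lab h0
  have := idx_injOn _ (hk.trans (B j).len_lt) (B j).len_lt hk'
  omega

lemma eq_next (h : Labelling B lab) {i : Fin n} {j : Fin m} (hi : lab i = j)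
    (hne : lab (finRotate n i) ≠ j) : lab (finRotate n i) = next B lab j := by
  obtain ⟨k, hk, rfl⟩ := h.idx_of_lab hi
  rw [← idx_succ] at hne ⊢
  rcases Nat.lt_or_ge (k + 1) (B j).len with h1 | h1
  · exact (hne (h.lab_idx j _ h1)).elim
  · rw [next, show k + 1 = (B j).len by omega]

lemma eq_prev (h : Labelling B lab) {i : Fin n} {j : Fin m} (hi : lab (finRotate n i) = j)
    (hne : lab i ≠ j) : lab i = prev B lab j := by
  obtain ⟨k, hk, hk'⟩ := h.idx_of_lab hi
  rcases Nat.eq_zero_or_pos k with rfl | h1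
  · rw [prev, show (B j).start = finRotate n i from hk', Equiv.symm_apply_apply]
  · obtain ⟨l, rfl⟩ : ∃ l, k = l + 1 := ⟨k - 1, by omega⟩
    rw [idx_succ] at hk'
    have := (finRotate n).injective hk'
    exact (hne (this ▸ h.lab_idx j l (by omega))).elim

lemma prev_ne (h : Labelling B lab) (j : Fin m) : prev B lab j ≠ j := by
  intro h0
  obtain ⟨k, hk, hk'⟩ := h.idx_of_lab h0
  have h1 : (B j).idx (k + 1) = (B j).idx 0 := by
    rw [idx_succ, hk', Equiv.apply_symm_apply]; rfl
  have := (B j).len_lt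
  have := idx_injOn _ (by omega) (by omega) h1
  omega

lemma eq_of_adj (h : Labelling B lab) {j k : Fin m} (hjk : AdjLabel lab j k) (hne : k ≠ j) :
    k = next B lab j ∨ k = prev B lab j := by
  obtain ⟨i, ⟨h1, rfl⟩ | ⟨rfl, h2⟩⟩ := hjk
  · exact Or.inl (h.eq_next h1 hne)
  · exact Or.inr (h.eq_prev h2 hne)

lemma rotate_ne (h : Labelling B lab) (j : Fin m) : finRotate m j ≠ j := by
  intro h0
  have := iterate_injOn (i := j) (k := 1) (l := 0) (by have := h.four_le; omega)
    (by have := h.four_le; omega) h0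
  omega

lemma rotate_symm_ne (h : Labelling B lab) (j : Fin m) : (finRotate m).symm j ≠ j := by
  intro h0
  rw [Equiv.symm_apply_eq] at h0
  exact h.rotate_ne j h0.symm

lemma rotate_ne_symm (h : Labelling B lab) (j : Fin m) :
    finRotate m j ≠ (finRotate m).symm j := by
  intro h0
  rw [Equiv.eq_symm_apply] at h0
  have := iterate_injOn (i := j) (k := 2) (l := 0) (by have := h.four_le; omega)
    (by have := h.four_le; omega) h0
  omega

lemma adj_symm (h : Labelling B lab) (j : Fin m) : AdjLabel lab j ((finRotate m).symm j) := by
  have := h.adj ((finRotate m).symm j)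
  rw [Equiv.apply_symm_apply] at this
  exact this.symm

/-- The indices before and after `j` are distinct neighbours of `j`, and every neighbour is the next
or the previous path. -/
lemma next_ne_prev (h : Labelling B lab) (j : Fin m) : next B lab j ≠ prev B lab j := by
  intro h0
  have h1 := h.eq_of_adj (h.adj j) (h.rotate_ne j)
  have h2 := h.eq_of_adj (h.adj_symm j) (h.rotate_symm_ne j)
  rw [← h0, or_self] at h1 h2
  exact h.rotate_ne_symm j (h1.trans h2.symm)

/-- The numbering of the paths may run with or against the order of the vertices. In both cases the
next and previous paths are the two cyclic neighbours in the numbering. -/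
lemma eq_rotate_of_adj (h : Labelling B lab) {j k : Fin m} (hjk : AdjLabel lab j k)
    (hne : k ≠ j) : k = finRotate m j ∨ k = (finRotate m).symm j := by
  have h1 := h.eq_of_adj (h.adj j) (h.rotate_ne j)
  have h2 := h.eq_of_adj (h.adj_symm j) (h.rotate_symm_ne j)
  have h3 := h.eq_of_adj hjk hne
  have h4 := h.rotate_ne_symm j
  rcases h1 with h1 | h1 <;> rcases h2 with h2 | h2 <;> rcases h3 with h3 | h3 <;>
    simp_all

/-- No three paths are pairwise adjacent. -/
lemma no_triangle (h : Labelling B lab) {j k l : Fin m} (hjk : j ≠ k) (hkl : k ≠ l) (hjl : j ≠ l)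
    (h1 : AdjLabel lab j k) (h2 : AdjLabel lab k l) (h3 : AdjLabel lab j l) : False := by
  have key : ∀ {j k l : Fin m}, j ≠ k → k ≠ l → j ≠ l → AdjLabel lab k l →
      k = finRotate m j → l = (finRotate m).symm j → False := by
    intro j k l hjk hkl hjl h2 hk hl
    rcases h.eq_rotate_of_adj h2 hkl.symm with h4 | h4
    · rw [h4, hk, Equiv.eq_symm_apply] at hl
      have := iterate_injOn (i := j) (k := 3) (l := 0) (by have := h.four_le; omega)
        (by have := h.four_le; omega) hl
      omega
    · rw [hk, Equiv.symm_apply_apply] at h4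
      exact hjl h4.symm
  rcases h.eq_rotate_of_adj h1 hjk.symm with hk | hk <;>
    rcases h.eq_rotate_of_adj h3 hjl.symm with hl | hl
  · exact hkl (hk.trans hl.symm)
  · exact key hjk hkl hjl h2 hk hl
  · exact key hjl hkl.symm hjk h2.symm hl hk
  · exact hkl (hk.trans hl.symm)

end Labelling

/-- A labelled polygon with outward convex paths in which, contrary to the theorem, only adjacent
paths see each other. -/
structure Counterexample (σ : ℝ) (z : Fin n → ℂ) (B : Fin m → BoundaryPath n)
    (lab : Fin n → Fin m) : Prop extends Labelling B lab where
  oriented : Oriented σ z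
  reflex : ∀ i, lab (finRotate n i) = lab i → turn σ z i ≤ 0
  edge_sees : ∀ i k, ∀ p ∈ openEdge z i, ∀ q ∈ openEdge z k, Sees z p q →
    lab i = lab k ∨ AdjLabel lab (lab i) (lab k)
  vertex_sees : ∀ i k, lab (finRotate n i) = lab i → ∀ q ∈ openEdge z k,
    Sees z (z (finRotate n i)) q → lab i = lab k ∨ AdjLabel lab (lab i) (lab k)

namespace Counterexample

variable {B : Fin m → BoundaryPath n} {lab : Fin n → Fin m}

lemma not_sees_forward (h : Counterexample σ z B lab) {j : Fin m} {a b : ℕ} (hab : a < b)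
    (hb : b < (B j).len) {p q : ℂ} (hp : p ∈ openEdge z ((B j).idx a))
    (hq : q ∈ openEdge z ((B j).idx b)) : ¬ Sees z p q := by
  intro hs
  have hlen := (B j).len_lt
  have hc : IsChord σ z ((B j).idx a) (b - a) p q := by
    refine ⟨h.oriented, by omega, by omega, hp, ?_, hs⟩
    rw [iterate_idx, show b - a + a = b by omega]
    exact hq
  refine hc.exists_convex fun k hk => ?_
  rw [iterate_idx]
  apply h.reflex
  rw [← idx_succ, h.lab_idx j _ (by omega), h.lab_idx j _ (by omega)]

/-- No outward convex path sees itself. -/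
lemma lab_ne_of_sees (h : Counterexample σ z B lab) {i k : Fin n} {p q : ℂ}
    (hp : p ∈ openEdge z i) (hq : q ∈ openEdge z k) (hs : Sees z p q) : lab i ≠ lab k := by
  intro hik
  obtain ⟨j, hj⟩ : ∃ j, lab k = j := ⟨_, rfl⟩
  obtain ⟨a, ha, rfl⟩ := h.idx_of_lab (hik.trans hj)
  obtain ⟨b, hb, rfl⟩ := h.idx_of_lab hj
  rcases lt_trichotomy a b with hab | rfl | hab
  · exact h.not_sees_forward hab hb hp hq hs
  · exact (h.oriented.height_pos_of_sees hp hs).ne' (height_of_mem_openEdge hq)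
  · exact h.not_sees_forward hab ha hq hp hs.symm

lemma adj_of_sees (h : Counterexample σ z B lab) {i k : Fin n} {p q : ℂ}
    (hp : p ∈ openEdge z i) (hq : q ∈ openEdge z k) (hs : Sees z p q) :
    AdjLabel lab (lab i) (lab k) :=
  (h.edge_sees i k p hp q hq hs).resolve_left (h.lab_ne_of_sees hp hq hs)

lemma next_or_prev_of_sees (h : Counterexample σ z B lab) {i k : Fin n} {p q : ℂ}
    (hp : p ∈ openEdge z i) (hq : q ∈ openEdge z k) (hs : Sees z p q) :
    lab k = Labelling.next B lab (lab i) ∨ lab k = Labelling.prev B lab (lab i) :=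
  h.eq_of_adj (h.adj_of_sees hp hq hs) (h.lab_ne_of_sees hp hq hs).symm

/-- The vertices at which two paths meet are convex. -/
lemma convex_corner (h : Counterexample σ z B lab) {i : Fin n}
    (hi : lab (finRotate n i) ≠ lab i) : 0 < turn σ z i := by
  by_contra! hn
  -- The path of the commonly seen point differs from both paths at the corner and is adjacent to
  -- both, which closes a triangle.
  obtain ⟨k, q, hq, ⟨p, hp, hs⟩, ⟨p', hp', hs'⟩⟩ := h.oriented.exists_sees_of_reflex hn
  exact h.no_triangle hi.symm (h.lab_ne_of_sees hp' hq hs') (h.lab_ne_of_sees hp hq hs)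
    ⟨i, Or.inl ⟨rfl, rfl⟩⟩ (h.adj_of_sees hp' hq hs') (h.adj_of_sees hp hq hs)

/-- Some point in the interior of the edge `i` sees an interior point of the path `l`. -/
def SeesLabel (z : Fin n → ℂ) (lab : Fin n → Fin m) (p : ℂ) (l : Fin m) : Prop :=
  ∃ k, lab k = l ∧ ∃ q ∈ openEdge z k, Sees z p q

/-- Some edge of each path sees both the path before and the path after it. -/
lemma exists_edge_sees_both (h : Counterexample σ z B lab) (j : Fin m) :
    ∃ i, lab i = j ∧ (∃ p ∈ openEdge z i, SeesLabel z lab p (Labelling.prev B lab j)) ∧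
      ∃ p ∈ openEdge z i, SeesLabel z lab p (Labelling.next B lab j) := by
  have hlen := (B j).one_le_len
  by_contra! hno
  -- If no edge sees both neighbours, seeing the previous path is inherited along the path: the
  -- point seen from both edges at a reflex vertex cannot be on the next path, so it is on the
  -- previous one. The last edge, which sees the next path, then gives the contradiction.
  have hall : ∀ a < (B j).len,
      ∃ p ∈ openEdge z ((B j).idx a), SeesLabel z lab p (Labelling.prev B lab j) := by
    intro a
    induction a with
    | zero =>
      intro _
      have hr : finRotate n ((finRotate n).symm (B j).start) = (B j).idx 0 := by
        rw [Equiv.apply_symm_apply]; rfl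
      have hne : lab (finRotate n ((finRotate n).symm (B j).start)) ≠
          lab ((finRotate n).symm (B j).start) := by
        rw [hr, h.lab_idx j 0 hlen]
        exact (h.prev_ne j).symm
      obtain ⟨p, hp, q, hq, hs⟩ := h.oriented.exists_sees_of_convex (h.convex_corner hne)
      rw [hr] at hq
      exact ⟨q, hq, _, rfl, p, hp, hs.symm⟩
    | succ a ih =>
      intro ha
      obtain ⟨p₀, hp₀, hs₀⟩ := ih (by omega)
      have hla := h.lab_idx j a (by omega)
      have hlb := h.lab_idx j (a + 1) ha
      have hturn := h.reflex ((B j).idx a) (by rw [← idx_succ, hla, hlb])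
      obtain ⟨k, q, hq, ⟨p, hp, hs⟩, ⟨p', hp', hs'⟩⟩ := h.oriented.exists_sees_of_reflex hturn
      rw [← idx_succ] at hp'
      have hk := h.next_or_prev_of_sees hp hq hs
      rw [hla] at hk
      rcases hk with hk | hk
      · exact (hno _ hla ⟨p₀, hp₀, hs₀⟩ p hp ⟨k, hk, q, hq, hs⟩).elim
      · exact ⟨p', hp', k, hk, q, hq, hs'⟩
  have hlast := h.lab_idx j ((B j).len - 1) (by omega)
  have hr : finRotate n ((B j).idx ((B j).len - 1)) = (B j).idx (B j).len := by
    rw [← idx_succ, Nat.sub_add_cancel hlen]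
  have hne : lab (finRotate n ((B j).idx ((B j).len - 1))) ≠
      lab ((B j).idx ((B j).len - 1)) := by
    rw [hr, hlast]
    exact h.next_ne j
  obtain ⟨p, hp, q, hq, hs⟩ := h.oriented.exists_sees_of_convex (h.convex_corner hne)
  exact hno _ hlast (hall _ (by omega)) p hp ⟨_, by rw [hr]; rfl, q, hq, hs⟩

end Counterexample

/-- Collinearity of the point with two given vertices is an affine condition on `s`. It is not
identically true when the first vertex is off the line of the edge, so each pair of vertices
excludes at most one value. -/
lemma eventually_generic (hz : Oriented σ z) (i : Fin n) (s₀ : ℝ) :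
    ∀ᶠ s : ℝ in 𝓝[≠] s₀, Generic σ z i (z i + s * (z (finRotate n i) - z i)) := by
  unfold Generic
  rw [eventually_all]
  intro k
  rw [eventually_all]
  intro l
  by_cases hkl : k = l
  · exact Eventually.of_forall fun s h => (h hkl).elim
  by_cases hk : height σ z i (z k) = 0
  · exact Eventually.of_forall fun s _ h => (h hk).elim
  set e := z (finRotate n i) - z i with he
  have he0 : e ≠ 0 := sub_ne_zero.2 (hz.ne i).symm
  have hk' : cross e (z k - z i) ≠ 0 := fun h0 => hk (hz.height_eq_zero_iff.2 h0)
  have hexp : ∀ s : ℝ, cross (z k - (z i + s * e)) (z l - (z i + s * e)) =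
      cross (z k - z i) (z l - z i) + s * cross e (z k - z l) := by
    intro s
    simp only [cross, sub_re, sub_im, add_re, add_im, re_ofReal_mul, im_ofReal_mul]
    ring
  have hfin : {s : ℝ | cross (z k - (z i + s * e)) (z l - (z i + s * e)) = 0}.Finite := by
    refine Set.Subsingleton.finite fun s hs t ht => ?_
    simp only [Set.mem_ofPred_eq, hexp] at hs ht
    by_cases hB : cross e (z k - z l) = 0
    · exfalso
      rw [hB, mul_zero, add_zero] at hs
      have h1 := exists_param_of_cross_eq_zero he0 hB
      set t := ((z k - z l) / e).re
      have h2 : cross (z k - z i) (z l - z i) = t * cross e (z k - z i) := by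
        have h3 : z l - z i = (z k - z i) + ((-t : ℝ) : ℂ) * e := by
          push_cast; linear_combination -h1
        rw [h3, cross_add_right, cross_smul_right]
        simp [cross]; ring
      rw [h2] at hs
      rcases mul_eq_zero.1 hs with h3 | h3
      · rw [h3, ofReal_zero, zero_mul, sub_eq_zero] at h1
        exact hkl (hz.injective h1)
      · exact hk' h3
    · have h3 : (s - t) * cross e (z k - z l) = 0 := by linarith
      rcases mul_eq_zero.1 h3 with h4 | h4
      · linarith
      · exact (hB h4).elim
  have := nhdsNE_le_cofinite s₀ hfin.compl_mem_cofinite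
  filter_upwards [this] with s hs _ _
  exact hs

/-! ### Rotating a ray about a generic point. -/

namespace Counterexample

variable {B : Fin m → BoundaryPath n} {lab : Fin n → Fin m}

lemma isOpen_seesLabel (hz : Oriented σ z) (i : Fin n) (l : Fin m) :
    IsOpen {s : ℝ | s ∈ Set.Ioo (0 : ℝ) 1 ∧
      SeesLabel z lab (z i + s * (z (finRotate n i) - z i)) l} := by
  rw [isOpen_iff_eventually]
  rintro s ⟨hs, k, hk, q, hq, hsees⟩
  have hp : z i + s * (z (finRotate n i) - z i) ∈ openEdge z i :=
    mem_openSegment_iff_param.2 ⟨s, hs.1, hs.2, rfl⟩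
  have h1 := hz.height_pos_of_sees hp hsees
  have h2 := hz.height_pos_of_sees hq hsees.symm
  have h3 := hsees.symm.eventually (isAffine_height k) (isAffine_height k) (isAffine_height i)
    (isAffine_height i)
    ((hz.edge k q hq).mono fun y hy (h : 0 < height σ z k y) _ => hy.1 h)
    ((hz.edge i _ hp).mono fun y hy (h : 0 < height σ z i y) _ => hy.1 h) h2 h2 h1 h1
  have hc : Continuous fun s : ℝ => z i + s * (z (finRotate n i) - z i) := by fun_prop
  filter_upwards [hc.continuousAt.eventually (eventually_fst_snd h3), Ioo_mem_nhds hs.1 hs.2]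
    with t ht ht'
  have hp' : z i + t * (z (finRotate n i) - z i) ∈ openEdge z i :=
    mem_openSegment_iff_param.2 ⟨t, ht'.1, ht'.2, rfl⟩
  have e1 := (height_of_mem_openEdge (σ := σ) hq).ge
  have e2 := (height_of_mem_openEdge (σ := σ) hp').ge
  exact ⟨ht', k, hk, q, hq, (ht e1 e1 e2 e2).symm⟩

/-- Some generic point sees both the path before and the path after its own path. -/
lemma exists_generic (h : Counterexample σ z B lab) (j : Fin m) :
    ∃ i, lab i = j ∧ ∃ p ∈ openEdge z i, Generic σ z i p ∧
      SeesLabel z lab p (Labelling.prev B lab j) ∧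
      SeesLabel z lab p (Labelling.next B lab j) := by
  obtain ⟨i, hi, ⟨p₁, hp₁, hs₁⟩, ⟨p₂, hp₂, hs₂⟩⟩ := h.exists_edge_sees_both j
  refine ⟨i, hi, ?_⟩
  obtain ⟨s₁, a₁, b₁, rfl⟩ := mem_openSegment_iff_param.1 hp₁
  obtain ⟨s₂, a₂, b₂, rfl⟩ := mem_openSegment_iff_param.1 hp₂
  have ho1 := isOpen_seesLabel (lab := lab) h.oriented i (Labelling.prev B lab j)
  have ho2 := isOpen_seesLabel (lab := lab) h.oriented i (Labelling.next B lab j)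
  -- The points seeing the previous path and those seeing the next one form two nonempty open sets
  -- that cover the open edge, so they meet. Their intersection is open, which leaves room for a
  -- generic point.
  obtain ⟨s, -, hs, hs'⟩ := (isPreconnected_Ioo (a := (0 : ℝ)) (b := 1)) _ _ ho1 ho2 (by
    intro s hs
    have hp : z i + s * (z (finRotate n i) - z i) ∈ openEdge z i :=
      mem_openSegment_iff_param.2 ⟨s, hs.1, hs.2, rfl⟩
    obtain ⟨k, q, hq, hsees⟩ := h.oriented.exists_sees hp
    have := h.next_or_prev_of_sees hp hq hsees
    rw [hi] at this
    rcases this with hk | hk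
    · exact Or.inr ⟨hs, k, hk, q, hq, hsees⟩
    · exact Or.inl ⟨hs, k, hk, q, hq, hsees⟩) ⟨s₁, ⟨a₁, b₁⟩, ⟨a₁, b₁⟩, hs₁⟩
      ⟨s₂, ⟨a₂, b₂⟩, ⟨a₂, b₂⟩, hs₂⟩
  obtain ⟨t, ht, ht1, ht2⟩ := ((eventually_generic h.oriented i s).and
    (nhdsWithin_le_nhds ((ho1.inter ho2).mem_nhds ⟨hs, hs'⟩))).exists
  exact ⟨_, mem_openSegment_iff_param.2 ⟨t, ht1.1.1, ht1.1.2, rfl⟩, ht, ht1.2, ht2.2⟩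

/-- Edges that are linked and seen from the same point belong to the same path. -/
lemma lab_eq_of_linked (h : Counterexample σ z B lab) {i k l : Fin n} {p q r : ℂ}
    (hp : p ∈ openEdge z i) (hq : q ∈ openEdge z k) (hr : r ∈ openEdge z l) (hpq : Sees z p q)
    (hpr : Sees z p r) (hkl : Linked σ z k l) : lab k = lab l := by
  by_contra hne
  have htri : ¬ AdjLabel lab (lab k) (lab l) := fun hadj =>
    h.no_triangle (h.lab_ne_of_sees hp hq hpq) hne (h.lab_ne_of_sees hp hr hpr)
      (h.adj_of_sees hp hq hpq) hadj (h.adj_of_sees hp hr hpr)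
  have hcase : ∀ {k l : Fin n}, (∃ a, turn σ z a ≤ 0 ∧ (k = a ∨ k = finRotate n a) ∧
      ∃ q ∈ openEdge z l, Sees z (z (finRotate n a)) q) → lab k = lab l ∨
        AdjLabel lab (lab k) (lab l) := by
    rintro k l ⟨a, ha, hk, q, hq, hs⟩
    -- A vertex that is not convex is interior to its path, so its sightings are subject to the
    -- assumption on visibility.
    have hcorner : lab (finRotate n a) = lab a := by
      by_contra hc
      exact (h.convex_corner hc).not_ge ha
    have : lab k = lab a := by
      rcases hk with rfl | rfl
      · rfl
      · exact hcorner
    rw [this]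
    exact h.vertex_sees a l hcorner q hq hs
  rcases hkl with rfl | rfl | rfl | hc | hc
  · exact hne rfl
  · exact htri ⟨k, Or.inl ⟨rfl, rfl⟩⟩
  · exact htri ⟨l, Or.inr ⟨rfl, rfl⟩⟩
  · rcases hcase hc with h1 | h1
    · exact hne h1
    · exact htri h1
  · rcases hcase hc with h1 | h1
    · exact hne h1.symm
    · exact htri h1.symm

/-- Puncturing disregards the exceptional directions in which the ray runs into a vertex, where no
edge is hit in its interior. -/
lemma isOpen_punctured (D : Set ℝ) : IsOpen {s : ℝ | ∀ᶠ t in 𝓝[≠] s, t ∈ D} := by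
  rw [isOpen_iff_eventually]
  intro s hs
  simp only [Set.mem_ofPred_eq, eventually_nhdsWithin_iff] at hs ⊢
  filter_upwards [eventually_eventually_nhds.2 hs] with t ht
  by_cases hts : t = s
  · subst hts
    exact ht
  · filter_upwards [ht, isOpen_ne.mem_nhds hts] with u hu hus _
    exact hu hus

/-- A rotating ray from a point that sees both neighbouring paths would have to switch between them,
while linked edges hit by it always carry the same label. -/
theorem false (h : Counterexample σ z B lab) : False := by
  have hm := h.four_le
  have ho := h.oriented
  set j : Fin m := ⟨0, by omega⟩
  obtain ⟨i, hi, p, hp, hgen, ⟨k₁, hk₁, q₁, hq₁, hs₁⟩, ⟨k₂, hk₂, q₂, hq₂, hs₂⟩⟩ :=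
    h.exists_generic j
  have hne : Labelling.prev B lab j ≠ Labelling.next B lab j := (h.next_ne_prev j).symm
  have hpos₁ := ho.height_pos_of_sees hp hs₁
  have hpos₂ := ho.height_pos_of_sees hp hs₂
  have hray₁ : RayHits z p (q₁ - p) k₁ := ⟨1, one_pos, by simpa using hq₁, by simpa using hs₁⟩
  have hray₂ : RayHits z p (q₂ - p) k₂ := ⟨1, one_pos, by simpa using hq₂, by simpa using hs₂⟩
  -- Both targets are above the edge of `p`. If they were collinear with `p` they would be on the
  -- same ray, whose first hit is unique.
  have hX : cross (q₁ - p) (q₂ - q₁) ≠ 0 := by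
    intro h0
    have h1 : cross (q₁ - p) (q₂ - p) = 0 := by
      have : q₂ - p = (q₂ - q₁) + (q₁ - p) := by ring
      rw [this, cross_add_right, h0, zero_add]
      simp [cross, mul_comm]
    have h2 := exists_param_of_cross_eq_zero (sub_ne_zero.2 hs₁.1.symm) h1
    set c := ((q₂ - p) / (q₁ - p)).re
    have h3 : q₂ = p + c * (q₁ - p) := by rw [← h2]; ring
    have h4 := hpos₂
    rw [h3, height_line, height_of_mem_openEdge hp, mul_zero, zero_add] at h4
    have hc : 0 < c := pos_of_mul_pos_left h4 hpos₁.le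
    have hray : RayHits z p (q₁ - p) k₂ := ⟨c, hc, h3 ▸ hq₂, h3 ▸ hs₂⟩
    have := hray₁.unique ho.toSimpleVertices hray
    rw [← hk₁, ← hk₂, this] at hne
    exact hne rfl
  set θ : ℝ → ℂ := fun s => (q₁ - p) + s * (q₂ - q₁) with hθ
  -- The direction moves along the line through the two sightings and turns in one sense only:
  -- `cross (θ s) (θ t)` is `t - s` times the nonzero constant in `hX`. The set `U` is the interval
  -- of parameters for which it points above the edge of `p`.
  have hθc : Continuous θ := by fun_prop
  have hθ1 : θ 1 = q₂ - p := by simp [hθ]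
  have hθ0 : θ 0 = q₁ - p := by simp [hθ]
  have hheight : ∀ s, height σ z i (p + θ s) =
      (1 - s) * height σ z i q₁ + s * height σ z i q₂ := by
    intro s
    rw [← height_line]
    congr 1
    simp only [hθ]
    ring
  set U : Set ℝ := {s | 0 < height σ z i (p + θ s)} with hU
  set D : Fin m → Set ℝ := fun l => {s | ∃ k, lab k = l ∧ RayHits z p (θ s) k} with hD
  set E : Fin m → Set ℝ := fun l => {s | ∀ᶠ t in 𝓝[≠] s, t ∈ D l} with hE
  have hUconn : IsPreconnected U := by
    refine Convex.isPreconnected ?_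
    have : U = {s | -(height σ z i q₁) < s * (height σ z i q₂ - height σ z i q₁)} := by
      ext s
      simp only [hU, Set.mem_ofPred_eq, hheight]
      constructor <;> intro hs <;> linarith
    rw [this]
    intro s hs t ht a b ha hb hab
    simp only [Set.mem_ofPred_eq, smul_eq_mul] at *
    set G := height σ z i q₂ - height σ z i q₁
    have e1 : (a * s + b * t) * G = a * (s * G) + b * (t * G) := by ring
    rw [e1]
    rcases ha.eq_or_lt with rfl | ha
    · have : b = 1 := by linarith
      subst this
      linarith
    · have h1 := mul_lt_mul_of_pos_left hs ha
      have h2 := mul_le_mul_of_nonneg_left ht.le hb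
      have h3 : a * -height σ z i q₁ + b * -height σ z i q₁ = -height σ z i q₁ := by
        rw [← add_mul, hab, one_mul]
      linarith
  -- On the two sides of any direction the edges hit are linked, hence equally labelled, so a
  -- punctured neighbourhood of its parameter belongs to a single neighbouring path.
  have hcov : U ⊆ E (Labelling.prev B lab j) ∪ E (Labelling.next B lab j) := by
    intro s hs
    obtain ⟨k, l, hkl, hev⟩ := ho.exists_linked hp hgen hs
    have hside : ∀ t, cross (θ s) (θ t) = (t - s) * cross (q₁ - p) (q₂ - q₁) := by
      intro t
      simp only [hθ, cross, add_re, add_im, re_ofReal_mul, im_ofReal_mul]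
      ring
    have hev' := hθc.continuousAt.eventually hev
    simp only [hside] at hev'
    obtain ⟨k, l, hkl, hgt, hlt⟩ : ∃ k l, Linked σ z k l ∧
        (∀ᶠ t in 𝓝 s, s < t → RayHits z p (θ t) k) ∧
        (∀ᶠ t in 𝓝 s, t < s → RayHits z p (θ t) l) := by
      rcases lt_or_gt_of_ne hX with hX | hX
      · refine ⟨l, k, hkl.symm, hev'.mono fun t ht hst => ?_, hev'.mono fun t ht hst => ?_⟩
        · exact ht.2 (mul_neg_of_pos_of_neg (by linarith) hX)
        · exact ht.1 (mul_pos_of_neg_of_neg (by linarith) hX)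
      · refine ⟨k, l, hkl, hev'.mono fun t ht hst => ?_, hev'.mono fun t ht hst => ?_⟩
        · exact ht.1 (mul_pos (by linarith) hX)
        · exact ht.2 (mul_neg_of_neg_of_pos (by linarith) hX)
    obtain ⟨t₁, h₁, e₁⟩ := ((hgt.filter_mono (nhdsWithin_le_nhds (s := Set.Ioi s))).and
      self_mem_nhdsWithin).exists
    obtain ⟨T₁, -, m₁, v₁⟩ := h₁ e₁
    obtain ⟨t₂, h₂, e₂⟩ := ((hlt.filter_mono (nhdsWithin_le_nhds (s := Set.Iio s))).and
      self_mem_nhdsWithin).exists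
    obtain ⟨T₂, -, m₂, v₂⟩ := h₂ e₂
    have hlab := h.lab_eq_of_linked hp m₁ m₂ v₁ v₂ hkl
    have hmem : s ∈ E (lab k) := by
      change ∀ᶠ t in 𝓝[≠] s, t ∈ D (lab k)
      rw [eventually_nhdsWithin_iff]
      filter_upwards [hgt, hlt] with t h1 h2 hts
      rcases lt_or_gt_of_ne hts with h3 | h3
      · exact ⟨l, hlab.symm, h2 h3⟩
      · exact ⟨k, rfl, h1 h3⟩
    have := h.next_or_prev_of_sees hp m₁ v₁
    rw [hi] at this
    rcases this with h1 | h1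
    · exact Or.inr (h1 ▸ hmem)
    · exact Or.inl (h1 ▸ hmem)
  have hmem0 : (0 : ℝ) ∈ E (Labelling.prev B lab j) := by
    have h1 := ho.rayHits_eventually hp hray₁
    rw [← hθ0] at h1
    exact nhdsWithin_le_nhds ((hθc.continuousAt.eventually h1).mono fun t ht => ⟨k₁, hk₁, ht⟩)
  have hmem1 : (1 : ℝ) ∈ E (Labelling.next B lab j) := by
    have h1 := ho.rayHits_eventually hp hray₂
    rw [← hθ1] at h1
    exact nhdsWithin_le_nhds ((hθc.continuousAt.eventually h1).mono fun t ht => ⟨k₂, hk₂, ht⟩)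
  obtain ⟨s, -, hs1, hs2⟩ := hUconn _ _ (isOpen_punctured _) (isOpen_punctured _) hcov
    ⟨0, by simp [hU, hheight, hpos₁], hmem0⟩ ⟨1, by simp [hU, hheight, hpos₂], hmem1⟩
  obtain ⟨t, ⟨a, ha, hta⟩, ⟨b, hb, htb⟩⟩ := (Eventually.and (f := 𝓝[≠] s) hs1 hs2).exists
  have := hta.unique ho.toSimpleVertices htb
  rw [← ha, ← hb, this] at hne
  exact hne rfl

end Counterexample

end PolygonVisibility

/-! ### From polygons in the Euclidean plane to complex vertices. -/

namespace PolygonVisibility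

open Complex Filter Topology Polygon

variable {n m : ℕ}

/-- The isometry between the Euclidean plane and the complex plane. -/
noncomputable def toComplex : Plane ≃ₗᵢ[ℝ] ℂ := Complex.orthonormalBasisOneI.repr.symm

/-- The vertices of a polygon as complex numbers. -/
noncomputable def complexVertices (P : Polygon Plane n) (i : Fin n) : ℂ := toComplex (P i)

lemma mem_edgeSet_iff {P : Polygon Plane n} {i : Fin n} {x : Plane} :
    x ∈ P.edgeSet ℝ i ↔ toComplex x ∈
      segment ℝ (complexVertices P i) (complexVertices P (finRotate n i)) := by
  rw [Polygon.edgeSet, affineSegment_eq_segment, complexVertices, complexVertices]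
  have h := image_segment ℝ (toComplex.toLinearEquiv.toLinearMap.toAffineMap) (P i)
    (P (finRotate n i))
  constructor
  · intro hx
    have := Set.mem_image_of_mem (toComplex.toLinearEquiv.toLinearMap.toAffineMap) hx
    rw [h] at this
    exact this
  · intro hx
    have hx' : toComplex x ∈ segment ℝ ((toComplex.toLinearEquiv.toLinearMap.toAffineMap) (P i))
      ((toComplex.toLinearEquiv.toLinearMap.toAffineMap) (P (finRotate n i))) := hx
    rw [← h] at hx'
    obtain ⟨y, hy, hyx⟩ := hx'
    have : y = x := toComplex.injective hyx
    exact this ▸ hy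

lemma mem_boundary_iff {P : Polygon Plane n} {x : Plane} :
    x ∈ P.boundary ℝ ↔ toComplex x ∈ trace (edges (complexVertices P)) := by
  simp only [Polygon.boundary, Set.mem_iUnion, mem_trace_edges, mem_edgeSet_iff]

lemma simpleVertices {P : Polygon Plane n} (hP : P.IsSimple) :
    SimpleVertices (complexVertices P) where
  three_le := hP.three_le
  ne i h := hP.nondegenerate i (toComplex.injective h)
  consecutive i := by
    have h := hP.consecutive i
    ext w
    obtain ⟨x, rfl⟩ := toComplex.surjective w
    have h1 := Set.ext_iff.1 h x
    simp only [Set.mem_inter_iff, mem_edgeSet_iff, Set.mem_singleton_iff] at h1 ⊢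
    rw [h1]
    exact toComplex.injective.eq_iff.symm
  nonconsecutive i j h1 h2 h3 := by
    have h := hP.nonconsecutive i j h1 h2 h3
    rw [Set.disjoint_left] at h ⊢
    intro w hw
    obtain ⟨x, rfl⟩ := toComplex.surjective w
    rw [← mem_edgeSet_iff] at hw ⊢
    exact h hw

/-- The winding number is constant on the component of the point and odd there, whereas it vanishes
far away, so the component is bounded. Only this inclusion is needed. -/
lemma mem_region_of_inside {P : Polygon Plane n} {x : Plane}
    (hx : toComplex x ∈ Inside (complexVertices P)) : x ∈ P.region := by
  have hxb : x ∉ P.boundary ℝ := fun h => hx.1 (mem_boundary_iff.1 h)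
  refine Or.inr ⟨hxb, ?_⟩
  obtain ⟨M, -, hb⟩ := exists_norm_bound (complexVertices P)
  refine (Metric.isBounded_closedBall (x := (0 : Plane)) (r := M)).subset fun y hy => ?_
  rw [mem_closedBall_zero_iff]
  by_contra! hlt
  have h1 : IsPreconnected (toComplex '' connectedComponentIn (P.boundary ℝ)ᶜ x) :=
    isPreconnected_connectedComponentIn.image _ toComplex.continuous.continuousOn
  have h2 := winding_eq_of_preconnected (isCycle_edges (complexVertices P)) h1 (by
    rintro _ ⟨w, hw, rfl⟩ h
    exact connectedComponentIn_subset _ _ hw (mem_boundary_iff.2 h))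
    (Set.mem_image_of_mem _ (mem_connectedComponentIn hxb)) (Set.mem_image_of_mem _ hy)
  have h3 := (outside_of_norm_lt (z := complexVertices P) (x := toComplex y) fun i => by
    rw [toComplex.norm_map]; exact (hb i).trans hlt).2
  rw [h3] at h2
  have h4 := hx.2
  rw [h2] at h4
  simp at h4

lemma toComplex_lineMap (x y : Plane) (t : ℝ) : toComplex (AffineMap.lineMap x y t) =
    toComplex x + t * (toComplex y - toComplex x) := by
  rw [AffineMap.lineMap_apply_module', map_add, map_smul, map_sub, real_smul, add_comm]

lemma toComplex_midpoint (x y : Plane) : toComplex (midpoint ℝ x y) =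
    toComplex x + (1 / 2 : ℝ) * (toComplex y - toComplex x) := by
  rw [midpoint, toComplex_lineMap]
  norm_num

/-- A reflex vertex is not a convex vertex in terms of the orientation. -/
lemma turn_nonpos_of_isReflex {P : Polygon Plane n} {σ : ℝ} (ho : Oriented σ (complexVertices P))
    {a : Fin n} (h : P.IsReflex (finRotate n a)) : turn σ (complexVertices P) a ≤ 0 := by
  by_contra! hpos
  -- At a vertex of positive turn the midpoint of the neighbours is above both edges. So the
  -- unoriented angle is the interior one, and being at most π it would have to equal π, which makes
  -- the vertex flat and the turn zero.
  have hsec : P.SmallSectorInward (finRotate n a) := by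
    unfold Polygon.SmallSectorInward
    rw [Equiv.symm_apply_apply]
    set z := complexVertices P with hz
    have ht := tendsto_ray (z (finRotate n a)) (z a + (1 / 2 : ℝ) *
      (z (finRotate n (finRotate n a)) - z a) - z (finRotate n a))
    filter_upwards [ht.eventually (ho.convex a hpos), self_mem_nhdsWithin] with t h1 h2
    have h2 : 0 < t := h2
    apply mem_region_of_inside
    rw [toComplex_lineMap, toComplex_midpoint]
    refine h1.1 ?_ ?_
    · rw [height_line, height_right, height_line, height_left, height_next]
      linarith [mul_pos h2 hpos]
    · rw [height_line, height_next_left, height_line, height_prev, height_right]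
      linarith [mul_pos h2 hpos]
  rw [Polygon.IsReflex, Polygon.interiorAngle, if_pos hsec, Equiv.symm_apply_apply] at h
  have hpi := le_antisymm (EuclideanGeometry.angle_le_pi _ _ _) h
  obtain ⟨⟨t, -, ht⟩, -⟩ := EuclideanGeometry.angle_eq_pi_iff_sbtw.1 hpi
  have h3 := toComplex_lineMap (P a) (P (finRotate n (finRotate n a))) t
  rw [ht] at h3
  apply hpos.ne'
  have h4 : complexVertices P (finRotate n a) = complexVertices P a +
      t * (complexVertices P (finRotate n (finRotate n a)) - complexVertices P a) := h3
  rw [turn, h4]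
  simp only [cross, sub_re, sub_im, add_re, add_im, re_ofReal_mul, im_ofReal_mul]
  ring

lemma mem_carrier_iff {P : Polygon Plane n} {B : BoundaryPath n} {x : Plane} :
    x ∈ B.carrier P ↔ ∃ k < B.len, x ∈ P.edgeSet ℝ (B.idx k) := by
  simp [BoundaryPath.carrier]

lemma mem_inner_of_openEdge {P : Polygon Plane n} (hz : SimpleVertices (complexVertices P))
    {B : BoundaryPath n} {k : ℕ} (hk : k < B.len) {x : Plane}
    (hx : toComplex x ∈ openEdge (complexVertices P) (B.idx k)) : x ∈ B.inner P := by
  refine ⟨mem_carrier_iff.2 ⟨k, hk, mem_edgeSet_iff.2 (openSegment_subset_segment _ _ _ hx)⟩, ?_⟩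
  rintro (rfl | rfl)
  · exact hz.notMem_openSegment _ _ hx
  · exact hz.notMem_openSegment _ _ hx

lemma exists_mem_openEdge (z : Fin n → ℂ) (i : Fin n) : (openEdge z i).Nonempty :=
  ⟨_, ⟨1 / 2, 1 / 2, by norm_num, by norm_num, by norm_num, rfl⟩⟩

section Partition

variable {P : Polygon Plane n} {B : Fin m → BoundaryPath n} {v : Fin m → Fin n}

/-- An interior point of an edge lies on no other edge. Covering therefore assigns a path to every
edge, and the absence of common interior points makes it unique. -/
lemma exists_lab (hP : P.IsSimple) (hB : P.IsPartition B v) : ∃ lab : Fin n → Fin m,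
    (∀ j, ∀ k < (B j).len, lab ((B j).idx k) = j) ∧
      ∀ i, ∃ k < (B (lab i)).len, (B (lab i)).idx k = i := by
  have hz := simpleVertices hP
  have hex : ∀ i, ∃ j, ∃ k < (B j).len, (B j).idx k = i := by
    intro i
    obtain ⟨w, hw⟩ := exists_mem_openEdge (complexVertices P) i
    obtain ⟨x, rfl⟩ := toComplex.surjective w
    have hx : x ∈ P.boundary ℝ := mem_boundary_iff.2 (openEdge_subset_trace hw)
    rw [← hB.cover, Set.mem_iUnion] at hx
    obtain ⟨j, hj⟩ := hx
    obtain ⟨k, hk, hx⟩ := mem_carrier_iff.1 hj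
    exact ⟨j, k, hk, (hz.eq_of_mem_openSegment hw (mem_edgeSet_iff.1 hx)).symm⟩
  choose lab hlab using hex
  refine ⟨lab, fun j k hk => ?_, hlab⟩
  by_contra hne
  obtain ⟨l, hl, hl'⟩ := hlab ((B j).idx k)
  obtain ⟨w, hw⟩ := exists_mem_openEdge (complexVertices P) ((B j).idx k)
  obtain ⟨x, rfl⟩ := toComplex.surjective w
  refine Set.disjoint_left.1 (hB.nonoverlap _ _ hne) ?_ (mem_inner_of_openEdge hz hk hw)
  rw [← hl'] at hw
  exact mem_inner_of_openEdge hz hl hw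

/-- The common point lies on two different edges, and these are consecutive by simplicity. -/
lemma adjLabel_of_mem (hP : P.IsSimple) {lab : Fin n → Fin m}
    (hlab : ∀ j, ∀ k < (B j).len, lab ((B j).idx k) = j) {j k : Fin m} (hjk : j ≠ k) {x : Plane}
    (hj : x ∈ (B j).carrier P) (hk : x ∈ (B k).carrier P) : AdjLabel lab j k := by
  obtain ⟨a, ha, hxa⟩ := mem_carrier_iff.1 hj
  obtain ⟨b, hb, hxb⟩ := mem_carrier_iff.1 hk
  have h1 := hlab j a ha
  have h2 := hlab k b hb
  have hne : (B j).idx a ≠ (B k).idx b := fun h0 => hjk (by rw [← h1, ← h2, h0])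
  rcases (simpleVertices hP).eq_vertex_of_mem hne (mem_edgeSet_iff.1 hxa)
    (mem_edgeSet_iff.1 hxb) with ⟨h3, -⟩ | ⟨h3, -⟩
  · exact ⟨_, Or.inl ⟨h1, h3 ▸ h2⟩⟩
  · exact ⟨_, Or.inr ⟨h2, h3 ▸ h1⟩⟩

lemma labelling (hP : P.IsSimple) (hm : 4 ≤ m) (hB : P.IsPartition B v) :
    ∃ lab, Labelling B lab := by
  obtain ⟨lab, h1, h2⟩ := exists_lab hP hB
  refine ⟨lab, h1, h2, hm, fun j => ?_⟩
  have hne : j ≠ finRotate m j := by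
    intro h0
    have := iterate_injOn (i := j) (k := 0) (l := 1) (by omega) (by omega) h0
    omega
  have hmem : P (v j) ∈ (B j).carrier P ∩ (B (finRotate m j)).carrier P := by
    rw [hB.meet j]; rfl
  exact adjLabel_of_mem hP h1 hne hmem.1 hmem.2

lemma stronglyMutuallyVisible_of_sees {A C : BoundaryPath n} {x y : Plane} (hx : x ∈ A.inner P)
    (hy : y ∈ C.inner P) (h : Sees (complexVertices P) (toComplex x) (toComplex y)) :
    P.StronglyMutuallyVisible A C := by
  have hb : ∀ {D : BoundaryPath n} {w : Plane}, w ∈ D.inner P → w ∈ P.boundary ℝ := by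
    intro D w hw
    obtain ⟨k, -, hk⟩ := mem_carrier_iff.1 hw.1
    exact Set.mem_iUnion.2 ⟨_, hk⟩
  have hseg : ∀ w ∈ segment ℝ x y, w = x ∨ w = y ∨ toComplex w ∈ Inside (complexVertices P) := by
    intro w hw
    rw [segment_eq_image_lineMap] at hw
    obtain ⟨s, ⟨s0, s1⟩, rfl⟩ := hw
    rcases s0.eq_or_lt with rfl | s0
    · left; simp
    rcases s1.eq_or_lt with rfl | s1
    · right; left; simp
    · right; right
      rw [toComplex_lineMap]
      exact h.2 s s0 s1
  refine ⟨x, hx, y, hy, fun w hw => ?_, ?_⟩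
  · rcases hseg w hw with rfl | rfl | h1
    · exact Or.inl (hb hx)
    · exact Or.inl (hb hy)
    · exact mem_region_of_inside h1
  · ext w
    constructor
    · rintro ⟨h1, h2⟩
      rcases hseg w h1 with rfl | rfl | h3
      · exact Or.inl rfl
      · exact Or.inr rfl
      · exact (h3.1 (mem_boundary_iff.1 h2)).elim
    · rintro (rfl | rfl)
      · exact ⟨left_mem_segment .., hb hx⟩
      · exact ⟨right_mem_segment .., hb hy⟩

lemma mem_inner_of_lab {lab : Fin n → Fin m} (hz : SimpleVertices (complexVertices P))
    (h : Labelling B lab) {i : Fin n} {x : Plane}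
    (hx : toComplex x ∈ openEdge (complexVertices P) i) : x ∈ (B (lab i)).inner P := by
  obtain ⟨k, hk, hk'⟩ := h.exists_idx i
  rw [← hk'] at hx
  exact mem_inner_of_openEdge hz hk hx

/-- This admits vertices as ends of sight lines between paths, which the rotating ray needs at
reflex vertices. -/
lemma vertex_mem_inner {lab : Fin n → Fin m} (hz : SimpleVertices (complexVertices P))
    (h : Labelling B lab) {i : Fin n} (hi : lab (finRotate n i) = lab i) :
    P (finRotate n i) ∈ (B (lab i)).inner P := by
  obtain ⟨k, hk, hk'⟩ := h.exists_idx i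
  have hlen := (B (lab i)).len_lt
  have hinj : ∀ {a b : Fin n}, P a = P b → a = b := fun hab =>
    hz.injective (congrArg toComplex hab)
  refine ⟨mem_carrier_iff.2 ⟨k, hk, mem_edgeSet_iff.2 ?_⟩, ?_⟩
  · rw [hk']
    exact right_mem_segment ..
  · rintro (h0 | h0)
    · have h1 := hinj h0
      rw [← hk', ← idx_succ, hk'] at h1
      have := idx_injOn _ (by omega) (by omega) h1
      omega
    · have h1 := hinj h0
      rw [h1] at hi
      exact h.next_ne _ hi

end Partition

end PolygonVisibility

open PolygonVisibility in
theorem proposition2p6 {n m : ℕ} (P : Polygon Plane n) (hP : P.IsSimple) (hm : 4 ≤ m)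
    (B : Fin m → Polygon.BoundaryPath n) (v : Fin m → Fin n)
    (hB : P.IsPartition B v) (hconv : ∀ k : Fin m, (B k).OutwardConvex P) :
    ∃ i j : Fin m, (B i).carrier P ∩ (B j).carrier P = ∅ ∧
      P.StronglyMutuallyVisible (B i) (B j) := by
  by_contra! hno
  have hz := simpleVertices hP
  obtain ⟨σ, ho⟩ := hz.exists_oriented
  obtain ⟨lab, hl⟩ := labelling hP hm hB
  have hadj : ∀ i k, P.StronglyMutuallyVisible (B (lab i)) (B (lab k)) →
      lab i = lab k ∨ AdjLabel lab (lab i) (lab k) := by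
    intro i k hvis
    by_cases heq : lab i = lab k
    · exact Or.inl heq
    · right
      obtain ⟨x, h1, h2⟩ : ((B (lab i)).carrier P ∩ (B (lab k)).carrier P).Nonempty :=
        Set.nonempty_iff_ne_empty.2 fun h0 => hno _ _ h0 hvis
      exact adjLabel_of_mem hP hl.lab_idx heq h1 h2
  refine Counterexample.false (σ := σ) (z := complexVertices P) (B := B) (lab := lab)
    { hl with
      oriented := ho
      reflex := fun i hi => ?_
      edge_sees := fun i k p hp q hq hs => ?_
      vertex_sees := fun i k hi q hq hs => ?_ }
  · apply turn_nonpos_of_isReflex ho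
    obtain ⟨k, hk, hk'⟩ := hl.exists_idx i
    have h1 : (B (lab i)).idx (k + 1) = finRotate n i := by rw [idx_succ, hk']
    rw [← h1]
    refine hconv _ _ (Nat.succ_pos k) ?_
    -- If the edge were the last one of its path, the vertex would start the next path, whose label
    -- is different.
    by_contra hge
    have h2 : k + 1 = (B (lab i)).len := by omega
    apply hl.next_ne (lab i)
    rw [Labelling.next, ← h2, h1, hi]
  · obtain ⟨x, rfl⟩ := toComplex.surjective p
    obtain ⟨y, rfl⟩ := toComplex.surjective q
    exact hadj i k (stronglyMutuallyVisible_of_sees (mem_inner_of_lab hz hl hp)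
      (mem_inner_of_lab hz hl hq) hs)
  · obtain ⟨y, rfl⟩ := toComplex.surjective q
    exact hadj i k (stronglyMutuallyVisible_of_sees (vertex_mem_inner hz hl hi)
      (mem_inner_of_lab hz hl hq) hs)
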